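/- **Theorem 1.2.** Write $e(x)=e^{2\pi i x}$. There are absolute real constants $C_{k\ell j}$ ($0\le \ell<k$, $1\le j\le k-\ell$) such that the following holds. Let $n\ge 2$, and let $C_0,\dots,C_{2n+3}$ be positive constants. Let $\alpha<\gamma<\beta$, let $f$ be a real-valued function that is $2n+3$ times continuously differentiable on $[\alpha,\beta]$, and let $g$ be a real-valued function that is $2n+1$ times continuously differentiable on $[\alpha,\beta]$ (with one-sided derivatives at the endpoints). Assume that there are positive parameters $M,N,T,U$ with $M\ge\beta-\alpha$ such that for all $x\in[\alpha,\beta]$ $$|f^{(r)}(x)|\le C_r\frac{T}{M^r}\ (2\le r\le 2n+3),\qquad f''(x)\ge\frac{T}{C_2M^2},\qquad |g^{(s)}(x)|\le C_s\frac{U}{N^s}\ (0\le s\le 2n+1).$$ Suppose that $f'$ changes sign only at $\gamma$, from negative to positive: $f'<0$ on $[\alpha,\gamma)$ and $f'>0$ on $(\gamma,\beta]$. Put $$\Delta=\min\Big\{\frac{\log 2}{C_2},\ \frac{1}{C_2^2\max_{2\le k\le 2n+3}C_k}\Big\},$$ and suppose that $T$ is so large that $T^{1/(2n+3)}\Delta>1$.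 Let $\lambda_k=f^{(k)}(\gamma)/k!$, $\eta_k=g^{(k)}(\gamma)/k!$, $$\varpi_k=\eta_k+\sum_{\ell=0}^{k-1}\eta_\ell\sum_{j=1}^{k-\ell}\frac{C_{k\ell j}}{\lambda_2^j}\sum_{\substack{3\le n_1,\dots,n_j\le 2n+3\\ n_1+\cdots+n_j=k-\ell+2j}}\lambda_{n_1}\cdots\lambda_{n_j}\qquad(0\le k\le 2n),$$ $$H_1(x)=\frac{g(x)}{2\pi i f'(x)},\qquad H_i(x)=-\frac{H_{i-1}'(x)}{2\pi i f'(x)}\quad(2\le i\le n+1),\ x\ne\gamma .$$ Then $$\int_\alpha^\beta g(x)e(f(x))\,dx=\frac{e(f(\gamma)+\frac18)}{\sqrt{f''(\gamma)}}\Big(g(\gamma)+\sum_{j=1}^n\varpi_{2j}\frac{(-1)^j(2j-1)!!}{(4\pi i\lambda_2)^j}\Big)+\Big[e(f(x))\sum_{i=1}^{n+1}H_i(x)\Big]_\alpha^\beta$$ $$+O\Big(\frac{UM^{2n+5}}{T^{n+2}N^{n+2}}\Big(\frac1{(\gamma-\alpha)^{n+2}}+\frac1{(\beta-\gamma)^{n+2}}\Big)\Big)+O\Big(\frac{UM^{2n+4}}{T^{n+2}}\Big(\frac1{(\gamma-\alpha)^{2n+3}}+\frac1{(\beta-\gamma)^{2n+3}}\Big)\Big)$$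 $$+O\Big(\frac{UM^{2n+4}}{T^{n+2}N^{2n}}\Big(\frac1{(\gamma-\alpha)^{3}}+\frac1{(\beta-\gamma)^{3}}\Big)\Big)+O\Big(\frac{U}{T^{n+1}}\Big(\frac{M^{2n+2}}{N^{2n+1}}+M\Big)\Big),$$ where the implied constants depend only on $n$ and $C_0,\dots,C_{2n+3}$. -/

import Mathlib

open Set MeasureTheory

noncomputable section

namespace StationaryPhase

/-- The additive character `e(x) = exp(2πix)`. -/
def e (x : ℝ) : ℂ := Complex.exp (2 * Real.pi * Complex.I * x)

/-- The `k`-th Taylor coefficient `h^{(k)}(γ)/k!` of a function on `[α, β]`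
(derivatives are taken within `[α, β]`). For `h = f` this is `λ_k`, for `h = g` it is `η_k`. -/
def taylorCoef (α β γ : ℝ) (h : ℝ → ℝ) (k : ℕ) : ℝ :=
  iteratedDerivWithin k h (Icc α β) γ / (k.factorial : ℝ)

/-- The functions `H_1 = g / (2πi f')`, `H_i = - H_{i-1}' / (2πi f')` for `i ≥ 2`, on `[α, β]`
(one-sided derivatives at the endpoints). The index `0` is not used. -/
def H (α β : ℝ) (f g : ℝ → ℝ) : ℕ → ℝ → ℂ
  | 0 => fun _ => 0
  | 1 => fun x =>
      (g x : ℂ) / (2 * Real.pi * Complex.I * ((derivWithin f (Icc α β) x : ℝ) : ℂ))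
  | i + 2 => fun x =>
      -derivWithin (H α β f g (i + 1)) (Icc α β) x /
        (2 * Real.pi * Complex.I * ((derivWithin f (Icc α β) x : ℝ) : ℂ))

/-- All tuples `(n_1, …, n_j)` with `3 ≤ n_i ≤ 2n+3` and `n_1 + ⋯ + n_j = s`. -/
def tuples (n j s : ℕ) : Finset (Fin j → ℕ) :=
  (Fintype.piFinset fun _ : Fin j => Finset.Icc 3 (2 * n + 3)).filter fun m => ∑ i, m i = s

/-- `ϖ_k` as an expression in `λ = lam`, `η = eta` and the coefficients `C_{kℓj} = c k ℓ j`. -/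
def varpi (c : ℕ → ℕ → ℕ → ℝ) (n : ℕ) (lam eta : ℕ → ℝ) (k : ℕ) : ℝ :=
  eta k + ∑ l ∈ Finset.range k, eta l * ∑ j ∈ Finset.Icc 1 (k - l),
    c k l j / lam 2 ^ j * ∑ m ∈ tuples n j (k - l + 2 * j), ∏ i, lam (m i)

/-- `Δ = min { log 2 / C_2, 1 / (C_2² max_{2 ≤ k ≤ 2n+3} C_k) }`. -/
def Delta (n : ℕ) (C : ℕ → ℝ) : ℝ :=
  min (Real.log 2 / C 2)
    (1 / (C 2 ^ 2 *
      (Finset.Icc 2 (2 * n + 3)).sup' (Finset.nonempty_Icc.mpr (by omega)) C))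

/-- The stationary phase main term
`e(f(γ) + 1/8) / √f''(γ) · (g(γ) + ∑_{j=1}^n ϖ_{2j} (-1)^j (2j-1)!! / (4πi λ_2)^j)`. -/
def mainTerm (c : ℕ → ℕ → ℕ → ℝ) (n : ℕ) (α β γ : ℝ) (f g : ℝ → ℝ) : ℂ :=
  e (f γ + 1 / 8) / (Real.sqrt (iteratedDerivWithin 2 f (Icc α β) γ) : ℂ) *
    ((g γ : ℂ) + ∑ j ∈ Finset.Icc 1 n,
      (varpi c n (taylorCoef α β γ f) (taylorCoef α β γ g) (2 * j) : ℂ) *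
        ((-1) ^ j * (Nat.doubleFactorial (2 * j - 1) : ℂ)) /
        (4 * Real.pi * Complex.I * (taylorCoef α β γ f 2 : ℂ)) ^ j)

/-- The function `e(f(x)) ∑_{i=1}^{n+1} H_i(x)` whose increment gives the boundary terms. -/
def boundary (n : ℕ) (α β : ℝ) (f g : ℝ → ℝ) (x : ℝ) : ℂ :=
  e (f x) * ∑ i ∈ Finset.Icc 1 (n + 1), H α β f g i x

end StationaryPhase

end

/-!
Since `f'(γ) = 0 < f''`, the phase has a global Morse coordinate on `[α, β]`: a function `y`
vanishing at `γ` with slope `1` there, such that `f = f(γ) + λ₂ y²`. Write `z = y'`. In this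
coordinate the amplitude `g dx` becomes a function of `y` times `dy`, and its Taylor coefficients in
`y` are the numbers `ϖ_k`. Indeed, if `Y = X Q` is the Taylor series of `y` at `γ`, then
`Q² = 1 + W` with `W = ∑_{m ≥ 3} (λ_m / λ₂) X^{m-2}`, and by Lagrange inversion (a residue
computation) the coefficient of `Y^k Y'` in the expansion of a series `G` is
`[X^k] (G Q^{-(k+1)})`. Expanding `Q^{-(k+1)} = (1 + W)^{-(k+1)/2}` by the binomial series gives
`ϖ_k` with `C_{kℓj} = binom(-(k+1)/2, j)`; this is `X_pow_dvd_sub_varpi`.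

Accordingly `g = ∑_{k ≤ 2n} ϖ_k y^k z + R`, where `R` vanishes to order `2n+1` at `γ`.

* For a monomial, `∫ y^k z e(f) dx = e(f(γ)) ∫_{y(α)}^{y(β)} t^k e(λ₂ t²) dt` exactly. Repeated
  integration by parts and the Fresnel integral give its main term, which is zero for odd `k`, its
  boundary terms, and an error that is a negative power of the end points
  (`exists_monomial_expansion`).
* For `R`, integrate by parts `n+2` times outside the range `|x - γ| ≤ A^{-1/2}`, where `A` is the
  lower bound for `f''`, and estimate trivially inside it; `R = O(|x - γ|^{2n+1})`, together with
  the corresponding bounds for its derivatives, makes everything that is not a boundary term at `α`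
  or `β` of size `A^{-(n+1)}` (`exists_remainder_bound`).

The operator `u ↦ -(u/f')'` that produces the `H_i` is linear in the amplitude, and on `y^k z` it
yields exactly the boundary terms of the monomial integral. Hence the boundary terms of all pieces
add up to those in the theorem (`IsStationaryPhase.exists_expansion_bound`).

All constants must depend on `n` and the `C_r` only. This is organised by `SymbolOn`, a class of
functions with scaled derivative bounds that is stable under products, inverses and square roots
with explicit scaling: `f''` and hence `z` live on the scale `M`, the amplitude `g` on the scale
`N`, and near `γ` the natural scale is `|x - γ|`.
-/

namespace StationaryPhase

/-! ### Taylor coefficients in the Morse coordinate -/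

open PowerSeries in
/-- The residue identity behind Lagrange inversion. With `Y = X * Q` and `P = Q⁻¹`, the coefficient is
the residue of `Y ^ (k - m - 1) * Y'`, which vanishes unless `k = m`. -/
theorem coeff_pow_mul_derivative_mul_pow {P Q : ℝ⟦X⟧} (hPQ : P * Q = 1) (k m : ℕ) :
    coeff m ((X * Q) ^ k * d⁄dX ℝ (X * Q) * P ^ (m + 1)) = if k = m then 1 else 0 := by
  have hder : d⁄dX ℝ (X * Q) = Q + X * d⁄dX ℝ Q := by
    rw [Derivation.leibniz]; simp [smul_eq_mul]; ring
  rcases lt_or_ge m k with hmk | hkm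
  · rw [if_neg (by omega), mul_pow, mul_assoc, mul_assoc, coeff_X_pow_mul', if_neg (by omega)]
  obtain ⟨N, rfl⟩ := Nat.exists_eq_add_of_le hkm
  have h1 : (X * Q) ^ k * d⁄dX ℝ (X * Q) * P ^ (k + N + 1)
      = X ^ k * (P ^ (N + 1) * d⁄dX ℝ (X * Q)) := by
    calc _ = X ^ k * (P * Q) ^ k * (P ^ (N + 1) * d⁄dX ℝ (X * Q)) := by ring
      _ = _ := by rw [hPQ]; simp
  rw [h1, add_comm k N, coeff_X_pow_mul]
  rcases Nat.eq_zero_or_pos N with rfl | hN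
  · rw [if_pos (by omega), hder]
    have : P ^ (0 + 1) * (Q + X * d⁄dX ℝ Q) = 1 + X * (P * d⁄dX ℝ Q) := by
      linear_combination hPQ
    rw [this]; simp
  · rw [if_neg (by omega), hder]
    have hd : P * d⁄dX ℝ Q + Q * d⁄dX ℝ P = 0 := by
      have := congrArg (d⁄dX ℝ) hPQ
      rw [Derivation.leibniz] at this
      simpa [smul_eq_mul] using this
    obtain ⟨L, rfl⟩ : ∃ L, N = L + 1 := ⟨N - 1, by omega⟩
    have h2 : P ^ (L + 1 + 1) * (Q + X * d⁄dX ℝ Q) = P ^ (L + 1) - X * (P ^ L * d⁄dX ℝ P) := by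
      linear_combination (P ^ (L + 1) - X * P ^ L * d⁄dX ℝ P) * hPQ + X * P ^ (L + 1) * hd
    have h3 : d⁄dX ℝ (P ^ (L + 1)) = C ((L : ℝ) + 1) * (P ^ L * d⁄dX ℝ P) := by
      rw [derivative_pow]; simp; ring
    have h4 := coeff_derivative (P ^ (L + 1)) L
    rw [h3, coeff_C_mul] at h4
    have h5 : coeff L (P ^ L * d⁄dX ℝ P) = coeff (L + 1) (P ^ (L + 1)) := by
      have : (L : ℝ) + 1 ≠ 0 := by positivity
      field_simp at h4; linarith
    rw [h2, map_sub, coeff_succ_X_mul, h5, sub_self]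

open PowerSeries in
/-- Lagrange inversion: the coefficient of `Y ^ k * Y'` in the expansion of `G`, where `Y = X * Q` and
`P = Q⁻¹`, is the `k`-th coefficient of `G * P ^ (k + 1)`. -/
theorem X_pow_dvd_sub_lagrange {P Q : ℝ⟦X⟧} (hPQ : P * Q = 1) (G : ℝ⟦X⟧) (r : ℕ) :
    X ^ (r + 1) ∣ G - ∑ k ∈ Finset.range (r + 1),
      C (coeff k (G * P ^ (k + 1))) * ((X * Q) ^ k * d⁄dX ℝ (X * Q)) := by
  set D := G - ∑ k ∈ Finset.range (r + 1),
      C (coeff k (G * P ^ (k + 1))) * ((X * Q) ^ k * d⁄dX ℝ (X * Q)) with hD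
  have hP0 : constantCoeff P ≠ 0 := by
    intro h0
    have := congrArg constantCoeff hPQ
    simp [h0] at this
  have hfun : ∀ m ≤ r, coeff m (D * P ^ (m + 1)) = 0 := by
    intro m hm
    rw [hD, sub_mul, map_sub, Finset.sum_mul, map_sum]
    simp_rw [mul_assoc (C _), coeff_C_mul, coeff_pow_mul_derivative_mul_pow hPQ]
    rw [Finset.sum_eq_single m]
    · simp
    · intro b _ hb; simp [hb]
    · intro h; exact absurd (Finset.mem_range.2 (by omega)) h
  -- the functionals `coeff m (· * P ^ (m + 1))`, `m ≤ r`, are triangular with nonzero diagonal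
  rw [X_pow_dvd_iff]
  intro m
  induction m using Nat.strong_induction_on with
  | _ m ih =>
    intro hm
    have h := hfun m (by omega)
    rw [coeff_mul, Finset.sum_eq_single (m, 0)] at h
    · have h2 : coeff 0 (P ^ (m + 1)) ≠ 0 := by simpa using hP0
      exact (mul_eq_zero.1 h).resolve_right h2
    · rintro ⟨i, j⟩ hij hne
      rw [Finset.HasAntidiagonal.mem_antidiagonal] at hij
      have hi : i < m := by
        rcases Nat.eq_zero_or_pos j with rfl | hj
        · exact absurd (by simp at hij; simp [hij]) hne
        · simp at hij; omega
      rw [ih i hi (by omega), zero_mul]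
    · intro h; simp at h

open PowerSeries in
/-- The formal power series `(1 + X)^{-1/2}`. -/
noncomputable def invSqrtSeries : ℝ⟦X⟧ := binomialSeries ℝ (-(1 / 2) : ℝ)

open PowerSeries in
theorem invSqrtSeries_sq_mul : invSqrtSeries ^ 2 * (1 + X) = 1 := by
  have h := binomialSeries_nat (R := ℝ) (A := ℝ) 1
  rw [pow_one, Nat.cast_one] at h
  rw [← h, invSqrtSeries, sq, ← binomialSeries_add, ← binomialSeries_add]
  norm_num

theorem constantCoeff_invSqrtSeries : PowerSeries.constantCoeff invSqrtSeries = 1 := by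
  simp [invSqrtSeries]

/-- The absolute constants `C_{kℓj} = binom(-(k+1)/2, j)`, as coefficients of `(1 + X)^{-(k+1)/2}`.
They do not depend on `ℓ`. -/
noncomputable def saddleCoef (k _l j : ℕ) : ℝ := PowerSeries.coeff j (invSqrtSeries ^ (k + 1))

open PowerSeries in
/-- Powers of `W = ∑_{m ≥ 3} (λ_m / λ₂) X^{m-2}`, in terms of the sums over tuples in `varpi`. -/
theorem coeff_pow_eq_sum_tuples (n j s : ℕ) (lam : ℕ → ℝ) (W : ℝ⟦X⟧)
    (hW : X ^ 2 * C (lam 2) * W = ∑ m ∈ Finset.Icc 3 (2 * n + 3), C (lam m) * X ^ m)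
    (h2 : lam 2 ≠ 0) :
    coeff s (W ^ j) = 1 / lam 2 ^ j * ∑ m ∈ tuples n j (s + 2 * j), ∏ i, lam (m i) := by
  have h : coeff (s + 2 * j) ((X ^ 2 * C (lam 2) * W) ^ j) = coeff (s + 2 * j)
      ((∑ m ∈ Finset.Icc 3 (2 * n + 3), C (lam m) * X ^ m : ℝ⟦X⟧) ^ j) := by rw [hW]
  have hl : (X ^ 2 * C (lam 2) * W) ^ j = X ^ (2 * j) * (C (lam 2 ^ j) * W ^ j) := by
    rw [mul_pow, mul_pow, ← pow_mul, map_pow, mul_assoc]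
  rw [hl, coeff_X_pow_mul, coeff_C_mul] at h
  have hr : (∑ m ∈ Finset.Icc 3 (2 * n + 3), C (lam m) * X ^ m : ℝ⟦X⟧) ^ j
      = ∑ p ∈ Fintype.piFinset fun _ : Fin j => Finset.Icc 3 (2 * n + 3),
          C (∏ i, lam (p i)) * X ^ (∑ i, p i) := by
    have := Finset.prod_univ_sum (fun _ : Fin j => Finset.Icc 3 (2 * n + 3))
      (fun _ m => (C (lam m) * X ^ m : ℝ⟦X⟧))
    rw [Finset.prod_const, Finset.card_univ, Fintype.card_fin] at this
    rw [this]
    refine Finset.sum_congr rfl fun p _ => ?_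
    rw [Finset.prod_mul_distrib, Finset.prod_pow_eq_pow_sum, map_prod]
  rw [hr, map_sum] at h
  simp_rw [coeff_C_mul, coeff_X_pow, mul_ite, mul_one, mul_zero] at h
  rw [← Finset.sum_filter] at h
  have ht : tuples n j (s + 2 * j) = (Fintype.piFinset fun _ : Fin j => Finset.Icc 3 (2 * n + 3)).filter
      fun m => s + 2 * j = ∑ i, m i := Finset.filter_congr fun _ _ => eq_comm
  rw [ht, ← h]
  field_simp

open PowerSeries in
/-- `ϖ_k` is the `k`-th coefficient of `(∑ η_i X^i) (1 + W)^{-(k+1)/2}`. -/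
theorem coeff_mul_subst_eq_varpi (n : ℕ) (lam eta : ℕ → ℝ) (W : ℝ⟦X⟧)
    (hW : X ^ 2 * C (lam 2) * W = ∑ m ∈ Finset.Icc 3 (2 * n + 3), C (lam m) * X ^ m)
    (hW0 : constantCoeff W = 0) (h2 : lam 2 ≠ 0) (k : ℕ) :
    coeff k (PowerSeries.mk eta * (invSqrtSeries.subst W) ^ (k + 1))
      = varpi saddleCoef n lam eta k := by
  have hs : HasSubst W := HasSubst.of_constantCoeff_zero' hW0
  have hcoef : ∀ s, coeff s ((invSqrtSeries.subst W : ℝ⟦X⟧) ^ (k + 1))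
      = ∑ j ∈ Finset.range (s + 1), saddleCoef k 0 j * coeff s (W ^ j) := by
    intro s
    rw [← subst_pow hs, coeff_subst' hs, finsum_eq_sum_of_support_subset]
    · rfl
    · intro j hj
      rw [Finset.coe_range, mem_Iio]
      by_contra hlt
      apply hj
      have : X ∣ W := X_dvd_iff.2 hW0
      have := pow_dvd_pow_of_dvd this j
      rw [X_pow_dvd_iff] at this
      simp [this s (by omega)]
  rw [coeff_mul, Finset.Nat.sum_antidiagonal_eq_sum_range_succ_mk, Finset.sum_range_succ]
  simp only [coeff_mk, tsub_self]
  rw [hcoef 0, varpi, add_comm]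
  congr 1
  · simp [saddleCoef, constantCoeff_invSqrtSeries]
  · refine Finset.sum_congr rfl fun l hl => ?_
    rw [Finset.mem_range] at hl
    congr 1
    rw [hcoef, ← Finset.sum_subset (s₁ := Finset.Icc 1 (k - l))]
    · refine Finset.sum_congr rfl fun j _ => ?_
      rw [coeff_pow_eq_sum_tuples n j _ lam W hW h2]
      simp only [saddleCoef]
      ring
    · intro j hj
      simp only [Finset.mem_Icc, Finset.mem_range] at hj ⊢
      omega
    · intro j hj hj'
      simp only [Finset.mem_Icc, Finset.mem_range, not_and, not_le] at hj hj'
      have hj0 : j = 0 := by by_contra h; have := hj' (by omega); omega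
      subst hj0
      rw [pow_zero, coeff_one, if_neg (by omega), mul_zero]

open PowerSeries in
theorem X_pow_dvd_derivative {r : ℕ} {F : ℝ⟦X⟧} (h : X ^ (r + 1) ∣ F) : X ^ r ∣ d⁄dX ℝ F := by
  rw [X_pow_dvd_iff] at h ⊢
  intro m hm
  rw [coeff_derivative, h (m + 1) (by omega), zero_mul]

open PowerSeries in
/-- If `λ₂ Y² = λ₂ X² + λ₃ X³ + ⋯`, then the `ϖ_k` are the coefficients of `∑ η_i X^i` with respect to
the system `Y ^ k * Y'`. Only a truncation of `Y` is determined by the hypothesis, which suffices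
for the stated precision. -/
theorem X_pow_dvd_sub_varpi (n : ℕ) (lam eta : ℕ → ℝ) (h2 : lam 2 ≠ 0) (Y : ℝ⟦X⟧)
    (hY0 : constantCoeff Y = 0) (hY1 : coeff 1 Y = 1)
    (hY : X ^ (2 * n + 3) ∣ C (lam 2) * Y ^ 2
      - ∑ m ∈ Finset.Icc 2 (2 * n + 3), C (lam m) * X ^ m) :
    X ^ (2 * n + 1) ∣ PowerSeries.mk eta - ∑ k ∈ Finset.range (2 * n + 1),
      C (varpi saddleCoef n lam eta k) * (Y ^ k * d⁄dX ℝ Y) := by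
  obtain ⟨Q', rfl⟩ := X_dvd_iff.2 hY0
  have hQ'0 : constantCoeff Q' = 1 := by
    have := coeff_succ_X_mul 0 Q'
    rw [hY1] at this
    simpa using this.symm
  set W : ℝ⟦X⟧ := C (1 / lam 2) * ∑ m ∈ Finset.Icc 3 (2 * n + 3), C (lam m) * X ^ (m - 2) with hWdef
  have hC : C (lam 2) * C (1 / lam 2) = (1 : ℝ⟦X⟧) := by
    rw [← map_mul, mul_one_div_cancel h2, map_one]
  have hW : X ^ 2 * C (lam 2) * W = ∑ m ∈ Finset.Icc 3 (2 * n + 3), C (lam m) * X ^ m := by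
    calc X ^ 2 * C (lam 2) * W = (C (lam 2) * C (1 / lam 2)) *
          (X ^ 2 * ∑ m ∈ Finset.Icc 3 (2 * n + 3), C (lam m) * X ^ (m - 2)) := by
            rw [hWdef]; ring
      _ = _ := by
        rw [hC, one_mul, Finset.mul_sum]
        refine Finset.sum_congr rfl fun m hm => ?_
        rw [Finset.mem_Icc] at hm
        obtain ⟨i, rfl⟩ := Nat.exists_eq_add_of_le hm.1
        rw [show 3 + i - 2 = i + 1 by omega]
        ring
  have hW0 : constantCoeff W = 0 := by
    rw [hWdef, map_mul, map_sum]
    rw [Finset.sum_eq_zero, mul_zero]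
    intro m hm
    rw [Finset.mem_Icc] at hm
    simp [show m - 2 ≠ 0 by omega]
  have hs : HasSubst W := HasSubst.of_constantCoeff_zero' hW0
  set P : ℝ⟦X⟧ := invSqrtSeries.subst W with hP
  have hP2 : P ^ 2 * (1 + W) = 1 := by
    have := congrArg (PowerSeries.substAlgHom hs) invSqrtSeries_sq_mul
    rw [map_mul, map_pow, map_add, map_one, substAlgHom_X] at this
    rwa [coe_substAlgHom] at this
  -- `Q` is the square root of `1 + W`, so that `X * Q` is an exact solution of the equation for `Y`
  set Q := P * (1 + W) with hQ
  have hPQ : P * Q = 1 := by rw [hQ]; linear_combination hP2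
  have hQ2 : Q ^ 2 = 1 + W := by
    rw [hQ]; linear_combination (1 + W) * hP2
  have hP0 : constantCoeff P = 1 := by
    have h0 := coeff_mul_subst_eq_varpi n lam (fun _ => 1) W hW hW0 h2 0
    rw [← hP] at h0
    simpa [varpi] using h0
  have hQ0 : constantCoeff Q = 1 := by
    rw [hQ]; simp [hP0, hW0]
  -- the cofactor of `Y` is a square root of `1 + W` modulo `X ^ (2 * n + 1)`; as its constant
  -- coefficient is that of `Q`, it agrees with `Q` rather than with `-Q`
  have hdvd : X ^ (2 * n + 1) ∣ Q' - Q := by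
    have hsum : ∑ m ∈ Finset.Icc 2 (2 * n + 3), C (lam m) * X ^ m
        = C (lam 2) * X ^ 2 + ∑ m ∈ Finset.Icc 3 (2 * n + 3), (C (lam m) * X ^ m : ℝ⟦X⟧) := by
      rw [← Finset.add_sum_Ioc_eq_sum_Icc (by omega)]
      rfl
    rw [hsum, ← hW, show 2 * n + 3 = 2 + (2 * n + 1) by ring, pow_add] at hY
    have e1 : C (lam 2) * (X * Q') ^ 2 - (C (lam 2) * X ^ 2 + X ^ 2 * C (lam 2) * W)
        = X ^ 2 * (C (lam 2) * ((Q' - Q) * (Q' + Q))) := by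
      linear_combination X ^ 2 * C (lam 2) * hQ2
    rw [e1] at hY
    have h3 := (mul_dvd_mul_iff_left (pow_ne_zero 2 X_ne_zero)).1 hY
    have hu1 : IsUnit (C (lam 2) : ℝ⟦X⟧) := by
      rw [isUnit_iff_constantCoeff]; simpa using h2
    have hu2 : IsUnit (Q' + Q) := by
      rw [isUnit_iff_constantCoeff]; simp [hQ'0, hQ0]
    rw [hu1.dvd_mul_left, hu2.dvd_mul_right] at h3
    exact h3
  have hYd : X ^ (2 * n + 2) ∣ X * Q' - X * Q := by
    rw [← mul_sub, show 2 * n + 2 = (2 * n + 1) + 1 by ring, pow_succ']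
    exact mul_dvd_mul_left _ hdvd
  have hdd : X ^ (2 * n + 1) ∣ d⁄dX ℝ (X * Q') - d⁄dX ℝ (X * Q) := by
    rw [← map_sub]; exact X_pow_dvd_derivative hYd
  have hmain := X_pow_dvd_sub_lagrange hPQ (PowerSeries.mk eta) (2 * n)
  have hdiff : X ^ (2 * n + 1) ∣ ∑ k ∈ Finset.range (2 * n + 1),
      C (varpi saddleCoef n lam eta k) * ((X * Q') ^ k * d⁄dX ℝ (X * Q') -
        (X * Q) ^ k * d⁄dX ℝ (X * Q)) := by
    refine Finset.dvd_sum fun k _ => Dvd.dvd.mul_left ?_ _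
    have h4 : X ^ (2 * n + 1) ∣ (X * Q') ^ k - (X * Q) ^ k :=
      ((pow_dvd_pow _ (by omega)).trans hYd).trans (sub_dvd_pow_sub_pow _ _ _)
    have e2 : (X * Q') ^ k * d⁄dX ℝ (X * Q') - (X * Q) ^ k * d⁄dX ℝ (X * Q)
        = ((X * Q') ^ k - (X * Q) ^ k) * d⁄dX ℝ (X * Q')
          + (X * Q) ^ k * (d⁄dX ℝ (X * Q') - d⁄dX ℝ (X * Q)) := by ring
    rw [e2]
    exact dvd_add (h4.mul_right _) (hdd.mul_left _)
  have := dvd_sub hmain hdiff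
  refine this.trans (dvd_of_eq ?_)
  rw [sub_sub, ← Finset.sum_add_distrib]
  congr 1
  refine Finset.sum_congr rfl fun k _ => ?_
  rw [coeff_mul_subst_eq_varpi n lam eta W hW hW0 h2]
  ring

/-! ### Symbol classes and segment averages -/

/-- `SymbolOn S r A ω u`: the function `u` is of class `C^r` on `S`, of size `A`, and each derivative
up to order `r` costs a factor `1 / ω`. Size and scale may vary with the point. -/
def SymbolOn (S : Set ℝ) (r : ℕ) (A ω : ℝ → ℝ) (u : ℝ → ℝ) : Prop :=
  ContDiffOn ℝ r u S ∧ ∀ k ≤ r, ∀ x ∈ S, |iteratedDerivWithin k u S x| ≤ A x / ω x ^ k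

namespace SymbolOn

variable {S : Set ℝ} {r : ℕ} {A B ω : ℝ → ℝ} {u v : ℝ → ℝ}

theorem abs_le (h : SymbolOn S r A ω u) {x : ℝ} (hx : x ∈ S) : |u x| ≤ A x := by
  simpa using h.2 0 (Nat.zero_le _) x hx

theorem of_le {r' : ℕ} (h : SymbolOn S r A ω u) (hr : r' ≤ r) : SymbolOn S r' A ω u :=
  ⟨h.1.of_le (by exact_mod_cast hr), fun k hk => h.2 k (hk.trans hr)⟩

theorem mono (h : SymbolOn S r A ω u) {A' ω' : ℝ → ℝ} (hω' : ∀ x ∈ S, 0 < ω' x)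
    (hω : ∀ x ∈ S, ω' x ≤ ω x) (hA : ∀ x ∈ S, A x ≤ A' x) : SymbolOn S r A' ω' u := by
  refine ⟨h.1, fun k hk x hx => (h.2 k hk x hx).trans ?_⟩
  have h0 : 0 ≤ A x := (abs_nonneg _).trans (h.abs_le hx)
  have := hω' x hx
  have := hω x hx
  have := hA x hx
  gcongr
  linarith

theorem mono_left (h : SymbolOn S r A ω u) {A' : ℝ → ℝ} (hω : ∀ x ∈ S, 0 < ω x)
    (hA : ∀ x ∈ S, A x ≤ A' x) : SymbolOn S r A' ω u :=
  h.mono hω (fun _ _ => le_rfl) hA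

theorem congr (h : SymbolOn S r A ω u) (huv : EqOn v u S) : SymbolOn S r A ω v :=
  ⟨h.1.congr huv, fun k hk x hx => by rw [iteratedDerivWithin_congr huv hx]; exact h.2 k hk x hx⟩

theorem succ_iff (hS : UniqueDiffOn ℝ S) :
    SymbolOn S (r + 1) A ω u ↔ DifferentiableOn ℝ u S ∧ (∀ x ∈ S, |u x| ≤ A x) ∧
      SymbolOn S r (fun x => A x / ω x) ω (derivWithin u S) := by
  constructor
  · intro h
    have h1 := h.1
    rw [Nat.cast_succ, contDiffOn_succ_iff_derivWithin hS] at h1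
    refine ⟨h1.1, fun x hx => h.abs_le hx, h1.2.2, fun k hk x hx => ?_⟩
    rw [← iteratedDerivWithin_succ', div_div, ← pow_succ']
    exact h.2 (k + 1) (by omega) x hx
  · rintro ⟨h1, h2, h3⟩
    refine ⟨?_, fun k hk x hx => ?_⟩
    · rw [Nat.cast_succ, contDiffOn_succ_iff_derivWithin hS]
      exact ⟨h1, by simp, h3.1⟩
    · rcases k with _ | k
      · simpa using h2 x hx
      · have := h3.2 k (by omega) x hx
        rwa [← iteratedDerivWithin_succ', div_div, ← pow_succ'] at this

theorem zero_iff : SymbolOn S 0 A ω u ↔ ContinuousOn u S ∧ ∀ x ∈ S, |u x| ≤ A x := by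
  constructor
  · intro h
    exact ⟨h.1.continuousOn, fun x hx => h.abs_le hx⟩
  · rintro ⟨h1, h2⟩
    refine ⟨by simpa using h1, fun k hk x hx => ?_⟩
    obtain rfl : k = 0 := by omega
    simpa using h2 x hx

theorem const_mul (hS : UniqueDiffOn ℝ S) (hu : SymbolOn S r A ω u) (a : ℝ) :
    SymbolOn S r (fun x => |a| * A x) ω (fun x => a * u x) := by
  refine ⟨contDiffOn_const.mul hu.1, fun k hk x hx => ?_⟩
  have hk' : (k : WithTop ℕ∞) ≤ r := by exact_mod_cast hk
  rw [iteratedDerivWithin_const_mul hx hS a ((hu.1 x hx).of_le hk'), abs_mul, mul_div_assoc]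
  exact mul_le_mul_of_nonneg_left (hu.2 k hk x hx) (abs_nonneg _)

/-- Leibniz' rule; the sum of the binomial coefficients accounts for the factor `2 ^ r`. -/
theorem mul (hS : UniqueDiffOn ℝ S) (hω : ∀ x ∈ S, 0 < ω x) (hu : SymbolOn S r A ω u)
    (hv : SymbolOn S r B ω v) :
    SymbolOn S r (fun x => 2 ^ r * (A x * B x)) ω (fun x => u x * v x) := by
  refine ⟨hu.1.mul hv.1, fun k hk x hx => ?_⟩
  have hk' : (k : WithTop ℕ∞) ≤ r := by exact_mod_cast hk
  have hω := hω x hx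
  have hA : 0 ≤ A x := (abs_nonneg _).trans (hu.abs_le hx)
  have hB : 0 ≤ B x := (abs_nonneg _).trans (hv.abs_le hx)
  have h := iteratedDerivWithin_mul hx hS ((hu.1 x hx).of_le hk') ((hv.1 x hx).of_le hk')
  change |iteratedDerivWithin k (u * v) S x| ≤ _
  rw [h]
  calc _ ≤ ∑ i ∈ Finset.range (k + 1), (k.choose i : ℝ) * (A x * B x / ω x ^ k) := by
        refine (Finset.abs_sum_le_sum_abs _ _).trans (Finset.sum_le_sum fun i hi => ?_)
        rw [Finset.mem_range] at hi
        rw [abs_mul, abs_mul, Nat.abs_cast, mul_assoc]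
        refine mul_le_mul_of_nonneg_left ?_ (Nat.cast_nonneg _)
        have e1 : A x * B x / ω x ^ k = A x / ω x ^ i * (B x / ω x ^ (k - i)) := by
          rw [div_mul_div_comm, ← pow_add, show i + (k - i) = k by omega]
        rw [e1]
        exact mul_le_mul (hu.2 i (by omega) x hx) (hv.2 (k - i) (by omega) x hx) (abs_nonneg _)
          (by positivity)
    _ = 2 ^ k * (A x * B x) / ω x ^ k := by
        rw [← Finset.sum_mul, ← Nat.cast_sum, Nat.sum_range_choose, Nat.cast_pow, Nat.cast_ofNat]
        ring
    _ ≤ _ := by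
        have : (2 : ℝ) ^ k ≤ 2 ^ r := pow_le_pow_right₀ (by norm_num) hk
        change _ ≤ 2 ^ r * (A x * B x) / ω x ^ k
        gcongr

theorem pow (hS : UniqueDiffOn ℝ S) (hω : ∀ x ∈ S, 0 < ω x) (hu : SymbolOn S r A ω u) (k : ℕ) :
    SymbolOn S r (fun x => (2 ^ r * A x) ^ k) ω (fun x => u x ^ k) := by
  induction k with
  | zero =>
    refine ⟨by simpa using contDiffOn_const, fun k hk x hx => ?_⟩
    have := hω x hx
    simp only [pow_zero, iteratedDerivWithin_const]
    split_ifs with h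
    · simp [h]
    · simp; positivity
  | succ k ih =>
    have := ih.mul hS hω hu
    simp_rw [pow_succ]
    refine this.mono_left hω fun x hx => le_of_eq (by ring)

/-- Inverses of symbols bounded below by a multiple of their size. The constant is independent of the
set, the size and the scale. -/
theorem exists_inv (r : ℕ) (c : ℝ) : ∃ K > 0, ∀ (S : Set ℝ) (A ω u : ℝ → ℝ), UniqueDiffOn ℝ S →
    (∀ x ∈ S, 0 < A x) → (∀ x ∈ S, 0 < ω x) → SymbolOn S r (fun x => c * A x) ω u →
    (∀ x ∈ S, A x ≤ |u x|) → SymbolOn S r (fun x => K / A x) ω (fun x => (u x)⁻¹) := by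
  have key : ∀ (S : Set ℝ) (A u : ℝ → ℝ), (∀ x ∈ S, 0 < A x) →
    (∀ x ∈ S, A x ≤ |u x|) → ∀ x ∈ S, |(u x)⁻¹| ≤ 1 / A x := by
    intro S A u hA hl x hx
    rw [abs_inv, ← one_div]
    exact one_div_le_one_div_of_le (hA x hx) (hl x hx)
  induction r with
  | zero =>
    refine ⟨1, one_pos, fun S A ω u hS hA hω hu hl => ?_⟩
    rw [zero_iff] at hu ⊢
    refine ⟨hu.1.inv₀ fun x hx => ?_, key S A u hA hl⟩
    exact abs_pos.1 ((hA x hx).trans_le (hl x hx))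
  | succ r ih =>
    obtain ⟨K, hK, ih⟩ := ih
    refine ⟨1 + 2 ^ r * (2 ^ r * (|c| * (K * K))), by positivity, fun S A ω u hS hA hω hu hl => ?_⟩
    have hne : ∀ x ∈ S, u x ≠ 0 := fun x hx => abs_pos.1 ((hA x hx).trans_le (hl x hx))
    have hi := ih S A ω u hS hA hω (hu.of_le (by omega)) hl
    rw [succ_iff hS] at hu ⊢
    refine ⟨hu.1.inv hne, fun x hx => (key S A u hA hl x hx).trans ?_, ?_⟩
    · have := hA x hx
      gcongr
      have : 0 ≤ (2 : ℝ) ^ r * (2 ^ r * (|c| * (K * K))) := by positivity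
      linarith
    · have h1 := ((hu.2.2.mul hS hω (hi.mul hS hω hi)).const_mul hS (-1))
      refine (h1.congr fun x hx => ?_).mono_left hω fun x hx => ?_
      · rw [derivWithin_fun_inv' (hu.1 x hx) (hne x hx)]
        field_simp
      · have := hA x hx
        have := hω x hx
        have hc := le_abs_self c
        rw [abs_neg, abs_one, one_mul]
        calc _ = 2 ^ r * (2 ^ r * (c * (K * K))) / (A x * ω x) := by field_simp
          _ ≤ (1 + 2 ^ r * (2 ^ r * (|c| * (K * K)))) / (A x * ω x) := by
            gcongr
            have : (2 : ℝ) ^ r * (2 ^ r * (c * (K * K))) ≤ 2 ^ r * (2 ^ r * (|c| * (K * K))) := by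
              gcongr
            linarith
          _ = _ := by field_simp

theorem exists_sqrt (r : ℕ) {a : ℝ} (ha : 0 < a) (c : ℝ) : ∃ K > 0, ∀ (S : Set ℝ) (ω u : ℝ → ℝ),
    UniqueDiffOn ℝ S → (∀ x ∈ S, 0 < ω x) → SymbolOn S r (fun _ => c) ω u → (∀ x ∈ S, a ≤ u x) →
    SymbolOn S r (fun _ => K) ω (fun x => √(u x)) := by
  induction r with
  | zero =>
    refine ⟨√c + 1, by positivity, fun S ω u hS hω hu hl => ?_⟩
    rw [zero_iff] at hu ⊢
    refine ⟨hu.1.sqrt, fun x hx => ?_⟩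
    rw [abs_of_nonneg (Real.sqrt_nonneg _)]
    have := Real.sqrt_le_sqrt ((le_abs_self _).trans (hu.2 x hx))
    linarith
  | succ r ih =>
    obtain ⟨K, hK, ih⟩ := ih
    have hsa : 0 < √a := Real.sqrt_pos.2 ha
    obtain ⟨K₂, hK₂, hinv⟩ := exists_inv r (K / √a)
    refine ⟨√c + 1 + 2 ^ r * (|c| * (K₂ / √a)), by positivity,
      fun S ω u hS hω hu hl => ?_⟩
    have hs := ih S ω u hS hω (hu.of_le (by omega)) hl
    have hi := hinv S (fun _ => √a) ω _ hS (fun _ _ => hsa) hω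
      (hs.mono_left hω fun x _ => le_of_eq (by field_simp))
      (fun x hx => by rw [abs_of_nonneg (Real.sqrt_nonneg _)]; exact Real.sqrt_le_sqrt (hl x hx))
    have hpos : ∀ x ∈ S, 0 < u x := fun x hx => ha.trans_le (hl x hx)
    rw [succ_iff hS] at hu ⊢
    have h3 : 0 ≤ 2 ^ r * (|c| * (K₂ / √a)) := by positivity
    have h4 := Real.sqrt_nonneg c
    refine ⟨hu.1.sqrt fun x hx => (hpos x hx).ne', fun x hx => ?_, ?_⟩
    · rw [abs_of_nonneg (Real.sqrt_nonneg _)]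
      have := Real.sqrt_le_sqrt ((le_abs_self _).trans (hu.2.1 x hx))
      linarith
    · have h1 := (hu.2.2.mul hS hω hi).const_mul hS (1 / 2)
      refine (h1.congr fun x hx => ?_).mono_left hω fun x hx => ?_
      · rw [derivWithin_sqrt (hu.1 x hx) (hpos x hx).ne' (hS x hx)]
        field_simp
      · have := hω x hx
        have hc := le_abs_self c
        rw [abs_of_pos (by norm_num : (0 : ℝ) < 1 / 2)]
        calc _ = (1 / 2) * (2 ^ r * (c * (K₂ / √a))) / ω x := by field_simp
          _ ≤ _ := by
            gcongr
            have : (2 : ℝ) ^ r * (c * (K₂ / √a)) ≤ 2 ^ r * (|c| * (K₂ / √a)) := by gcongr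
            linarith

end SymbolOn

/-- A `C¹` function on `[α, β]` extends to a `C¹` function on `ℝ` with bounded derivative. This turns
one-sided derivatives at the end points into derivatives. -/
theorem exists_hasDerivAt_extension {α β γ : ℝ} (hγ : γ ∈ Icc α β) {w : ℝ → ℝ}
    (hd : DifferentiableOn ℝ w (Icc α β)) (hc : ContinuousOn (derivWithin w (Icc α β)) (Icc α β)) :
    ∃ W c : ℝ → ℝ, Continuous c ∧ (∀ x, HasDerivAt W (c x) x) ∧ EqOn W w (Icc α β) ∧
      EqOn c (derivWithin w (Icc α β)) (Icc α β) ∧ (∃ K, ∀ x, |c x| ≤ K) ∧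
      ∀ x, W x - W γ = ∫ t in γ..x, c t := by
  have hle : α ≤ β := hγ.1.trans hγ.2
  set c := IccExtend hle ((Icc α β).domRestrict (derivWithin w (Icc α β))) with hcdef
  have hcc : Continuous c := hc.domRestrict.Icc_extend'
  have hceq : EqOn c (derivWithin w (Icc α β)) (Icc α β) := fun x hx => by
    rw [hcdef, IccExtend_of_mem _ _ hx]; rfl
  have hW : ∀ x, HasDerivAt (fun x => w γ + ∫ t in γ..x, c t) (c x) x := fun x =>
    (intervalIntegral.integral_hasDerivAt_right (hcc.intervalIntegrable _ _)
      (hcc.stronglyMeasurableAtFilter _ _) hcc.continuousAt).const_add _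
  refine ⟨fun x => w γ + ∫ t in γ..x, c t, c, hcc, hW, fun x hx => ?_, hceq, ?_, by simp⟩
  · have h0 : ∀ y ∈ Icc α β, HasDerivWithinAt (fun x => (w γ + ∫ t in γ..x, c t) - w x) 0
        (Icc α β) y := fun y hy => by
      have := (hW y).hasDerivWithinAt.sub (hd y hy).hasDerivWithinAt (s := Icc α β)
      rwa [hceq hy, sub_self] at this
    have := (convex_Icc α β).norm_image_sub_le_of_norm_hasDerivWithin_le h0
      (C := 0) (by simp) hγ hx
    simp only [intervalIntegral.integral_same, add_zero, sub_self, zero_mul, sub_zero,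
      norm_le_zero_iff] at this
    simpa using sub_eq_zero.1 this
  · obtain ⟨K, hK⟩ := isCompact_Icc.exists_bound_of_continuousOn hc
    refine ⟨K, fun x => ?_⟩
    exact hK (projIcc α β hle x) (projIcc α β hle x).2

/-- The weighted average `∫₀¹ t^j w(γ + t (x - γ)) dt` of `w` over the segment from `γ` to `x`. It is
the integral form of the divided differences of a primitive of `w` at `γ`, without a division by
`x - γ`, and so inherits its regularity and bounds from `w` on all of `[α, β]`. -/
noncomputable def segmentMean (γ : ℝ) (j : ℕ) (w : ℝ → ℝ) (x : ℝ) : ℝ :=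
  ∫ t in (0 : ℝ)..1, t ^ j * w (γ + t * (x - γ))

theorem segment_mem_Icc {α β γ x t : ℝ} (hγ : γ ∈ Icc α β) (hx : x ∈ Icc α β)
    (ht : t ∈ Icc (0 : ℝ) 1) : γ + t * (x - γ) ∈ Icc α β := by
  have := (convex_Icc α β).add_smul_sub_mem hγ hx ht
  simpa using this

theorem segmentMean_congr {α β γ x : ℝ} {j : ℕ} {w w' : ℝ → ℝ} (hγ : γ ∈ Icc α β)
    (hx : x ∈ Icc α β) (h : EqOn w w' (Icc α β)) : segmentMean γ j w x = segmentMean γ j w' x := by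
  refine intervalIntegral.integral_congr fun t ht => ?_
  rw [uIcc_of_le zero_le_one] at ht
  simp only [h (segment_mem_Icc hγ hx ht)]

theorem continuousOn_segmentMean {α β γ : ℝ} {j : ℕ} {w : ℝ → ℝ} (hγ : γ ∈ Icc α β)
    (hc : ContinuousOn w (Icc α β)) : ContinuousOn (segmentMean γ j w) (Icc α β) := by
  have hle : α ≤ β := hγ.1.trans hγ.2
  set c := IccExtend hle ((Icc α β).domRestrict w) with hcdef
  have hcc : Continuous c := hc.domRestrict.Icc_extend'
  have hceq : EqOn w c (Icc α β) := fun x hx => by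
    rw [hcdef, IccExtend_of_mem _ _ hx]; rfl
  have : Continuous (segmentMean γ j c) := by
    unfold segmentMean
    refine intervalIntegral.continuous_parametric_intervalIntegral_of_continuous' ?_ 0 1
    fun_prop
  exact this.continuousOn.congr fun x hx => segmentMean_congr hγ hx hceq

theorem hasDerivWithinAt_segmentMean {α β γ x : ℝ} {j : ℕ} {w : ℝ → ℝ} (hγ : γ ∈ Icc α β)
    (hd : DifferentiableOn ℝ w (Icc α β)) (hc : ContinuousOn (derivWithin w (Icc α β)) (Icc α β))
    (hx : x ∈ Icc α β) : HasDerivWithinAt (segmentMean γ j w)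
      (segmentMean γ (j + 1) (derivWithin w (Icc α β)) x) (Icc α β) x := by
  obtain ⟨W, c, hcc, hW, hWw, hceq, ⟨K, hK⟩, -⟩ := exists_hasDerivAt_extension hγ hd hc
  have hWc : Continuous W := continuous_iff_continuousAt.2 fun x => (hW x).continuousAt
  have hmain : HasDerivAt (segmentMean γ j W) (segmentMean γ (j + 1) c x) x := by
    refine (intervalIntegral.hasDerivAt_integral_of_dominated_loc_of_deriv_le
      (F := fun x t => t ^ j * W (γ + t * (x - γ)))
      (F' := fun x t => t ^ (j + 1) * c (γ + t * (x - γ)))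
      (bound := fun _ => K) Filter.univ_mem ?_ ?_ ?_ ?_ ?_ ?_).2
    · exact Filter.Eventually.of_forall fun y => Continuous.aestronglyMeasurable (by fun_prop)
    · exact Continuous.intervalIntegrable (by fun_prop) _ _
    · exact Continuous.aestronglyMeasurable (by fun_prop)
    · refine Filter.Eventually.of_forall fun t ht y _ => ?_
      rw [uIoc_of_le zero_le_one] at ht
      rw [norm_mul, norm_pow, Real.norm_eq_abs, Real.norm_eq_abs, abs_of_pos ht.1]
      calc _ ≤ 1 * |c (γ + t * (y - γ))| := by
            gcongr
            exact pow_le_one₀ ht.1.le ht.2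
        _ ≤ K := by rw [one_mul]; exact hK _
    · simp
    · refine Filter.Eventually.of_forall fun t _ y _ => ?_
      have h1 : HasDerivAt (fun y => γ + t * (y - γ)) t y := by
        simpa using (((hasDerivAt_id y).sub_const γ).const_mul t).const_add γ
      have := ((hW (γ + t * (y - γ))).comp y h1).const_mul (t ^ j)
      rw [show t ^ (j + 1) * c (γ + t * (y - γ)) = t ^ j * (c (γ + t * (y - γ)) * t) by ring]
      exact this
  have h2 := hmain.hasDerivWithinAt (s := Icc α β)
  rw [segmentMean_congr hγ hx hceq] at h2
  exact h2.congr (fun y hy => segmentMean_congr hγ hy hWw.symm) (segmentMean_congr hγ hx hWw.symm)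

theorem sub_eq_mul_segmentMean {α β γ x : ℝ} {w : ℝ → ℝ} (hγ : γ ∈ Icc α β)
    (hd : DifferentiableOn ℝ w (Icc α β)) (hc : ContinuousOn (derivWithin w (Icc α β)) (Icc α β))
    (hx : x ∈ Icc α β) :
    w x - w γ = (x - γ) * segmentMean γ 0 (derivWithin w (Icc α β)) x := by
  obtain ⟨W, c, hcc, hW, hWw, hceq, -, hint⟩ := exists_hasDerivAt_extension hγ hd hc
  rw [← hWw hx, ← hWw hγ, hint, ← segmentMean_congr hγ hx hceq, segmentMean]
  have := intervalIntegral.smul_integral_comp_add_mul (a := 0) (b := 1) c (x - γ) γ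
  simp only [smul_eq_mul, mul_zero, add_zero, mul_one, add_sub_cancel] at this
  rw [← this]
  congr 1
  refine intervalIntegral.integral_congr fun t _ => ?_
  simp [mul_comm]

theorem SymbolOn.segmentMean {α β γ : ℝ} (hlt : α < β) (hγ : γ ∈ Icc α β) {r : ℕ} {A L : ℝ}
    {w : ℝ → ℝ} (h : SymbolOn (Icc α β) r (fun _ => A) (fun _ => L) w) (j : ℕ) :
    SymbolOn (Icc α β) r (fun _ => A) (fun _ => L) (segmentMean γ j w) := by
  have hS := uniqueDiffOn_Icc hlt
  have hb : ∀ (j : ℕ) (A : ℝ) (w : ℝ → ℝ), (∀ x ∈ Icc α β, |w x| ≤ A) →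
      ∀ x ∈ Icc α β, |StationaryPhase.segmentMean γ j w x| ≤ A := by
    intro j A w hw x hx
    have := intervalIntegral.norm_integral_le_of_norm_le_const (a := 0) (b := 1) (C := A)
      (f := fun t : ℝ => t ^ j * w (γ + t * (x - γ))) ?_
    · simpa [StationaryPhase.segmentMean] using this
    · intro t ht
      rw [uIoc_of_le zero_le_one] at ht
      have h1 := hw _ (segment_mem_Icc hγ hx ⟨ht.1.le, ht.2⟩)
      rw [norm_mul, norm_pow, Real.norm_eq_abs, Real.norm_eq_abs, abs_of_pos ht.1]
      calc _ ≤ 1 * |w (γ + t * (x - γ))| := by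
            gcongr
            exact pow_le_one₀ ht.1.le ht.2
        _ ≤ A := by rwa [one_mul]
  induction r generalizing j A w with
  | zero =>
    rw [SymbolOn.zero_iff] at h ⊢
    exact ⟨continuousOn_segmentMean hγ h.1, hb j A w h.2⟩
  | succ r ih =>
    rw [SymbolOn.succ_iff hS] at h ⊢
    have hder := fun x hx => hasDerivWithinAt_segmentMean (j := j) (x := x) hγ h.1
      h.2.2.1.continuousOn hx
    refine ⟨fun x hx => (hder x hx).differentiableWithinAt, hb j A w h.2.1, ?_⟩
    exact (ih h.2.2 (j + 1)).congr fun x hx => (hder x hx).derivWithin (hS x hx)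

theorem le_segmentMean {α β γ x a b : ℝ} {j : ℕ} {w : ℝ → ℝ} (hγ : γ ∈ Icc α β)
    (hc : ContinuousOn w (Icc α β)) (hx : x ∈ Icc α β) (hw : ∀ x ∈ Icc α β, a ≤ w x)
    (hb : b * (j + 1) ≤ a) : b ≤ segmentMean γ j w x := by
  have hcont : ContinuousOn (fun t : ℝ => t ^ j * w (γ + t * (x - γ))) (Icc 0 1) := by
    refine (continuousOn_pow j).mul (hc.comp (by fun_prop) fun t ht => segment_mem_Icc hγ hx ht)
  have := intervalIntegral.integral_mono_on (μ := volume) (a := (0 : ℝ)) (b := 1) zero_le_one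
    (f := fun t => t ^ j * a) (Continuous.intervalIntegrable (by fun_prop) _ _)
    (hcont.intervalIntegrable_of_Icc zero_le_one)
    (fun t ht => mul_le_mul_of_nonneg_left (hw _ (segment_mem_Icc hγ hx ht)) (pow_nonneg ht.1 j))
  refine le_trans ?_ this
  rw [intervalIntegral.integral_mul_const, integral_pow]
  simp
  field_simp
  exact hb

/-! ### Monomial amplitudes against a quadratic phase -/

section Fresnel

open Complex Filter Topology

theorem norm_cexp_neg_mul_sq_le_one {b : ℂ} (hb : 0 ≤ b.re) (t : ℝ) : ‖cexp (-b * (t : ℂ) ^ 2)‖ ≤ 1 := by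
  rw [norm_cexp_neg_mul_sq, Real.exp_le_one_iff]
  have := mul_nonneg hb (sq_nonneg t)
  linarith

theorem integrableOn_Ioi_one_cexp_div {b : ℂ} (hb : 0 ≤ b.re) :
    IntegrableOn (fun t : ℝ => cexp (-b * (t : ℂ) ^ 2) / (2 * b * (t : ℂ) ^ 2)) (Ioi 1) := by
  have h1 : IntegrableOn (fun t : ℝ => t ^ (-2 : ℝ) * (1 / ‖2 * b‖)) (Ioi 1) :=
    (integrableOn_Ioi_rpow_of_lt (by norm_num) one_pos).mul_const _
  refine h1.mono' ?_ ?_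
  · refine (ContinuousOn.aestronglyMeasurable ?_ measurableSet_Ioi)
    rcases eq_or_ne b 0 with rfl | hb0
    · simp; exact continuousOn_const
    · refine ContinuousOn.div (by fun_prop) (by fun_prop) fun t ht => ?_
      have : (t : ℂ) ≠ 0 := by exact_mod_cast (one_pos.trans ht).ne'
      simp [hb0, this]
  · rw [ae_restrict_iff' measurableSet_Ioi]
    refine Eventually.of_forall fun t ht => ?_
    have ht0 : (0 : ℝ) < t := one_pos.trans ht
    rw [norm_div, norm_mul, norm_pow, norm_real, Real.norm_of_nonneg ht0.le, Real.rpow_neg ht0.le]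
    rw [show (2 : ℝ) = ((2 : ℕ) : ℝ) by norm_num, Real.rpow_natCast]
    have := norm_cexp_neg_mul_sq_le_one hb t
    calc _ ≤ 1 / (‖2 * b‖ * t ^ 2) := by gcongr
      _ = _ := by rw [one_div, mul_inv]; ring

/-- Conditional convergence of the Gaussian integral on the closed half plane `0 ≤ re b`. One
integration by parts makes the tail absolutely convergent, uniformly up to the imaginary axis. -/
theorem tendsto_integral_cexp_neg_mul_sq {b : ℂ} (hb : 0 ≤ b.re) (hb0 : b ≠ 0) :
    Tendsto (fun B : ℝ => ∫ t in (0 : ℝ)..B, cexp (-b * (t : ℂ) ^ 2)) atTop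
      (𝓝 ((∫ t in (0 : ℝ)..1, cexp (-b * (t : ℂ) ^ 2)) + cexp (-b) / (2 * b)
        - ∫ t in Ioi (1 : ℝ), cexp (-b * (t : ℂ) ^ 2) / (2 * b * (t : ℂ) ^ 2))) := by
  have hcont : Continuous fun t : ℝ => cexp (-b * (t : ℂ) ^ 2) := by fun_prop
  have hI := integrableOn_Ioi_one_cexp_div hb
  have key : ∀ B : ℝ, 1 ≤ B → ∫ t in (0 : ℝ)..B, cexp (-b * (t : ℂ) ^ 2)
      = (∫ t in (0 : ℝ)..1, cexp (-b * (t : ℂ) ^ 2)) + cexp (-b) / (2 * b)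
        - (∫ t in (1 : ℝ)..B, cexp (-b * (t : ℂ) ^ 2) / (2 * b * (t : ℂ) ^ 2))
        - cexp (-b * (B : ℂ) ^ 2) / (2 * b * B) := by
    intro B hB
    have hII : IntervalIntegrable (fun t : ℝ => cexp (-b * (t : ℂ) ^ 2) / (2 * b * (t : ℂ) ^ 2))
        volume 1 B := by
      rw [intervalIntegrable_iff_integrableOn_Ioc_of_le hB]
      exact hI.mono_set Ioc_subset_Ioi_self
    -- integrate `exp (-b t²) = (2 b t exp (-b t²)) / (2 b t)` by parts
    have hder : ∀ t ∈ uIcc 1 B, HasDerivAt (fun t : ℝ => -(cexp (-b * (t : ℂ) ^ 2) / (2 * b * t)))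
        (cexp (-b * (t : ℂ) ^ 2) + cexp (-b * (t : ℂ) ^ 2) / (2 * b * (t : ℂ) ^ 2)) t := by
      intro t ht
      rw [uIcc_of_le hB] at ht
      have ht0 : (t : ℂ) ≠ 0 := by exact_mod_cast (one_pos.trans_le ht.1).ne'
      have h1 : HasDerivAt (fun z : ℂ => -(cexp (-b * z ^ 2) / (2 * b * z)))
          (-((cexp (-b * (t : ℂ) ^ 2) * (-b * (2 * (t : ℂ)))) * (2 * b * t)
            - cexp (-b * (t : ℂ) ^ 2) * (2 * b * 1)) / (2 * b * t) ^ 2) (t : ℂ) := by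
        have h2 : HasDerivAt (fun z : ℂ => cexp (-b * z ^ 2))
            (cexp (-b * (t : ℂ) ^ 2) * (-b * (2 * (t : ℂ)))) (t : ℂ) := by
          have := ((hasDerivAt_pow 2 (t : ℂ)).const_mul (-b)).cexp
          simpa using this
        have h3 := (h2.div ((hasDerivAt_id (t : ℂ)).const_mul (2 * b)) (by simp [hb0, ht0])).neg
        refine h3.congr_deriv ?_
        simp only [id]
        ring
      refine h1.comp_ofReal.congr_deriv ?_
      field_simp
      ring
    have hFTC := intervalIntegral.integral_eq_sub_of_hasDerivAt hder
      ((hcont.intervalIntegrable _ _).add hII)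
    rw [intervalIntegral.integral_add (hcont.intervalIntegrable _ _) hII] at hFTC
    rw [← intervalIntegral.integral_add_adjacent_intervals (hcont.intervalIntegrable 0 1)
      (hcont.intervalIntegrable 1 B)]
    simp only [ofReal_one, one_pow, mul_one] at hFTC
    linear_combination hFTC
  have hlim := intervalIntegral_tendsto_integral_Ioi 1 hI tendsto_id
  have hlast : Tendsto (fun B : ℝ => cexp (-b * (B : ℂ) ^ 2) / (2 * b * B)) atTop (𝓝 0) := by
    have h0 : Tendsto (fun B : ℝ => 1 / ‖2 * b‖ * B⁻¹) atTop (𝓝 0) := by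
      simpa using tendsto_inv_atTop_zero.const_mul (1 / ‖2 * b‖)
    refine squeeze_zero_norm' ?_ h0
    filter_upwards [eventually_gt_atTop 0] with B hB
    rw [norm_div, norm_mul, norm_real, Real.norm_of_nonneg hB.le]
    have := norm_cexp_neg_mul_sq_le_one hb B
    calc _ ≤ 1 / (‖2 * b‖ * B) := by gcongr
      _ = _ := by rw [one_div, mul_inv]; ring
  have h := (tendsto_const_nhds (x := (∫ t in (0 : ℝ)..1, cexp (-b * (t : ℂ) ^ 2))
    + cexp (-b) / (2 * b))).sub hlim |>.sub hlast
  rw [sub_zero] at h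
  refine h.congr' ?_
  filter_upwards [eventually_ge_atTop 1] with B hB
  rw [key B hB]
  rfl

/-- The Gaussian integral on the imaginary axis, as the limit of the absolutely convergent integrals
with parameter `ε - a i`, `ε → 0⁺`. -/
theorem tendsto_integral_cexp_neg_I_mul_sq {a : ℝ} (ha : 0 < a) :
    Tendsto (fun B : ℝ => ∫ t in (0 : ℝ)..B, cexp (-(-(a * I)) * (t : ℂ) ^ 2)) atTop
      (𝓝 ((Real.pi / (-(a * I))) ^ (1 / 2 : ℂ) / 2)) := by
  set β : ℝ → ℂ := fun ε => ε - a * I with hβ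
  have hre : ∀ ε, (β ε).re = ε := fun ε => by simp [hβ]
  have him : ∀ ε, (β ε).im = -a := fun ε => by simp [hβ]
  have hne : ∀ ε, β ε ≠ 0 := fun ε h => by
    have := him ε; rw [h] at this; simp at this; exact ha.ne' this
  have hβ0 : β 0 = -(a * I) := by simp [hβ]
  have hβc : Continuous β := by rw [hβ]; fun_prop
  have hnorm : ∀ ε, 2 * a ≤ ‖2 * β ε‖ := fun ε => by
    rw [norm_mul, Complex.norm_ofNat]
    have := abs_im_le_norm (β ε)
    rw [him, abs_neg, abs_of_pos ha] at this
    linarith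
  set Φ : ℂ → ℂ := fun b => (∫ t in (0 : ℝ)..1, cexp (-b * (t : ℂ) ^ 2)) + cexp (-b) / (2 * b)
        - ∫ t in Ioi (1 : ℝ), cexp (-b * (t : ℂ) ^ 2) / (2 * b * (t : ℂ) ^ 2) with hΦ
  have hΦeq : ∀ ε > 0, Φ (β ε) = (Real.pi / β ε) ^ (1 / 2 : ℂ) / 2 := by
    intro ε hε
    rw [← integral_gaussian_complex_Ioi (by rw [hre]; exact hε)]
    refine tendsto_nhds_unique (tendsto_integral_cexp_neg_mul_sq (by rw [hre]; exact hε.le) (hne ε)) ?_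
    exact intervalIntegral_tendsto_integral_Ioi 0
      (integrable_cexp_neg_mul_sq (by rw [hre]; exact hε)).integrableOn tendsto_id
  have hΦlim : Tendsto (fun ε => Φ (β ε)) (𝓝[>] 0) (𝓝 (Φ (β 0))) := by
    refine Tendsto.sub (Tendsto.add ?_ ?_) ?_
    · have : Continuous fun ε : ℝ => ∫ t in (0 : ℝ)..1, cexp (-β ε * (t : ℂ) ^ 2) := by
        refine intervalIntegral.continuous_parametric_intervalIntegral_of_continuous' ?_ 0 1
        fun_prop
      exact (this.tendsto 0).mono_left nhdsWithin_le_nhds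
    · have : Continuous fun ε : ℝ => cexp (-β ε) / (2 * β ε) := by
        refine Continuous.div (by fun_prop) (by fun_prop) fun ε => ?_
        simp [hne]
      exact (this.tendsto 0).mono_left nhdsWithin_le_nhds
    · refine tendsto_integral_filter_of_dominated_convergence
        (fun t : ℝ => t ^ (-2 : ℝ) * (1 / (2 * a))) ?_ ?_ ?_ ?_
      · filter_upwards [self_mem_nhdsWithin] with ε hε
        exact (integrableOn_Ioi_one_cexp_div (by rw [hre]; exact le_of_lt hε)).aestronglyMeasurable
      · filter_upwards [self_mem_nhdsWithin] with ε hε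
        rw [ae_restrict_iff' measurableSet_Ioi]
        refine Eventually.of_forall fun t ht => ?_
        have ht0 : (0 : ℝ) < t := one_pos.trans ht
        rw [norm_div, norm_mul, norm_pow, norm_real, Real.norm_of_nonneg ht0.le,
          Real.rpow_neg ht0.le]
        rw [show t ^ (2 : ℝ) = t ^ 2 by exact_mod_cast Real.rpow_natCast t 2]
        have h1 := norm_cexp_neg_mul_sq_le_one (b := β ε) (by rw [hre]; exact le_of_lt hε) t
        have h2 := hnorm ε
        calc _ ≤ 1 / (2 * a * t ^ 2) := by gcongr
          _ = _ := by rw [one_div, mul_inv]; ring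
      · exact (integrableOn_Ioi_rpow_of_lt (by norm_num) one_pos).mul_const _
      · rw [ae_restrict_iff' measurableSet_Ioi]
        refine Eventually.of_forall fun t ht => ?_
        have ht0 : (t : ℂ) ≠ 0 := by exact_mod_cast (one_pos.trans ht).ne'
        have : Continuous fun ε : ℝ => cexp (-β ε * (t : ℂ) ^ 2) / (2 * β ε * (t : ℂ) ^ 2) := by
          refine Continuous.div (by fun_prop) (by fun_prop) fun ε => ?_
          simp [hne, ht0]
        exact (this.tendsto 0).mono_left nhdsWithin_le_nhds
  have hrlim : Tendsto (fun ε => (Real.pi / β ε) ^ (1 / 2 : ℂ) / 2) (𝓝[>] 0)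
      (𝓝 ((Real.pi / β 0) ^ (1 / 2 : ℂ) / 2)) := by
    have hc : ContinuousAt (fun ε => (Real.pi / β ε) ^ (1 / 2 : ℂ) / 2) 0 := by
      refine ContinuousAt.div_const (ContinuousAt.cpow ?_ continuousAt_const ?_) _
      · exact (Continuous.div continuous_const hβc hne).continuousAt
      · rw [mem_slitPlane_iff]
        right
        rw [hβ0]
        have : (Real.pi : ℂ) / (-(a * I)) = ((Real.pi / a : ℝ) : ℂ) * I := by
          have : (a : ℂ) ≠ 0 := by exact_mod_cast ha.ne'
          push_cast
          field_simp
          simp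
        rw [this]
        simp
        exact ha.ne'
    exact hc.tendsto.mono_left nhdsWithin_le_nhds
  have hfin : Φ (β 0) = (Real.pi / β 0) ^ (1 / 2 : ℂ) / 2 := by
    refine tendsto_nhds_unique hΦlim (hrlim.congr' ?_)
    filter_upwards [self_mem_nhdsWithin] with ε hε
    exact (hΦeq ε hε).symm
  rw [← hβ0, ← hfin]
  exact tendsto_integral_cexp_neg_mul_sq (by rw [hre]) (hne 0)

theorem norm_e (x : ℝ) : ‖e x‖ = 1 := by
  rw [e, show 2 * (Real.pi : ℂ) * I * x = ((2 * Real.pi * x : ℝ) : ℂ) * I by push_cast; ring]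
  exact norm_exp_ofReal_mul_I _

theorem e_add (x y : ℝ) : e (x + y) = e x * e y := by
  rw [e, e, e, ← Complex.exp_add]; push_cast; ring_nf

theorem continuous_e : Continuous e := by unfold e; fun_prop

theorem hasDerivAt_e (x : ℝ) : HasDerivAt e (2 * Real.pi * I * e x) x := by
  have h : HasDerivAt (fun z : ℂ => cexp (2 * Real.pi * I * z))
      (cexp (2 * Real.pi * I * (x : ℂ)) * (2 * Real.pi * I * 1)) (x : ℂ) :=
    ((hasDerivAt_id (x : ℂ)).const_mul (2 * Real.pi * I)).cexp
  refine h.comp_ofReal.congr_deriv ?_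
  rw [e]; ring

/-- The Fresnel integral `∫₀^∞ e(l t²) dt = e(1/8) / (2 √(2l))`. -/
theorem tendsto_fresnel {l : ℝ} (hl : 0 < l) :
    Tendsto (fun B : ℝ => ∫ t in (0 : ℝ)..B, e (l * t ^ 2)) atTop
      (𝓝 (e (1 / 8) / (2 * (√(2 * l) : ℝ)))) := by
  have h := tendsto_integral_cexp_neg_I_mul_sq (a := 2 * Real.pi * l) (by positivity)
  have hfun : (fun B : ℝ => ∫ t in (0 : ℝ)..B, e (l * t ^ 2))
      = fun B : ℝ => ∫ t in (0 : ℝ)..B, cexp (-(-((2 * Real.pi * l : ℝ) * I)) * (t : ℂ) ^ 2) := by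
    funext B
    refine intervalIntegral.integral_congr fun t _ => ?_
    simp only [e]
    push_cast
    ring_nf
  rw [hfun]
  convert h using 2
  have hs : 0 < √(2 * l) := by positivity
  have hsq : ((√(2 * l) : ℝ) : ℂ) ^ 2 = 2 * l := by
    exact_mod_cast congrArg Complex.ofReal (Real.sq_sqrt (by positivity : 0 ≤ 2 * l))
  have h1 : (Real.pi : ℂ) / (-((2 * Real.pi * l : ℝ) * I))
      = ((1 / (2 * l) : ℝ) : ℂ) * I := by
    have : (l : ℂ) ≠ 0 := by exact_mod_cast hl.ne'
    have : (Real.pi : ℂ) ≠ 0 := by exact_mod_cast Real.pi_ne_zero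
    push_cast
    field_simp
    simp
  have h2 : ((1 / (2 * l) : ℝ) : ℂ) ^ (1 / 2 : ℂ) = ((1 / √(2 * l) : ℝ) : ℂ) := by
    rw [show (1 / 2 : ℂ) = ((1 / 2 : ℝ) : ℂ) by norm_num, ← ofReal_cpow (by positivity),
      ← Real.sqrt_eq_rpow, Real.sqrt_div zero_le_one, Real.sqrt_one]
  have h3 : I ^ (1 / 2 : ℂ) = e (1 / 8) := by
    rw [cpow_def_of_ne_zero I_ne_zero, log_I, e]
    congr 1
    push_cast
    ring
  have hpos : 0 < 1 / (2 * l) := by positivity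
  have hpos' : ((1 / (2 * l) : ℝ) : ℂ) ≠ 0 := by exact_mod_cast hpos.ne'
  rw [h1, cpow_def_of_ne_zero (mul_ne_zero hpos' I_ne_zero), log_ofReal_mul hpos I_ne_zero, add_mul,
    Complex.exp_add, ofReal_log hpos.le, ← cpow_def_of_ne_zero hpos',
    ← cpow_def_of_ne_zero I_ne_zero, h2, h3]
  push_cast
  ring

/-- The numerical factor picked up by `y^k` after `i` integrations by parts against a quadratic phase:
`∏_{m < i} -(k - 1 - 2m)`. -/
def ladder (k : ℕ) : ℕ → ℝ
  | 0 => 1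
  | i + 1 => -((k : ℝ) - 1 - 2 * i) * ladder k i

/-- The first `m` boundary terms in the repeated integration by parts of `∫ t^k e(l t²) dt`, evaluated
at `y`. The exponents `k - 1 - 2i` are integers, possibly negative. -/
noncomputable def monomialBoundary (l : ℝ) (k m : ℕ) (y : ℝ) : ℂ :=
  e (l * y ^ 2) * ∑ i ∈ Finset.range m,
    (ladder k i : ℂ) * ((y ^ ((k : ℤ) - 1 - 2 * i) : ℝ) : ℂ) / (4 * Real.pi * I * l) ^ (i + 1)

theorem hasDerivAt_e_mul_sq (l y : ℝ) :
    HasDerivAt (fun y : ℝ => e (l * y ^ 2)) (4 * Real.pi * I * l * y * e (l * y ^ 2)) y := by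
  have h1 : HasDerivAt (fun y : ℝ => l * y ^ 2) (l * (2 * y)) y := by
    simpa using (hasDerivAt_pow 2 y).const_mul l
  refine ((hasDerivAt_e (l * y ^ 2)).scomp y h1).congr_deriv ?_
  simp
  ring

theorem four_pi_I_mul_ne_zero {l : ℝ} (hl : l ≠ 0) : (4 * Real.pi * I * l : ℂ) ≠ 0 := by
  have : (Real.pi : ℂ) ≠ 0 := by exact_mod_cast Real.pi_ne_zero
  have : (l : ℂ) ≠ 0 := by exact_mod_cast hl
  simp [*]

theorem norm_four_pi_I_mul {l : ℝ} (hl : 0 < l) : ‖(4 * Real.pi * I * l : ℂ)‖ = 4 * Real.pi * l := by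
  simp [abs_of_pos Real.pi_pos, abs_of_pos hl]

theorem hasDerivAt_monomialBoundary {l : ℝ} (hl : l ≠ 0) (k m : ℕ) {y : ℝ} (hy : y ≠ 0) :
    HasDerivAt (monomialBoundary l k m)
      ((y : ℂ) ^ k * e (l * y ^ 2) - (ladder k m : ℂ) * ((y ^ ((k : ℤ) - 2 * m) : ℝ) : ℂ)
        / (4 * Real.pi * I * l) ^ m * e (l * y ^ 2)) y := by
  have hb := four_pi_I_mul_ne_zero hl
  have hyc : (y : ℂ) ≠ 0 := by exact_mod_cast hy
  unfold monomialBoundary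
  induction m with
  | zero => simpa [ladder] using hasDerivAt_const y (0 : ℂ)
  | succ m ih =>
    simp_rw [Finset.sum_range_succ, mul_add]
    have h1 : HasDerivAt (fun y : ℝ => (ladder k m : ℂ) *
        ((y ^ ((k : ℤ) - 1 - 2 * m) : ℝ) : ℂ) / (4 * Real.pi * I * l) ^ (m + 1))
        ((ladder k m : ℂ) * (((((k : ℤ) - 1 - 2 * m : ℤ) : ℝ) *
          y ^ ((k : ℤ) - 1 - 2 * m - 1) : ℝ) : ℂ) / (4 * Real.pi * I * l) ^ (m + 1)) y :=
      (((hasDerivAt_zpow ((k : ℤ) - 1 - 2 * m) y (Or.inl hy)).ofReal_comp).const_mul _).div_const _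
    refine (ih.add ((hasDerivAt_e_mul_sq l y).mul h1)).congr_deriv ?_
    have e1 : (y : ℝ) ^ ((k : ℤ) - 2 * m) = y * y ^ ((k : ℤ) - 1 - 2 * m) := by
      rw [show (k : ℤ) - 2 * m = 1 + ((k : ℤ) - 1 - 2 * m) by ring, zpow_add₀ hy, zpow_one]
    have e2 : (y : ℝ) ^ ((k : ℤ) - 2 * (m + 1 : ℕ)) = y ^ ((k : ℤ) - 1 - 2 * m - 1) := by
      congr 1; push_cast; ring
    rw [e1, e2, ladder]
    push_cast
    field_simp
    ring

theorem integrableOn_Ioi_zpow {z : ℤ} (hz : z ≤ -2) {c : ℝ} (hc : 0 < c) :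
    IntegrableOn (fun t : ℝ => t ^ z) (Ioi c) ∧
      ∫ t in Ioi c, t ^ z ≤ c ^ (z + 1) := by
  have hz' : (z : ℝ) < -1 := by
    have : (z : ℝ) ≤ -2 := by exact_mod_cast hz
    linarith
  have h1 := integrableOn_Ioi_rpow_of_lt hz' hc
  have h2 := integral_Ioi_rpow_of_lt hz' hc
  simp_rw [Real.rpow_intCast] at h1 h2
  refine ⟨h1, ?_⟩
  rw [h2, show (z : ℝ) + 1 = ((z + 1 : ℤ) : ℝ) by push_cast; ring, Real.rpow_intCast]
  have hz2 : ((z + 1 : ℤ) : ℝ) ≤ -1 := by exact_mod_cast (by omega : z + 1 ≤ -1)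
  have hpos : 0 < c ^ (z + 1) := zpow_pos hc _
  rw [neg_div, ← div_neg]
  exact div_le_self hpos.le (by linarith)

theorem continuous_pow_mul_e (l : ℝ) (k : ℕ) :
    Continuous fun t : ℝ => (t : ℂ) ^ k * e (l * t ^ 2) := by
  have := continuous_e
  fun_prop

/-- The regularised integral of `t ^ k * e (l * t ^ 2)` over `[0, ∞)` exists once enough boundary terms
are removed, and the tail is controlled by the next power. -/
theorem exists_tendsto_monomial {l : ℝ} (hl : 0 < l) {k m : ℕ} (hkm : k + 2 ≤ 2 * m) :
    ∃ c : ℂ, Tendsto (fun B : ℝ => (∫ t in (0 : ℝ)..B, (t : ℂ) ^ k * e (l * t ^ 2))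
        - monomialBoundary l k m B) atTop (𝓝 c) ∧
      ∀ B > 0, ‖(∫ t in (0 : ℝ)..B, (t : ℂ) ^ k * e (l * t ^ 2)) - monomialBoundary l k m B - c‖
        ≤ |ladder k m| / (4 * Real.pi * l) ^ m * B ^ ((k : ℤ) + 1 - 2 * m) := by
  set F : ℝ → ℂ := fun B => (∫ t in (0 : ℝ)..B, (t : ℂ) ^ k * e (l * t ^ 2))
        - monomialBoundary l k m B with hF
  set F' : ℝ → ℂ := fun y => (ladder k m : ℂ) * ((y ^ ((k : ℤ) - 2 * m) : ℝ) : ℂ)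
        / (4 * Real.pi * I * l) ^ m * e (l * y ^ 2) with hF'
  have hcont := continuous_pow_mul_e l k
  have hder : ∀ y : ℝ, 0 < y → HasDerivAt F (F' y) y := by
    intro y hy
    have h1 := intervalIntegral.integral_hasDerivAt_right (hcont.intervalIntegrable 0 y)
      (hcont.stronglyMeasurableAtFilter _ _) hcont.continuousAt
    refine (h1.sub (hasDerivAt_monomialBoundary hl.ne' k m hy.ne')).congr_deriv ?_
    rw [hF']; ring
  have hnorm : ∀ y : ℝ, 0 < y →
      ‖F' y‖ = |ladder k m| / (4 * Real.pi * l) ^ m * y ^ ((k : ℤ) - 2 * m) := by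
    intro y hy
    rw [hF']
    simp only
    rw [norm_mul, norm_div, norm_mul, norm_pow, norm_four_pi_I_mul hl, norm_e, norm_real, norm_real,
      Real.norm_eq_abs, Real.norm_eq_abs, abs_of_pos (zpow_pos hy _)]
    ring
  have hint : ∀ B : ℝ, 0 < B → IntegrableOn F' (Ioi B) ∧
      ‖∫ t in Ioi B, F' t‖ ≤ |ladder k m| / (4 * Real.pi * l) ^ m * B ^ ((k : ℤ) + 1 - 2 * m) := by
    intro B hB
    obtain ⟨h1, h2⟩ := integrableOn_Ioi_zpow (z := (k : ℤ) - 2 * m) (by omega) hB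
    have h3 := h1.const_mul (|ladder k m| / (4 * Real.pi * l) ^ m)
    have hbd : ∀ᵐ y ∂(volume.restrict (Ioi B)), ‖F' y‖
        ≤ |ladder k m| / (4 * Real.pi * l) ^ m * y ^ ((k : ℤ) - 2 * m) := by
      rw [ae_restrict_iff' measurableSet_Ioi]
      exact Eventually.of_forall fun y hy => (hnorm y (hB.trans hy)).le
    constructor
    · refine h3.mono' (ContinuousOn.aestronglyMeasurable ?_ measurableSet_Ioi) hbd
      have he := continuous_e
      refine ContinuousOn.mul (ContinuousOn.div_const (continuousOn_const.mul ?_) _)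
        (by fun_prop : Continuous fun y : ℝ => e (l * y ^ 2)).continuousOn
      refine continuous_ofReal.comp_continuousOn ?_
      exact fun y hy => (continuousAt_zpow₀ y _ (Or.inl (hB.trans hy).ne')).continuousWithinAt
    · refine (norm_integral_le_of_norm_le h3 hbd).trans ?_
      rw [integral_const_mul]
      have : (k : ℤ) + 1 - 2 * m = (k : ℤ) - 2 * m + 1 := by ring
      rw [this]
      gcongr
  have hlim := tendsto_limUnder_of_hasDerivAt_of_integrableOn_Ioi
    (fun x (hx : x ∈ Ioi (1 : ℝ)) => hder x (one_pos.trans hx)) (hint 1 one_pos).1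
  refine ⟨_, hlim, fun B hB => ?_⟩
  have h4 := integral_Ioi_of_hasDerivAt_of_tendsto' (fun x hx => hder x (lt_of_lt_of_le hB hx))
    (hint B hB).1 hlim
  have h5 := (hint B hB).2
  rw [h4, norm_sub_rev] at h5
  exact h5

theorem ladder_succ_add_two (k i : ℕ) : ladder (k + 2) (i + 1) = -((k : ℝ) + 1) * ladder k i := by
  induction i with
  | zero => simp [ladder]; ring
  | succ i ih => rw [ladder, ih, ladder]; push_cast; ring

theorem monomialBoundary_add_two {l : ℝ} (hl : l ≠ 0) (k m : ℕ) (y : ℝ) :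
    monomialBoundary l (k + 2) (m + 1) y = (y : ℂ) ^ (k + 1) * e (l * y ^ 2) / (4 * Real.pi * I * l)
      - (k + 1) / (4 * Real.pi * I * l) * monomialBoundary l k m y := by
  have hb := four_pi_I_mul_ne_zero hl
  unfold monomialBoundary
  rw [Finset.sum_range_succ', mul_add]
  have h1 : ∑ i ∈ Finset.range m, (ladder (k + 2) (i + 1) : ℂ) *
      ((y ^ (((k + 2 : ℕ) : ℤ) - 1 - 2 * (i + 1 : ℕ)) : ℝ) : ℂ) / (4 * Real.pi * I * l) ^ (i + 1 + 1)
      = -((k + 1) / (4 * Real.pi * I * l)) * ∑ i ∈ Finset.range m,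
        (ladder k i : ℂ) * ((y ^ ((k : ℤ) - 1 - 2 * i) : ℝ) : ℂ) / (4 * Real.pi * I * l) ^ (i + 1) := by
    rw [Finset.mul_sum]
    refine Finset.sum_congr rfl fun i _ => ?_
    rw [ladder_succ_add_two]
    have : ((k + 2 : ℕ) : ℤ) - 1 - 2 * (i + 1 : ℕ) = (k : ℤ) - 1 - 2 * i := by push_cast; ring
    rw [this]
    push_cast
    generalize (4 * Real.pi * I * l : ℂ) = b at hb ⊢
    field_simp
    ring
  have h2 : ((k + 2 : ℕ) : ℤ) - 1 - 2 * (0 : ℕ) = (k + 1 : ℕ) := by push_cast; ring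
  rw [h1, h2, zpow_natCast]
  simp only [ladder, ofReal_one, ofReal_pow, zero_add, pow_one]
  ring

theorem integral_pow_add_two_mul_e {l : ℝ} (hl : l ≠ 0) (k : ℕ) (B : ℝ) :
    ∫ t in (0 : ℝ)..B, (t : ℂ) ^ (k + 2) * e (l * t ^ 2)
      = (B : ℂ) ^ (k + 1) * e (l * B ^ 2) / (4 * Real.pi * I * l)
        - (k + 1) / (4 * Real.pi * I * l) * ∫ t in (0 : ℝ)..B, (t : ℂ) ^ k * e (l * t ^ 2) := by
  have hb := four_pi_I_mul_ne_zero hl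
  have hder : ∀ t ∈ uIcc 0 B, HasDerivAt
      (fun t : ℝ => (t : ℂ) ^ (k + 1) * e (l * t ^ 2) / (4 * Real.pi * I * l))
      ((t : ℂ) ^ (k + 2) * e (l * t ^ 2)
        + (k + 1) / (4 * Real.pi * I * l) * ((t : ℂ) ^ k * e (l * t ^ 2))) t := by
    intro t _
    have h1 : HasDerivAt (fun t : ℝ => (t : ℂ) ^ (k + 1)) (((k + 1 : ℕ) : ℂ) * (t : ℂ) ^ k) t := by
      simpa using (hasDerivAt_pow (k + 1) (t : ℂ)).comp_ofReal
    refine ((h1.mul (hasDerivAt_e_mul_sq l t)).div_const _).congr_deriv ?_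
    push_cast
    generalize (4 * Real.pi * I * l : ℂ) = b at hb ⊢
    field_simp
    ring
  have c1 := (continuous_pow_mul_e l (k + 2)).intervalIntegrable (μ := volume) 0 B
  have c2 := (continuous_pow_mul_e l k).intervalIntegrable (μ := volume) 0 B
  have := intervalIntegral.integral_eq_sub_of_hasDerivAt hder (c1.add (c2.const_mul _))
  rw [intervalIntegral.integral_add c1 (c2.const_mul _), intervalIntegral.integral_const_mul] at this
  simp at this
  linear_combination this

/-- The regularised integrals of the even monomials. Both the integral and the boundary terms satisfy
the recursion `k → k + 2` coming from one integration by parts, which reduces to `k = 0`. -/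
theorem tendsto_monomial_even {l : ℝ} (hl : 0 < l) (j m : ℕ) :
    Tendsto (fun B : ℝ => (∫ t in (0 : ℝ)..B, (t : ℂ) ^ (2 * j) * e (l * t ^ 2))
        - monomialBoundary l (2 * j) (j + m) B) atTop
      (𝓝 ((-1) ^ j * ((2 * j - 1).doubleFactorial : ℂ) / (4 * Real.pi * I * l) ^ j
        * (e (1 / 8) / (2 * (√(2 * l) : ℝ))))) := by
  have hb := four_pi_I_mul_ne_zero hl.ne'
  induction j with
  | zero =>
    have h0 : Tendsto (monomialBoundary l 0 m) atTop (𝓝 0) := by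
      rw [tendsto_zero_iff_norm_tendsto_zero]
      simp only [monomialBoundary, norm_mul, norm_e, one_mul]
      rw [← tendsto_zero_iff_norm_tendsto_zero]
      rw [show (0 : ℂ) = ∑ i ∈ Finset.range m, (ladder 0 i : ℂ) * ((0 : ℝ) : ℂ)
        / (4 * Real.pi * I * l) ^ (i + 1) by simp]
      refine tendsto_finsetSum _ fun i _ => ?_
      refine ((continuous_ofReal.tendsto 0).comp ?_).const_mul _ |>.div_const _
      have : (((0 : ℕ) : ℤ) - 1 - 2 * i) = -((1 + 2 * i : ℕ) : ℤ) := by push_cast; ring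
      simp_rw [this, zpow_neg, zpow_natCast]
      exact (tendsto_pow_atTop (by omega)).inv_tendsto_atTop
    simpa using (tendsto_fresnel hl).sub h0
  | succ j ih =>
    have := ih.const_mul (-((2 * j : ℕ) + 1) / (4 * Real.pi * I * l))
    convert this using 1
    · funext B
      rw [show 2 * (j + 1) = 2 * j + 2 by ring, show j + 1 + m = j + m + 1 by ring,
        monomialBoundary_add_two hl.ne', integral_pow_add_two_mul_e hl.ne']
      ring
    · have hd : ((2 * (j + 1) - 1).doubleFactorial : ℂ)
          = (2 * j + 1) * ((2 * j - 1).doubleFactorial : ℂ) := by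
        rcases j with _ | j
        · simp
        · rw [show 2 * (j + 1 + 1) - 1 = (2 * j + 1) + 2 by omega,
            show 2 * (j + 1) - 1 = 2 * j + 1 by omega, Nat.doubleFactorial_add_two]
          push_cast; ring
      rw [hd]
      push_cast
      congr 1
      generalize (4 * Real.pi * I * l : ℂ) = b at hb ⊢
      field_simp
      ring

theorem monomialBoundary_neg (l : ℝ) (k m : ℕ) (y : ℝ) :
    monomialBoundary l k m (-y) = (-1) ^ (k + 1) * monomialBoundary l k m y := by
  unfold monomialBoundary
  rw [neg_sq, mul_left_comm]
  congr 1
  rw [Finset.mul_sum]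
  refine Finset.sum_congr rfl fun i _ => ?_
  have h1 : (-y) ^ ((k : ℤ) - 1 - 2 * i) = (-1) ^ (k + 1) * y ^ ((k : ℤ) - 1 - 2 * i) := by
    rw [neg_eq_neg_one_mul, mul_zpow]
    congr 1
    rw [show (k : ℤ) - 1 - 2 * i = ((k + 1 : ℕ) : ℤ) - 2 * (i + 1 : ℤ) by push_cast; ring,
      zpow_sub₀ (by norm_num), zpow_natCast, zpow_mul]
    norm_num
  rw [h1]
  push_cast
  ring

theorem monomialBoundary_succ (l : ℝ) (k m : ℕ) (y : ℝ) :
    monomialBoundary l k (m + 1) y = monomialBoundary l k m y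
      + e (l * y ^ 2) * ((ladder k m : ℂ) * ((y ^ ((k : ℤ) - 1 - 2 * m) : ℝ) : ℂ)
        / (4 * Real.pi * I * l) ^ (m + 1)) := by
  unfold monomialBoundary
  rw [Finset.sum_range_succ, mul_add]

/-- The contribution of the stationary point to `∫ t^k e(l t²) dt`, for an interval around `0`: twice
the regularised integral over `[0, ∞)` if `k` is even, and `0` if `k` is odd. -/
noncomputable def monomialMain (l : ℝ) (k : ℕ) : ℂ :=
  if Even k then e (1 / 8) / (√(2 * l) : ℝ)
    * ((-1) ^ (k / 2) * ((k - 1).doubleFactorial : ℂ) / (4 * Real.pi * I * l) ^ (k / 2)) else 0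

/-- Stationary phase for a monomial amplitude and a quadratic phase. In the proof an additional boundary
term, the one of index `n + 1`, is split off and then absorbed into the error; this improves the
power of `l` from `n + 1` to `n + 2`. -/
theorem exists_monomial_expansion (n k : ℕ) (hk : k ≤ 2 * n) : ∃ K > 0, ∀ l A B : ℝ, 0 < l → 0 < A →
    0 < B → ‖(∫ t in (-A)..B, (t : ℂ) ^ k * e (l * t ^ 2)) - monomialMain l k
      - (monomialBoundary l k (n + 1) B - monomialBoundary l k (n + 1) (-A))‖
      ≤ K * (A ^ ((k : ℤ) - 2 * n - 3) + B ^ ((k : ℤ) - 2 * n - 3)) / l ^ (n + 2) := by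
  set K := (|ladder k (n + 2)| + |ladder k (n + 1)|) / (4 * Real.pi) ^ (n + 2) + 1 with hK
  refine ⟨K, by positivity, fun l A B hl hA hB => ?_⟩
  obtain ⟨c, hc, hbd⟩ := exists_tendsto_monomial hl (k := k) (m := n + 2) (by omega)
  set F : ℝ → ℂ := fun B => ∫ t in (0 : ℝ)..B, (t : ℂ) ^ k * e (l * t ^ 2) with hF
  have key : ∀ B > 0, ‖F B - monomialBoundary l k (n + 1) B - c‖
      ≤ K * B ^ ((k : ℤ) - 2 * n - 3) / l ^ (n + 2) := by
    intro B hB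
    have h1 := hbd B hB
    rw [monomialBoundary_succ] at h1
    set q := e (l * B ^ 2) * ((ladder k (n + 1) : ℂ) * ((B ^ ((k : ℤ) - 1 - 2 * (n + 1 : ℕ)) : ℝ) : ℂ)
        / (4 * Real.pi * I * l) ^ (n + 1 + 1)) with hq
    have e1 : (k : ℤ) - 1 - 2 * (n + 1 : ℕ) = (k : ℤ) - 2 * n - 3 := by push_cast; ring
    have e2 : (k : ℤ) + 1 - 2 * (n + 2 : ℕ) = (k : ℤ) - 2 * n - 3 := by push_cast; ring
    have h2 : ‖q‖ = |ladder k (n + 1)| / (4 * Real.pi * l) ^ (n + 2)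
        * B ^ ((k : ℤ) - 2 * n - 3) := by
      rw [hq, norm_mul, norm_div, norm_mul, norm_pow, norm_four_pi_I_mul hl, norm_e, norm_real,
        norm_real, Real.norm_eq_abs, Real.norm_eq_abs, abs_of_pos (zpow_pos hB _), e1]
      ring
    rw [e2] at h1
    have h3 : F B - monomialBoundary l k (n + 1) B - c
        = (F B - (monomialBoundary l k (n + 1) B + q) - c) + q := by ring
    rw [h3]
    refine (norm_add_le _ _).trans ((add_le_add h1 h2.le).trans ?_)
    rw [mul_pow, hK]
    have hz : 0 < B ^ ((k : ℤ) - 2 * n - 3) := zpow_pos hB _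
    have : 0 < B ^ ((k : ℤ) - 2 * n - 3) / l ^ (n + 2) := by positivity
    calc _ = (|ladder k (n + 2)| + |ladder k (n + 1)|) / (4 * Real.pi) ^ (n + 2)
          * (B ^ ((k : ℤ) - 2 * n - 3) / l ^ (n + 2)) := by field_simp
      _ ≤ _ := by rw [mul_div_assoc]; gcongr; linarith
  have hsplit : ∫ t in (-A)..B, (t : ℂ) ^ k * e (l * t ^ 2) = F B + (-1) ^ k * F A := by
    have hcont := continuous_pow_mul_e l k
    rw [← intervalIntegral.integral_add_adjacent_intervals (hcont.intervalIntegrable (-A) 0)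
      (hcont.intervalIntegrable 0 B), add_comm]
    congr 1
    have := intervalIntegral.integral_comp_neg (a := 0) (b := A)
      (fun t : ℝ => (t : ℂ) ^ k * e (l * t ^ 2))
    rw [neg_zero] at this
    rw [← this, hF, ← intervalIntegral.integral_const_mul]
    refine intervalIntegral.integral_congr fun t _ => ?_
    simp only [neg_sq, ofReal_neg]
    rw [neg_eq_neg_one_mul (t : ℂ), mul_pow]
    ring
  have hmain : monomialMain l k = c + (-1) ^ k * c := by
    rw [monomialMain]
    split_ifs with hev
    · obtain ⟨j, rfl⟩ := even_iff_exists_two_mul.1 hev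
      have h1 := tendsto_monomial_even hl j (n + 2 - j)
      rw [show j + (n + 2 - j) = n + 2 by omega] at h1
      rw [tendsto_nhds_unique hc h1, hev.neg_one_pow, Nat.mul_div_cancel_left _ two_pos]
      ring
    · rw [(Nat.not_even_iff_odd.1 hev).neg_one_pow]; ring
  have e3 : (∫ t in (-A)..B, (t : ℂ) ^ k * e (l * t ^ 2)) - monomialMain l k
      - (monomialBoundary l k (n + 1) B - monomialBoundary l k (n + 1) (-A))
      = (F B - monomialBoundary l k (n + 1) B - c)
        + (-1) ^ k * (F A - monomialBoundary l k (n + 1) A - c) := by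
    rw [hsplit, hmain, monomialBoundary_neg]; ring
  rw [e3]
  refine (norm_add_le _ _).trans ?_
  rw [norm_mul, norm_pow, norm_neg, norm_one, one_pow, one_mul]
  refine (add_le_add (key B hB) (key A hA)).trans (le_of_eq ?_)
  ring

end Fresnel

/-! ### Iterated integration by parts -/

/-- The real functions `u / f'`, `-(u / f')' / f'`, …, obtained by iterating `v ↦ -v' / f'`. Up to powers
of `2πi` they are the functions `H_1, H_2, …` for the amplitude `u`. -/
noncomputable def phaseQuot (α β : ℝ) (f u : ℝ → ℝ) : ℕ → ℝ → ℝ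
  | 0 => fun x => u x / derivWithin f (Icc α β) x
  | i + 1 => fun x =>
      -derivWithin (phaseQuot α β f u i) (Icc α β) x / derivWithin f (Icc α β) x

theorem derivWithin_diff_singleton {F : Type*} [NormedAddCommGroup F] [NormedSpace ℝ F] {S : Set ℝ}
    {γ x : ℝ} (hx : x ≠ γ) (u : ℝ → F) :
    derivWithin u (S \ {γ}) x = derivWithin u S x := by
  rw [sdiff_eq]
  exact derivWithin_inter (isOpen_compl_singleton.mem_nhds hx)

theorem uniqueDiffOn_diff_singleton {S : Set ℝ} (hS : UniqueDiffOn ℝ S) (γ : ℝ) :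
    UniqueDiffOn ℝ (S \ {γ}) := by
  rw [sdiff_eq]
  exact hS.inter isOpen_compl_singleton

theorem iteratedDerivWithin_diff_singleton {S : Set ℝ} {γ x : ℝ}
    (hx : x ∈ S \ {γ}) (u : ℝ → ℝ) (k : ℕ) :
    iteratedDerivWithin k u (S \ {γ}) x = iteratedDerivWithin k u S x := by
  induction k generalizing u x with
  | zero => simp
  | succ k ih =>
    rw [iteratedDerivWithin_succ', iteratedDerivWithin_succ', ← ih hx]
    exact iteratedDerivWithin_congr (fun y hy => derivWithin_diff_singleton hy.2 u) hx

theorem SymbolOn.diff_singleton {S : Set ℝ} {γ : ℝ} {r : ℕ} {A ω : ℝ → ℝ} {u : ℝ → ℝ}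
    (h : SymbolOn S r A ω u) : SymbolOn (S \ {γ}) r A ω u :=
  ⟨h.1.mono sdiff_subset, fun k hk x hx => by
    rw [iteratedDerivWithin_diff_singleton hx]; exact h.2 k hk x hx.1⟩

section PhaseQuot

variable {α β γ : ℝ} {f u : ℝ → ℝ} {r : ℕ}

theorem contDiffOn_phaseQuot (hlt : α < β)
    (hf : ContDiffOn ℝ r (derivWithin f (Icc α β)) (Icc α β \ {γ}))
    (hf0 : ∀ x ∈ Icc α β \ {γ}, derivWithin f (Icc α β) x ≠ 0)
    (hu : ContDiffOn ℝ r u (Icc α β \ {γ})) (i s : ℕ) (hs : s + i ≤ r) :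
    ContDiffOn ℝ s (phaseQuot α β f u i) (Icc α β \ {γ}) := by
  have hS := uniqueDiffOn_diff_singleton (uniqueDiffOn_Icc hlt) γ
  induction i generalizing s with
  | zero =>
    have hs' : (s : WithTop ℕ∞) ≤ r := by exact_mod_cast hs
    exact (hu.of_le hs').div (hf.of_le hs') hf0
  | succ i ih =>
    have hs' : (s : WithTop ℕ∞) ≤ r := by exact_mod_cast (by omega : s ≤ r)
    have h1 := ih (s + 1) (by omega)
    rw [Nat.cast_succ, contDiffOn_succ_iff_derivWithin hS] at h1
    refine (h1.2.2.neg.congr fun x hx => ?_).div (hf.of_le hs') hf0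
    rw [derivWithin_diff_singleton hx.2]

theorem phaseQuot_succ_eq {i : ℕ} {x : ℝ} (hx : x ∈ Icc α β \ {γ}) :
    phaseQuot α β f u (i + 1) x = -derivWithin (phaseQuot α β f u i) (Icc α β \ {γ}) x
      / derivWithin f (Icc α β) x := by
  rw [derivWithin_diff_singleton hx.2]; rfl

theorem H_succ_eq (hlt : α < β)
    (hf : ContDiffOn ℝ r (derivWithin f (Icc α β)) (Icc α β \ {γ}))
    (hf0 : ∀ x ∈ Icc α β \ {γ}, derivWithin f (Icc α β) x ≠ 0)
    (hu : ContDiffOn ℝ r u (Icc α β \ {γ})) (i : ℕ) (hi : i ≤ r) :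
    ∀ x ∈ Icc α β \ {γ}, H α β f u (i + 1) x
      = (phaseQuot α β f u i x : ℂ) / (2 * Real.pi * Complex.I) ^ (i + 1) := by
  have hS := uniqueDiffOn_diff_singleton (uniqueDiffOn_Icc hlt) γ
  have hpi : (2 * Real.pi * Complex.I : ℂ) ≠ 0 := Complex.two_pi_I_ne_zero
  induction i with
  | zero =>
    intro x hx
    have := hf0 x hx
    simp only [H, phaseQuot]
    push_cast
    field_simp
  | succ i ih =>
    intro x hx
    have h1 : derivWithin (H α β f u (i + 1)) (Icc α β) x
        = ((derivWithin (phaseQuot α β f u i) (Icc α β) x : ℝ) : ℂ)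
          / (2 * Real.pi * Complex.I) ^ (i + 1) := by
      rw [← derivWithin_diff_singleton (S := Icc α β) hx.2 (H α β f u (i + 1)),
        ← derivWithin_diff_singleton (S := Icc α β) hx.2 (phaseQuot α β f u i),
        derivWithin_congr (ih (by omega)) (ih (by omega) x hx)]
      have h2 := (contDiffOn_phaseQuot hlt hf hf0 hu i 1 (by omega)).differentiableOn (by simp) x hx
      exact ((h2.hasDerivWithinAt.ofReal_comp).div_const _).derivWithin (hS x hx)
    simp only [H, phaseQuot]
    rw [h1]
    have := hf0 x hx
    push_cast
    field_simp
    ring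

theorem phaseQuot_add (hlt : α < β)
    (hf : ContDiffOn ℝ r (derivWithin f (Icc α β)) (Icc α β \ {γ}))
    (hf0 : ∀ x ∈ Icc α β \ {γ}, derivWithin f (Icc α β) x ≠ 0) {v : ℝ → ℝ}
    (hu : ContDiffOn ℝ r u (Icc α β \ {γ})) (hv : ContDiffOn ℝ r v (Icc α β \ {γ}))
    (i : ℕ) (hi : i ≤ r) : ∀ x ∈ Icc α β \ {γ},
      phaseQuot α β f (fun x => u x + v x) i x = phaseQuot α β f u i x + phaseQuot α β f v i x := by
  induction i with
  | zero => intro x hx; simp [phaseQuot, add_div]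
  | succ i ih =>
    intro x hx
    rw [phaseQuot_succ_eq hx, phaseQuot_succ_eq hx, phaseQuot_succ_eq hx,
      derivWithin_congr (ih (by omega)) (ih (by omega) x hx), derivWithin_fun_add]
    · ring
    · exact (contDiffOn_phaseQuot hlt hf hf0 hu i 1 (by omega)).differentiableOn (by simp) x hx
    · exact (contDiffOn_phaseQuot hlt hf hf0 hv i 1 (by omega)).differentiableOn (by simp) x hx

theorem phaseQuot_sum (hlt : α < β)
    (hf : ContDiffOn ℝ r (derivWithin f (Icc α β)) (Icc α β \ {γ}))
    (hf0 : ∀ x ∈ Icc α β \ {γ}, derivWithin f (Icc α β) x ≠ 0) {ι : Type*} (s : Finset ι)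
    (a : ι → ℝ) (v : ι → ℝ → ℝ) (hv : ∀ j ∈ s, ContDiffOn ℝ r (v j) (Icc α β \ {γ}))
    (i : ℕ) (hi : i ≤ r) : ∀ x ∈ Icc α β \ {γ},
      phaseQuot α β f (fun x => ∑ j ∈ s, a j * v j x) i x
        = ∑ j ∈ s, a j * phaseQuot α β f (v j) i x := by
  have hS := uniqueDiffOn_diff_singleton (uniqueDiffOn_Icc hlt) γ
  induction i with
  | zero => intro x hx; simp [phaseQuot, Finset.sum_div, mul_div_assoc]
  | succ i ih =>
    intro x hx
    have hd : ∀ j ∈ s, DifferentiableWithinAt ℝ (phaseQuot α β f (v j) i) (Icc α β \ {γ}) x :=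
      fun j hj =>
        (contDiffOn_phaseQuot hlt hf hf0 (hv j hj) i 1 (by omega)).differentiableOn (by simp) x hx
    have h1 : HasDerivWithinAt (fun x => ∑ j ∈ s, a j * phaseQuot α β f (v j) i x)
        (∑ j ∈ s, a j * derivWithin (phaseQuot α β f (v j) i) (Icc α β \ {γ}) x)
        (Icc α β \ {γ}) x :=
      HasDerivWithinAt.fun_sum fun j hj => (hd j hj).hasDerivWithinAt.const_mul _
    rw [phaseQuot_succ_eq hx, derivWithin_congr (ih (by omega)) (ih (by omega) x hx),
      h1.derivWithin (hS x hx), ← Finset.sum_neg_distrib, Finset.sum_div]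
    refine Finset.sum_congr rfl fun j _ => ?_
    rw [phaseQuot_succ_eq hx]
    ring

/-- If `f'` has size `a |x - γ|` and all functions are symbols on the scale `|x - γ|`, then each
application of `v ↦ -v' / f'` gains a factor `1 / (a (x - γ)²)`. -/
theorem exists_phaseQuot_bound (r i : ℕ) (c : ℝ) : ∃ K > 0, ∀ (α β γ a : ℝ) (f u A : ℝ → ℝ), α < β →
    0 < a → SymbolOn (Icc α β \ {γ}) r (fun x => c * (a * |x - γ|)) (fun x => |x - γ|)
      (derivWithin f (Icc α β)) →
    (∀ x ∈ Icc α β \ {γ}, a * |x - γ| ≤ |derivWithin f (Icc α β) x|) →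
    SymbolOn (Icc α β \ {γ}) r A (fun x => |x - γ|) u → i ≤ r →
    SymbolOn (Icc α β \ {γ}) (r - i) (fun x => K * A x / (a * |x - γ|) / (a * |x - γ| ^ 2) ^ i)
      (fun x => |x - γ|) (phaseQuot α β f u i) := by
  obtain ⟨K₁, hK₁, hinv⟩ := SymbolOn.exists_inv r c
  induction i with
  | zero =>
    refine ⟨2 ^ r * K₁, by positivity, fun α β γ a f u A hlt ha hf hl hu _ => ?_⟩
    have hS := uniqueDiffOn_diff_singleton (uniqueDiffOn_Icc hlt) γ
    have hω : ∀ x ∈ Icc α β \ {γ}, 0 < |x - γ| := fun x hx => abs_pos.2 (sub_ne_zero.2 hx.2)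
    have h1 := hinv _ (fun x => a * |x - γ|) _ _ hS (fun x hx => mul_pos ha (hω x hx)) hω hf hl
    refine ((hu.mul hS hω h1).congr fun x hx => ?_).mono_left hω fun x hx => le_of_eq ?_
    · simp [phaseQuot, div_eq_mul_inv]
    · simp; ring
  | succ i ih =>
    obtain ⟨K, hK, ih⟩ := ih
    refine ⟨2 ^ r * (K * K₁), by positivity, fun α β γ a f u A hlt ha hf hl hu hi => ?_⟩
    have hS := uniqueDiffOn_diff_singleton (uniqueDiffOn_Icc hlt) γ
    have hω : ∀ x ∈ Icc α β \ {γ}, 0 < |x - γ| := fun x hx => abs_pos.2 (sub_ne_zero.2 hx.2)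
    have h1 := hinv _ (fun x => a * |x - γ|) _ _ hS (fun x hx => mul_pos ha (hω x hx)) hω hf hl
    have h2 := ih α β γ a f u A hlt ha hf hl hu (by omega)
    rw [show r - i = (r - (i + 1)) + 1 by omega, SymbolOn.succ_iff hS] at h2
    have h3 := (h2.2.2.const_mul hS (-1)).mul hS hω (h1.of_le (by omega : r - (i + 1) ≤ r))
    refine (h3.congr fun x hx => ?_).mono_left hω fun x hx => ?_
    · rw [phaseQuot_succ_eq hx]; ring
    · have h0 := hω x hx
      have hA : 0 ≤ A x := (abs_nonneg _).trans (hu.abs_le hx)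
      have hp : (2 : ℝ) ^ (r - (i + 1)) ≤ 2 ^ r := pow_le_pow_right₀ (by norm_num) (by omega)
      have e1 : 2 ^ r * (K * K₁) * A x / (a * |x - γ|) / (a * |x - γ| ^ 2) ^ (i + 1)
          = 2 ^ r * (|(-1 : ℝ)| * (K * A x / (a * |x - γ|) / (a * |x - γ| ^ 2) ^ i / |x - γ|)
            * (K₁ / (a * |x - γ|))) := by
        rw [abs_neg, abs_one]
        field_simp
        ring
      rw [e1]
      gcongr

end PhaseQuot

open Complex in
/-- Iterated integration by parts on `(0, d]` for an amplitude `w` vanishing to order `2n+1` at `0`.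
The `q i` stand for the boundary terms and `ρ` for the integrand left over. The integral is
estimated trivially on `[0, a^{-1/2}]` and through the boundary terms on `[a^{-1/2}, d]`; if
`a d² ≤ 1`, everything is estimated trivially. -/
theorem norm_integral_sub_sum_le {n : ℕ} {d a V K : ℝ} (hd : 0 < d) (ha : 0 < a) (hV : 0 ≤ V)
    (hK : 0 ≤ K) {w ρ : ℝ → ℂ} {q : ℕ → ℝ → ℂ} (hwc : ContinuousOn w (Icc 0 d))
    (hw : ∀ t ∈ Icc 0 d, ‖w t‖ ≤ V * t ^ (2 * n + 1))
    (hρc : ContinuousOn ρ (Ioc 0 d))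
    (hρ : ∀ t ∈ Ioc 0 d, ‖ρ t‖ ≤ K * V / a ^ (n + 2) * t ^ (-3 : ℤ))
    (hq : ∀ i ≤ n + 1, ∀ t ∈ Ioc 0 d, ‖q i t‖ ≤ K * (V * t ^ (2 * n)) / a / (a * t ^ 2) ^ i)
    (hder : ∀ t ∈ Ioc 0 d, HasDerivWithinAt (fun t => ∑ i ∈ Finset.range (n + 2), q i t)
      (w t + ρ t) (Icc 0 d) t) :
    ‖(∫ t in (0 : ℝ)..d, w t) - ∑ i ∈ Finset.range (n + 1), q i d‖
      ≤ (1 + (n + 4) * K) * (V / a ^ (n + 1)) := by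
  have hX : 0 ≤ V / a ^ (n + 1) := by positivity
  have hsmall : ∀ s ∈ Icc 0 d, a * s ^ 2 ≤ 1 → ‖∫ t in (0 : ℝ)..s, w t‖ ≤ V / a ^ (n + 1) := by
    intro s hs has
    have h1 := intervalIntegral.norm_integral_le_of_norm_le_const (a := 0) (b := s)
      (C := V * s ^ (2 * n + 1)) (f := w) ?_
    · refine h1.trans ?_
      rw [sub_zero, abs_of_nonneg hs.1, le_div_iff₀ (by positivity)]
      calc V * s ^ (2 * n + 1) * s * a ^ (n + 1) = V * (a * s ^ 2) ^ (n + 1) := by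
            rw [mul_pow, ← pow_mul]; ring
        _ ≤ V * 1 := by
            gcongr
            exact pow_le_one₀ (by positivity) has
        _ = V := mul_one V
    · intro t ht
      rw [uIoc_of_le hs.1] at ht
      refine (hw t ⟨ht.1.le, ht.2.trans hs.2⟩).trans ?_
      have := ht.1.le
      have := ht.2
      gcongr
  rcases le_or_gt (a * d ^ 2) 1 with hcase | hcase
  · have h1 := hsmall d ⟨hd.le, le_rfl⟩ hcase
    have h2 : ∀ i ∈ Finset.range (n + 1), ‖q i d‖ ≤ K * (V / a ^ (n + 1)) := by
      intro i hi
      rw [Finset.mem_range] at hi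
      refine (hq i (by omega) d ⟨hd, le_rfl⟩).trans ?_
      have e1 : K * (V * d ^ (2 * n)) / a / (a * d ^ 2) ^ i
          = K * (V / a ^ (n + 1)) * (a * d ^ 2) ^ (n - i) := by
        have h3 : (a * d ^ 2) ^ (n - i) = (a * d ^ 2) ^ n / (a * d ^ 2) ^ i := by
          rw [pow_sub₀ _ (by positivity) (by omega)]; rfl
        rw [h3, mul_pow a (d ^ 2) n, ← pow_mul]
        field_simp
        ring
      rw [e1]
      exact mul_le_of_le_one_right (by positivity) (pow_le_one₀ (by positivity) hcase)
    calc _ ≤ V / a ^ (n + 1) + ∑ i ∈ Finset.range (n + 1), K * (V / a ^ (n + 1)) :=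
          (norm_sub_le _ _).trans (add_le_add h1 (norm_sum_le_of_le _ h2))
      _ = (1 + (n + 1) * K) * (V / a ^ (n + 1)) := by simp; ring
      _ ≤ _ := by gcongr; linarith
  · -- the trivial estimate and integration by parts balance where `a * s ^ 2 = 1`
    set s := 1 / √a with hs
    have hsa : 0 < √a := Real.sqrt_pos.2 ha
    have hs0 : 0 < s := by positivity
    have has : a * s ^ 2 = 1 := by
      rw [hs, div_pow, Real.sq_sqrt ha.le]; field_simp
    have hsd : s < d := by
      have : s ^ 2 < d ^ 2 := by
        rw [← has] at hcase; exact lt_of_mul_lt_mul_left hcase ha.le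
      exact lt_of_pow_lt_pow_left₀ 2 hd.le this
    have hsub : Icc s d ⊆ Ioc 0 d := fun t ht => ⟨hs0.trans_le ht.1, ht.2⟩
    have hwi : IntervalIntegrable w volume s d :=
      (hwc.mono (hsub.trans Ioc_subset_Icc_self)).intervalIntegrable_of_Icc hsd.le
    have hwi0 : IntervalIntegrable w volume 0 s :=
      (hwc.mono (Icc_subset_Icc_right hsd.le)).intervalIntegrable_of_Icc hs0.le
    have hρi : IntervalIntegrable ρ volume s d :=
      (hρc.mono hsub).intervalIntegrable_of_Icc hsd.le
    have hFTC := intervalIntegral.integral_eq_sub_of_hasDerivAt_of_le hsd.le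
      (fun t ht => ((hder t (hsub ht)).continuousWithinAt).mono
        (hsub.trans Ioc_subset_Icc_self))
      (fun t ht => (hder t (hsub (Ioo_subset_Icc_self ht))).hasDerivAt
        (Icc_mem_nhds (hs0.trans ht.1) ht.2)) (hwi.add hρi)
    rw [intervalIntegral.integral_add hwi hρi] at hFTC
    have hρint : ‖∫ t in s..d, ρ t‖ ≤ K * (V / a ^ (n + 1)) := by
      have h1 : IntervalIntegrable (fun t : ℝ => K * V / a ^ (n + 2) * t ^ (-3 : ℤ)) volume s d := by
        refine ContinuousOn.intervalIntegrable_of_Icc hsd.le (continuousOn_const.mul ?_)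
        exact fun t ht => (continuousAt_zpow₀ t _
          (Or.inl (hs0.trans_le ht.1).ne')).continuousWithinAt
      refine (intervalIntegral.norm_integral_le_of_norm_le hsd.le ?_ h1).trans ?_
      · exact Filter.Eventually.of_forall fun t ht => hρ t (hsub (Ioc_subset_Icc_self ht))
      · rw [intervalIntegral.integral_const_mul, integral_zpow]
        · have e1 : (-3 : ℤ) + 1 = -2 := by norm_num
          have e2 : s ^ (-2 : ℤ) = a := by
            rw [zpow_neg]; exact inv_eq_of_mul_eq_one_left (by exact_mod_cast has)
          have h2 : 0 < d ^ (-2 : ℤ) := zpow_pos hd _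
          rw [e1, e2]
          calc _ = K * V / a ^ (n + 2) * ((a - d ^ (-2 : ℤ)) / 2) := by push_cast; ring
            _ ≤ K * V / a ^ (n + 2) * a := by gcongr; linarith
            _ = _ := by rw [pow_succ a (n + 1)]; field_simp
        · right
          refine ⟨by norm_num, fun h => ?_⟩
          rw [uIcc_of_le hsd.le] at h
          exact absurd h.1 (not_le.2 hs0)
    have hqs : ∀ i ∈ Finset.range (n + 2), ‖q i s‖ ≤ K * (V / a ^ (n + 1)) := by
      intro i hi
      rw [Finset.mem_range] at hi
      refine (hq i (by omega) s ⟨hs0, hsd.le⟩).trans (le_of_eq ?_)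
      have h3 : s ^ (2 * n) = 1 / a ^ n := by
        rw [pow_mul, eq_div_iff (by positivity), ← mul_pow, mul_comm (s ^ 2), has, one_pow]
      rw [has, one_pow, h3]
      field_simp
      ring
    have hqd : ‖q (n + 1) d‖ ≤ K * (V / a ^ (n + 1)) := by
      refine (hq (n + 1) le_rfl d ⟨hd, le_rfl⟩).trans ?_
      have e1 : K * (V * d ^ (2 * n)) / a / (a * d ^ 2) ^ (n + 1)
          = K * (V / a ^ (n + 1)) / (a * d ^ 2) := by
        field_simp
        ring
      rw [e1]
      exact div_le_self (by positivity) hcase.le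
    have e3 : (∫ t in (0 : ℝ)..d, w t) - ∑ i ∈ Finset.range (n + 1), q i d
        = (∫ t in (0 : ℝ)..s, w t) + q (n + 1) d - (∑ i ∈ Finset.range (n + 2), q i s)
          - ∫ t in s..d, ρ t := by
      rw [← intervalIntegral.integral_add_adjacent_intervals hwi0 hwi]
      rw [Finset.sum_range_succ _ (n + 1)] at hFTC
      linear_combination hFTC
    rw [e3]
    calc _ ≤ V / a ^ (n + 1) + K * (V / a ^ (n + 1))
          + (∑ i ∈ Finset.range (n + 2), K * (V / a ^ (n + 1))) + K * (V / a ^ (n + 1)) := by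
          refine (norm_sub_le _ _).trans (add_le_add ((norm_sub_le _ _).trans (add_le_add
            ((norm_add_le _ _).trans (add_le_add ?_ hqd)) (norm_sum_le_of_le _ hqs))) hρint)
          exact hsmall s ⟨hs0.le, hsd.le⟩ has.le
      _ = _ := by simp; ring

/-! ### Amplitudes vanishing to high order at the stationary point -/

section Remainder

variable {α β γ : ℝ} {f u : ℝ → ℝ} {r : ℕ}

/-- The function `e(f) H_{i+1}` for the amplitude `u`, expressed through `phaseQuot`. -/
noncomputable def boundaryTerm (α β : ℝ) (f u : ℝ → ℝ) (i : ℕ) (x : ℝ) : ℂ :=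
  e (f x) * ((phaseQuot α β f u i x : ℂ) / (2 * Real.pi * Complex.I) ^ (i + 1))

theorem hasDerivWithinAt_phaseQuot (hlt : α < β)
    (hf : ContDiffOn ℝ r (derivWithin f (Icc α β)) (Icc α β \ {γ}))
    (hf0 : ∀ x ∈ Icc α β \ {γ}, derivWithin f (Icc α β) x ≠ 0)
    (hu : ContDiffOn ℝ r u (Icc α β \ {γ})) {i : ℕ} (hi : i < r) {x : ℝ}
    (hx : x ∈ Icc α β \ {γ}) :
    HasDerivWithinAt (phaseQuot α β f u i)
      (-(derivWithin f (Icc α β) x * phaseQuot α β f u (i + 1) x)) (Icc α β) x := by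
  have h1 := (contDiffOn_phaseQuot hlt hf hf0 hu i 1 (by omega)).differentiableOn (by simp) x hx
  rw [sdiff_eq, differentiableWithinAt_inter (isOpen_compl_singleton.mem_nhds hx.2)] at h1
  refine h1.hasDerivWithinAt.congr_deriv ?_
  have := hf0 x hx
  rw [phaseQuot]
  field_simp

theorem hasDerivWithinAt_e_comp {S : Set ℝ} {f' x : ℝ} (h : HasDerivWithinAt f f' S x) :
    HasDerivWithinAt (fun x => e (f x)) (2 * Real.pi * Complex.I * f' * e (f x)) S x := by
  refine ((hasDerivAt_e (f x)).scomp_hasDerivWithinAt x h).congr_deriv ?_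
  simp
  ring

/-- The boundary terms form a primitive of `u e(f)`, up to the integrand left after `m` integrations by
parts. -/
theorem hasDerivWithinAt_sum_boundaryTerm (hlt : α < β) (hfd : DifferentiableOn ℝ f (Icc α β))
    (hf : ContDiffOn ℝ r (derivWithin f (Icc α β)) (Icc α β \ {γ}))
    (hf0 : ∀ x ∈ Icc α β \ {γ}, derivWithin f (Icc α β) x ≠ 0)
    (hu : ContDiffOn ℝ r u (Icc α β \ {γ})) {m : ℕ} (hm : m ≤ r) {x : ℝ}
    (hx : x ∈ Icc α β \ {γ}) :
    HasDerivWithinAt (fun x => ∑ i ∈ Finset.range m, boundaryTerm α β f u i x)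
      (u x * e (f x) + -(e (f x) * (derivWithin f (Icc α β) x * phaseQuot α β f u m x : ℝ)
        / (2 * Real.pi * Complex.I) ^ m)) (Icc α β) x := by
  have hpi : (2 * Real.pi * Complex.I : ℂ) ≠ 0 := Complex.two_pi_I_ne_zero
  have h0 := hf0 x hx
  have h0c : ((derivWithin f (Icc α β) x : ℝ) : ℂ) ≠ 0 := by exact_mod_cast h0
  induction m with
  | zero =>
    have : (u x * e (f x) + -(e (f x) * (derivWithin f (Icc α β) x * phaseQuot α β f u 0 x : ℝ)
        / (2 * Real.pi * Complex.I) ^ 0)) = 0 := by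
      simp only [phaseQuot]
      rw [mul_div_cancel₀ _ h0]
      simp
      ring
    rw [this]
    simpa using hasDerivWithinAt_const x (Icc α β) (0 : ℂ)
  | succ m ih =>
    simp_rw [Finset.sum_range_succ]
    have h1 := (hasDerivWithinAt_phaseQuot hlt hf hf0 hu (i := m) (by omega) hx).ofReal_comp
    have h2 := (hasDerivWithinAt_e_comp (hfd x hx.1).hasDerivWithinAt).mul
      (h1.div_const ((2 * Real.pi * Complex.I) ^ (m + 1)))
    refine ((ih (by omega)).add h2).congr_deriv ?_
    push_cast
    generalize (2 * Real.pi * Complex.I : ℂ) = b at hpi ⊢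
    field_simp
    ring

/-- The contribution of one side of the stationary point; `σ = 1` is the right side and `σ = -1` the left
one. -/
theorem exists_one_sided_remainder_bound (n : ℕ) (c : ℝ) (hn : 1 ≤ n) : ∃ K > 0,
    ∀ (α β γ a V d σ : ℝ) (f u : ℝ → ℝ), α < β → 0 < a → 0 ≤ V → 0 < d → σ = 1 ∨ σ = -1 →
      (∀ t ∈ Icc 0 d, γ + σ * t ∈ Icc α β) → DifferentiableOn ℝ f (Icc α β) →
      SymbolOn (Icc α β \ {γ}) (2 * n + 1) (fun x => c * (a * |x - γ|)) (fun x => |x - γ|)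
        (derivWithin f (Icc α β)) →
      (∀ x ∈ Icc α β \ {γ}, a * |x - γ| ≤ |derivWithin f (Icc α β) x|) →
      SymbolOn (Icc α β \ {γ}) (2 * n + 1) (fun x => V * |x - γ| ^ (2 * n + 1))
        (fun x => |x - γ|) u → ContinuousOn u (Icc α β) →
      (∀ x ∈ Icc α β, |u x| ≤ V * |x - γ| ^ (2 * n + 1)) →
      ‖(∫ t in (0 : ℝ)..d, (u (γ + σ * t) : ℂ) * e (f (γ + σ * t)))
        - σ * ∑ i ∈ Finset.range (n + 1), boundaryTerm α β f u i (γ + σ * d)‖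
        ≤ K * (V / a ^ (n + 1)) := by
  choose k hk hkb using fun i => exists_phaseQuot_bound (2 * n + 1) i c
  set K₀ := ∑ i ∈ Finset.range (n + 3), k i with hK₀
  have hkK : ∀ i ≤ n + 2, k i ≤ K₀ := fun i hi =>
    Finset.single_le_sum (f := k) (fun i _ => (hk i).le) (Finset.mem_range.2 (by omega))
  have hK₀pos : 0 < K₀ := (hk 0).trans_le (hkK 0 (by omega))
  set K := (1 + |c|) * K₀ with hK
  have hKK₀ : K₀ ≤ K := by
    rw [hK, add_mul, one_mul]
    have : 0 ≤ |c| * K₀ := by positivity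
    linarith
  refine ⟨1 + (n + 4) * K, by positivity,
    fun α β γ a V d σ f u hlt ha hV hd hσ hmem hfd hf hl hu huc hub => ?_⟩
  have hσ2 : σ * σ = 1 := by rcases hσ with rfl | rfl <;> norm_num
  have hσa : |σ| = 1 := by rcases hσ with rfl | rfl <;> simp
  have habs : ∀ t, 0 ≤ t → |γ + σ * t - γ| = t := fun t ht => by
    rw [add_sub_cancel_left, abs_mul, hσa, one_mul, abs_of_nonneg ht]
  have hmem' : ∀ t ∈ Ioc 0 d, γ + σ * t ∈ Icc α β \ {γ} := fun t ht =>
    ⟨hmem t (Ioc_subset_Icc_self ht), fun h => by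
      have := habs t ht.1.le
      rw [mem_singleton_iff.1 h, sub_self, abs_zero] at this
      exact ht.1.ne this⟩
  have hf0 : ∀ x ∈ Icc α β \ {γ}, derivWithin f (Icc α β) x ≠ 0 := fun x hx =>
    abs_pos.1 ((mul_pos ha (abs_pos.2 (sub_ne_zero.2 hx.2))).trans_le (hl x hx))
  -- `n + 2` applications are possible since `1 ≤ n` gives `n + 2 ≤ 2 * n + 1`
  have hQ : ∀ i ≤ n + 2, ∀ t ∈ Ioc 0 d, |phaseQuot α β f u i (γ + σ * t)|
      ≤ K₀ * (V * t ^ (2 * n)) / a / (a * t ^ 2) ^ i := by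
    intro i hi t ht
    have h1 := (hkb i α β γ a f u _ hlt ha hf hl hu (by omega)).abs_le (hmem' t ht)
    rw [habs t ht.1.le] at h1
    refine h1.trans ?_
    have := ht.1
    calc _ = k i * (V * t ^ (2 * n)) / a / (a * t ^ 2) ^ i := by
          rw [pow_succ]; field_simp
      _ ≤ _ := by gcongr; exact hkK i hi
  have hpin : 1 ≤ ‖(2 * Real.pi * Complex.I : ℂ)‖ := by
    simp [abs_of_pos Real.pi_pos]
    linarith [Real.pi_gt_three]
  have hQc : ContinuousOn (phaseQuot α β f u (n + 2)) (Icc α β \ {γ}) :=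
    (contDiffOn_phaseQuot hlt hf.1 hf0 hu.1 (n + 2) 0 (by omega)).continuousOn
  have hγc : Continuous fun t : ℝ => γ + σ * t := by fun_prop
  have hcomp := norm_integral_sub_sum_le (n := n) (d := d) (a := a) (V := V) (K := K)
    (w := fun t => (u (γ + σ * t) : ℂ) * e (f (γ + σ * t)))
    (ρ := fun t => -(e (f (γ + σ * t)) * (derivWithin f (Icc α β) (γ + σ * t) *
      phaseQuot α β f u (n + 2) (γ + σ * t) : ℝ) / (2 * Real.pi * Complex.I) ^ (n + 2)))
    (q := fun i t => σ * boundaryTerm α β f u i (γ + σ * t)) hd ha hV (by positivity)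
    ?_ ?_ ?_ ?_ ?_ ?_
  · rwa [Finset.mul_sum]
  · refine ContinuousOn.mul (Complex.continuous_ofReal.comp_continuousOn
      (huc.comp hγc.continuousOn hmem)) (continuous_e.comp_continuousOn
      (hfd.continuousOn.comp hγc.continuousOn hmem))
  · intro t ht
    rw [norm_mul, norm_e, mul_one, Complex.norm_real, Real.norm_eq_abs]
    have := hub _ (hmem t ht)
    rwa [habs t ht.1] at this
  · refine ContinuousOn.neg (ContinuousOn.div_const (ContinuousOn.mul ?_ ?_) _)
    · exact continuous_e.comp_continuousOn (hfd.continuousOn.comp hγc.continuousOn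
        fun t ht => hmem t (Ioc_subset_Icc_self ht))
    · exact Complex.continuous_ofReal.comp_continuousOn
        ((hf.1.continuousOn.comp hγc.continuousOn hmem').mul (hQc.comp hγc.continuousOn hmem'))
  · intro t ht
    have ht0 := ht.1
    rw [norm_neg, norm_div, norm_mul, norm_e, one_mul, Complex.norm_real, Real.norm_eq_abs, abs_mul,
      norm_pow]
    have h1 := hf.abs_le (hmem' t ht)
    rw [habs t ht0.le] at h1
    have h2 := hQ (n + 2) le_rfl t ht
    have h3 : c * (a * t) ≤ |c| * (a * t) := by
      gcongr
      exact le_abs_self c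
    calc _ ≤ |derivWithin f (Icc α β) (γ + σ * t)| * |phaseQuot α β f u (n + 2) (γ + σ * t)| :=
          div_le_self (by positivity) (one_le_pow₀ hpin)
      _ ≤ (|c| * (a * t)) * (K₀ * (V * t ^ (2 * n)) / a / (a * t ^ 2) ^ (n + 2)) := by
          gcongr
          exact h1.trans h3
      _ = |c| * K₀ * V / a ^ (n + 2) * t ^ (-3 : ℤ) := by
          rw [mul_pow, zpow_neg, ← pow_mul, show 2 * (n + 2) = 2 * n + 1 + 3 by ring]
          norm_cast
          rw [pow_add t (2 * n + 1) 3, pow_succ t (2 * n)]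
          field_simp
      _ ≤ _ := by
          have : 0 < t ^ (-3 : ℤ) := zpow_pos ht0 _
          gcongr
          rw [hK]
          linarith
  · intro i hi t ht
    rw [norm_mul, Complex.norm_real, Real.norm_eq_abs, hσa, one_mul, boundaryTerm, norm_mul, norm_e,
      one_mul, norm_div, Complex.norm_real, Real.norm_eq_abs, norm_pow]
    have h2 := hQ i (by omega) t ht
    have := ht.1
    calc _ ≤ |phaseQuot α β f u i (γ + σ * t)| :=
          div_le_self (by positivity) (one_le_pow₀ hpin)
      _ ≤ _ := h2.trans (by gcongr)
  · intro t ht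
    have h1 := hasDerivWithinAt_sum_boundaryTerm hlt hfd hf.1 hf0 hu.1 (m := n + 2) (by omega)
      (hmem' t ht)
    have h2 : HasDerivWithinAt (fun t : ℝ => γ + σ * t) σ (Icc 0 d) t := by
      simpa using (((hasDerivAt_id t).const_mul σ).const_add γ).hasDerivWithinAt
    have h3 := (h1.scomp t h2 hmem).const_mul (σ : ℂ)
    simp_rw [← Finset.mul_sum]
    refine h3.congr_deriv ?_
    rw [Complex.real_smul, ← mul_assoc]
    rw [show (σ : ℂ) * σ = 1 by exact_mod_cast hσ2, one_mul]

/-- An amplitude vanishing to order `2n+1` at the stationary point contributes boundary terms at `α` and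
`β` only, up to `O(V / a^{n+1})`. -/
theorem exists_remainder_bound (n : ℕ) (c : ℝ) (hn : 1 ≤ n) : ∃ K > 0,
    ∀ (α β γ a V : ℝ) (f u : ℝ → ℝ), α < γ → γ < β → 0 < a → 0 ≤ V →
      DifferentiableOn ℝ f (Icc α β) →
      SymbolOn (Icc α β \ {γ}) (2 * n + 1) (fun x => c * (a * |x - γ|)) (fun x => |x - γ|)
        (derivWithin f (Icc α β)) →
      (∀ x ∈ Icc α β \ {γ}, a * |x - γ| ≤ |derivWithin f (Icc α β) x|) →
      SymbolOn (Icc α β \ {γ}) (2 * n + 1) (fun x => V * |x - γ| ^ (2 * n + 1))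
        (fun x => |x - γ|) u → ContinuousOn u (Icc α β) →
      (∀ x ∈ Icc α β, |u x| ≤ V * |x - γ| ^ (2 * n + 1)) →
      ‖(∫ x in α..β, (u x : ℂ) * e (f x))
        - (∑ i ∈ Finset.range (n + 1), boundaryTerm α β f u i β
          - ∑ i ∈ Finset.range (n + 1), boundaryTerm α β f u i α)‖
        ≤ K * (V / a ^ (n + 1)) := by
  obtain ⟨K, hK, h⟩ := exists_one_sided_remainder_bound n c hn
  refine ⟨2 * K, by positivity, fun α β γ a V f u hα hβ ha hV hfd hf hl hu huc hub => ?_⟩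
  have h1 := h α β γ a V (β - γ) 1 f u (hα.trans hβ) ha hV (by linarith) (Or.inl rfl)
    (fun t ht => ⟨by linarith [ht.1], by linarith [ht.2]⟩) hfd hf hl hu huc hub
  have h2 := h α β γ a V (γ - α) (-1) f u (hα.trans hβ) ha hV (by linarith) (Or.inr rfl)
    (fun t ht => ⟨by linarith [ht.2], by linarith [ht.1]⟩) hfd hf hl hu huc hub
  have hc : ContinuousOn (fun x => (u x : ℂ) * e (f x)) (Icc α β) :=
    (Complex.continuous_ofReal.comp_continuousOn huc).mul
      (continuous_e.comp_continuousOn hfd.continuousOn)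
  have i1 : ∫ t in (0 : ℝ)..(β - γ), (u (γ + 1 * t) : ℂ) * e (f (γ + 1 * t))
      = ∫ x in γ..β, (u x : ℂ) * e (f x) := by
    have := intervalIntegral.integral_comp_add_left (a := 0) (b := β - γ)
      (fun x => (u x : ℂ) * e (f x)) γ
    simp only [add_zero, add_sub_cancel] at this
    simp only [one_mul, this]
  have i2 : ∫ t in (0 : ℝ)..(γ - α), (u (γ + -1 * t) : ℂ) * e (f (γ + -1 * t))
      = ∫ x in α..γ, (u x : ℂ) * e (f x) := by
    have := intervalIntegral.integral_comp_sub_left (a := 0) (b := γ - α)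
      (fun x => (u x : ℂ) * e (f x)) γ
    simp only [sub_zero, sub_sub_cancel] at this
    simp only [neg_one_mul, ← sub_eq_add_neg, this]
  rw [i1, one_mul, add_sub_cancel, Complex.ofReal_one, one_mul] at h1
  rw [i2, show γ + -1 * (γ - α) = α by ring] at h2
  have hsplit := intervalIntegral.integral_add_adjacent_intervals
    ((hc.mono (Icc_subset_Icc_right hβ.le)).intervalIntegrable_of_Icc (μ := volume) hα.le)
    ((hc.mono (Icc_subset_Icc_left hα.le)).intervalIntegrable_of_Icc (μ := volume) hβ.le)
  rw [← hsplit]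
  refine le_trans (le_of_eq ?_) ((norm_add_le _ _).trans ((add_le_add h2 h1).trans
    (le_of_eq (by ring))))
  congr 1
  push_cast
  ring

end Remainder

/-! ### The Morse coordinate -/

/-- `y` is a Morse coordinate, with derivative `z`, for the phase `f` at `γ`: `f = f(γ) + l y²`. The
normalisation `y'(γ) = 1` corresponds to `l = f''(γ) / 2`. The last identity for `f'` follows from
the others and is recorded for convenience. -/
structure IsMorseCoordinate (α β γ l : ℝ) (f y z : ℝ → ℝ) : Prop where
  hasDerivWithinAt : ∀ x ∈ Icc α β, HasDerivWithinAt y (z x) (Icc α β) x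
  phase_eq : ∀ x ∈ Icc α β, f x = f γ + l * y x ^ 2
  deriv_phase_eq : ∀ x ∈ Icc α β, derivWithin f (Icc α β) x = 2 * l * y x * z x
  apply_center : y γ = 0
  deriv_center : z γ = 1

theorem segmentMean_self (γ : ℝ) (j : ℕ) (w : ℝ → ℝ) : segmentMean γ j w γ = w γ / (j + 1) := by
  simp [segmentMean]
  field_simp

theorem sub_mul_segmentMean_eq_derivWithin {α β γ : ℝ} {f : ℝ → ℝ} (hγ : γ ∈ Icc α β)
    (hd : DifferentiableOn ℝ (derivWithin f (Icc α β)) (Icc α β))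
    (hc : ContinuousOn (derivWithin (derivWithin f (Icc α β)) (Icc α β)) (Icc α β))
    (h0 : derivWithin f (Icc α β) γ = 0) {x : ℝ} (hx : x ∈ Icc α β) :
    derivWithin f (Icc α β) x
      = (x - γ) * segmentMean γ 0 (derivWithin (derivWithin f (Icc α β)) (Icc α β)) x := by
  rw [← sub_eq_mul_segmentMean hγ hd hc hx, h0, sub_zero]

/-- Write `f - f(γ) = (x - γ)² h(x)` and take `y = (x - γ) √(h / l)`. As `h` is an average of `f''`, it
is a symbol comparable to `l`. Since `f'` is `x - γ` times an average
of `f''`, the derivative `z = f' / (2 l y)` is a quotient of symbols of order `r`, so that `y` has one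
derivative more than its definition shows. -/
theorem exists_isMorseCoordinate (r : ℕ) (hr : 1 ≤ r) {c : ℝ} (hc : 0 < c) : ∃ K > 0,
    ∀ (α β γ A M : ℝ) (f : ℝ → ℝ), α < β → γ ∈ Icc α β → 0 < A → 0 < M →
      DifferentiableOn ℝ f (Icc α β) → DifferentiableOn ℝ (derivWithin f (Icc α β)) (Icc α β) →
      derivWithin f (Icc α β) γ = 0 →
      SymbolOn (Icc α β) r (fun _ => c * A) (fun _ => M)
        (derivWithin (derivWithin f (Icc α β)) (Icc α β)) →
      (∀ x ∈ Icc α β, A ≤ derivWithin (derivWithin f (Icc α β)) (Icc α β) x) →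
      ∃ y z : ℝ → ℝ, IsMorseCoordinate α β γ
          (derivWithin (derivWithin f (Icc α β)) (Icc α β) γ / 2) f y z ∧
        SymbolOn (Icc α β) r (fun _ => K) (fun _ => M) z ∧
        (∀ x ∈ Icc α β, |y x| ≤ K * |x - γ|) ∧ (∀ x ∈ Icc α β, |x - γ| ≤ K * |y x|) ∧
        (∀ x ∈ Icc α β, γ < x → 0 < y x) ∧ (∀ x ∈ Icc α β, x < γ → y x < 0) := by
  obtain ⟨K₁, hK₁, hsqrt⟩ := SymbolOn.exists_sqrt r (a := 1 / c) (by positivity) (2 * c)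
  have hsc : 0 < √(1 / c) := by positivity
  obtain ⟨K₂, hK₂, hinv⟩ := SymbolOn.exists_inv r (K₁ / √(1 / c))
  refine ⟨K₁ + 1 / √(1 / c) + 2 ^ r * (c * (K₂ / √(1 / c))), by positivity,
    fun α β γ A M f hlt hγ hA hM hfd hf'd hf0 hf2 hlow => ?_⟩
  set F := derivWithin (derivWithin f (Icc α β)) (Icc α β) with hF
  have hS := uniqueDiffOn_Icc hlt
  have hFc : ContinuousOn F (Icc α β) := hf2.1.continuousOn
  have hω : ∀ x ∈ Icc α β, 0 < (fun _ : ℝ => M) x := fun _ _ => hM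
  set l := F γ / 2 with hl
  have hlA : A / 2 ≤ l := by rw [hl]; linarith [hlow γ hγ]
  have hlpos : 0 < l := lt_of_lt_of_le (by positivity) hlA
  have hlc : l ≤ c * A / 2 := by
    have := (le_abs_self _).trans (hf2.abs_le hγ)
    rw [hl]; linarith
  set h := segmentMean γ 0 (segmentMean γ 1 F) with hh
  have hs1 : SymbolOn (Icc α β) r (fun _ => c * A) (fun _ => M) (segmentMean γ 1 F) :=
    hf2.segmentMean hlt hγ 1
  have hsh : SymbolOn (Icc α β) r (fun _ => c * A) (fun _ => M) h := hs1.segmentMean hlt hγ 0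
  have hhlow : ∀ x ∈ Icc α β, A / 2 ≤ h x := fun x hx =>
    le_segmentMean (a := A / 2) hγ hs1.1.continuousOn hx
      (fun x hx => le_segmentMean hγ hFc hx hlow (by norm_num)) (by norm_num)
  have hhγ : h γ = l := by
    rw [hh, segmentMean_self, segmentMean_self, hl]; norm_num
  -- the second order factorisation of the phase at `γ`
  have hfac : ∀ x ∈ Icc α β, f x = f γ + (x - γ) ^ 2 * h x := by
    intro x hx
    have e1 := sub_eq_mul_segmentMean hγ hfd hf'd.continuousOn hx
    have hder : ∀ x ∈ Icc α β, HasDerivWithinAt (segmentMean γ 0 (derivWithin f (Icc α β)))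
        (segmentMean γ 1 F x) (Icc α β) x := fun x hx =>
      hasDerivWithinAt_segmentMean hγ hf'd hFc hx
    have hdeq : EqOn (derivWithin (segmentMean γ 0 (derivWithin f (Icc α β))) (Icc α β))
        (segmentMean γ 1 F) (Icc α β) := fun x hx => (hder x hx).derivWithin (hS x hx)
    have e2 := sub_eq_mul_segmentMean hγ (fun x hx => (hder x hx).differentiableWithinAt)
      (hs1.1.continuousOn.congr hdeq) hx
    rw [segmentMean_self, hf0, segmentMean_congr hγ hx hdeq] at e2
    simp only [zero_div, sub_zero] at e2
    rw [e2] at e1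
    linear_combination e1
  set q : ℝ → ℝ := fun x => √(1 / l * h x) with hq
  have hql : ∀ x ∈ Icc α β, 1 / c ≤ 1 / l * h x := by
    intro x hx
    rw [div_mul_eq_mul_div, one_mul, div_le_div_iff₀ hc hlpos]
    nlinarith [hhlow x hx]
  have hhl : SymbolOn (Icc α β) r (fun _ => 2 * c) (fun _ => M) (fun x => 1 / l * h x) := by
    refine (hsh.const_mul hS (1 / l)).mono_left hω fun x _ => ?_
    rw [abs_of_pos (by positivity), div_mul_eq_mul_div, one_mul, div_le_iff₀ hlpos]
    nlinarith
  have hqs : SymbolOn (Icc α β) r (fun _ => K₁) (fun _ => M) q := hsqrt _ _ _ hS hω hhl hql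
  have hqlow : ∀ x ∈ Icc α β, √(1 / c) ≤ q x := fun x hx => Real.sqrt_le_sqrt (hql x hx)
  have hqpos : ∀ x ∈ Icc α β, 0 < q x := fun x hx => hsc.trans_le (hqlow x hx)
  have hqi : SymbolOn (Icc α β) r (fun _ => K₂ / √(1 / c)) (fun _ => M) (fun x => (q x)⁻¹) := by
    refine hinv _ (fun _ => √(1 / c)) _ _ hS (fun _ _ => hsc) hω
      (hqs.mono_left hω fun x _ => le_of_eq (by field_simp)) fun x hx => ?_
    rw [abs_of_pos (hqpos x hx)]
    exact hqlow x hx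
  have hq2 : ∀ x ∈ Icc α β, l * q x ^ 2 = h x := by
    intro x hx
    rw [hq, Real.sq_sqrt ((by positivity : 0 ≤ 1 / c).trans (hql x hx))]
    field_simp
  have hqγ : q γ = 1 := by
    rw [hq]; simp only [hhγ]; rw [one_div_mul_cancel hlpos.ne', Real.sqrt_one]
  set κ := segmentMean γ 0 F with hκ
  have hκs : SymbolOn (Icc α β) r (fun _ => c * A) (fun _ => M) κ := hf2.segmentMean hlt hγ 0
  have hf' : ∀ x ∈ Icc α β, derivWithin f (Icc α β) x = (x - γ) * κ x := fun x hx =>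
    sub_mul_segmentMean_eq_derivWithin hγ hf'd hFc hf0 hx
  have hκγ : κ γ = 2 * l := by rw [hκ, segmentMean_self, hl]; norm_num; ring
  set y : ℝ → ℝ := fun x => (x - γ) * q x with hy
  set z : ℝ → ℝ := fun x => 1 / (2 * l) * (κ x * (q x)⁻¹) with hz
  have hphase : ∀ x ∈ Icc α β, f x = f γ + l * y x ^ 2 := by
    intro x hx
    rw [hfac x hx, ← hq2 x hx, hy]; ring
  have hyz : ∀ x ∈ Icc α β, derivWithin f (Icc α β) x = 2 * l * y x * z x := by
    intro x hx
    have := (hqpos x hx).ne'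
    rw [hf' x hx, hy, hz]
    field_simp
  have hzγ : z γ = 1 := by
    rw [hz]; simp only [hqγ, hκγ]; field_simp
  have hder : ∀ x ∈ Icc α β, HasDerivWithinAt y (z x) (Icc α β) x := by
    intro x hx
    have hqd : HasDerivWithinAt q (derivWithin q (Icc α β) x) (Icc α β) x :=
      (hqs.1.differentiableOn (by simp; omega) x hx).hasDerivWithinAt
    have h1 := ((hasDerivAt_id x).sub_const γ).hasDerivWithinAt (s := Icc α β) |>.mul hqd
    simp only [id, one_mul] at h1
    have h2 : HasDerivWithinAt y (q x + (x - γ) * derivWithin q (Icc α β) x) (Icc α β) x := h1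
    refine h2.congr_deriv ?_
    -- away from `γ`, differentiate the identity for the phase and cancel `y`
    rcases eq_or_ne x γ with rfl | hne
    · rw [hzγ, hqγ]; ring
    · have h3 := ((h2.pow 2).const_mul l).const_add (f γ)
      have h4 := (h3.congr hphase (hphase x hx)).derivWithin (hS x hx)
      rw [hyz x hx] at h4
      have h5 : y x ≠ 0 := mul_ne_zero (sub_ne_zero.2 hne) (hqpos x hx).ne'
      simp only [Nat.cast_ofNat, Nat.add_one_sub_one, pow_one] at h4
      have h6 : 2 * l * y x * (q x + (x - γ) * derivWithin q (Icc α β) x) = 2 * l * y x * z x := by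
        linarith
      exact mul_left_cancel₀ (by positivity) h6
  have hyabs : ∀ x ∈ Icc α β, |y x| = |x - γ| * q x := fun x hx => by
    rw [hy]; simp only [abs_mul, abs_of_pos (hqpos x hx)]
  have hp1 : 0 < 1 / √(1 / c) := by positivity
  have hp2 : 0 < 2 ^ r * (c * (K₂ / √(1 / c))) := by positivity
  refine ⟨y, z, ⟨hder, hphase, hyz, by rw [hy]; simp, hzγ⟩, ?_, ?_, ?_, ?_, ?_⟩
  · refine ((hκs.mul hS hω hqi).const_mul hS (1 / (2 * l))).mono_left hω fun x _ => ?_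
    rw [abs_of_pos (by positivity)]
    calc _ = A / (2 * l) * (2 ^ r * (c * (K₂ / √(1 / c)))) := by field_simp
      _ ≤ 1 * (2 ^ r * (c * (K₂ / √(1 / c)))) := by
          gcongr
          rw [div_le_one (by positivity)]; linarith
      _ ≤ _ := by linarith
  · intro x hx
    rw [hyabs x hx, mul_comm]
    have := (le_abs_self _).trans (hqs.abs_le hx)
    gcongr
    linarith
  · intro x hx
    rw [hyabs x hx]
    have h1 := hqlow x hx
    calc |x - γ| = 1 / √(1 / c) * (|x - γ| * √(1 / c)) := by field_simp
      _ ≤ _ := by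
        gcongr
        linarith
  · exact fun x hx hlt => mul_pos (sub_pos.2 hlt) (hqpos x hx)
  · exact fun x hx hlt => mul_neg_of_neg_of_pos (sub_neg.2 hlt) (hqpos x hx)

/-! ### Taylor series at the stationary point -/

section Jet

variable {α β γ : ℝ}

/-- The Taylor series of `h` at `γ`, with derivatives within `[α, β]`. -/
noncomputable def jet (α β γ : ℝ) (h : ℝ → ℝ) : PowerSeries ℝ := PowerSeries.mk (taylorCoef α β γ h)

open PowerSeries

theorem X_pow_dvd_jet_mul_sub {r : ℕ} (hlt : α < β) (hγ : γ ∈ Icc α β) {u v : ℝ → ℝ}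
    (hu : ContDiffOn ℝ r u (Icc α β)) (hv : ContDiffOn ℝ r v (Icc α β)) :
    X ^ (r + 1) ∣ jet α β γ (fun x => u x * v x) - jet α β γ u * jet α β γ v := by
  rw [X_pow_dvd_iff]
  intro m hm
  have hm' : (m : WithTop ℕ∞) ≤ r := by exact_mod_cast (by omega : m ≤ r)
  rw [map_sub, sub_eq_zero, coeff_mul, Finset.Nat.sum_antidiagonal_eq_sum_range_succ_mk]
  simp only [jet, coeff_mk, taylorCoef]
  have h := iteratedDerivWithin_mul hγ (uniqueDiffOn_Icc hlt) ((hu γ hγ).of_le hm')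
    ((hv γ hγ).of_le hm')
  change iteratedDerivWithin m (u * v) (Icc α β) γ / _ = _
  rw [h, Finset.sum_div]
  refine Finset.sum_congr rfl fun i hi => ?_
  rw [Finset.mem_range] at hi
  rw [Nat.cast_choose ℝ (by omega : i ≤ m)]
  have h1 : (m.factorial : ℝ) ≠ 0 := by positivity
  have h2 : (i.factorial : ℝ) ≠ 0 := by positivity
  have h3 : ((m - i).factorial : ℝ) ≠ 0 := by positivity
  field_simp

theorem X_pow_dvd_jet_pow_sub {r : ℕ} (hlt : α < β) (hγ : γ ∈ Icc α β) {u : ℝ → ℝ}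
    (hu : ContDiffOn ℝ r u (Icc α β)) (k : ℕ) :
    X ^ (r + 1) ∣ jet α β γ (fun x => u x ^ k) - jet α β γ u ^ k := by
  induction k with
  | zero =>
    have h1 : jet α β γ (fun x => u x ^ 0) = 1 := by
      ext m
      rcases Nat.eq_zero_or_pos m with rfl | hm
      · simp [jet, taylorCoef]
      · simp [jet, taylorCoef, iteratedDerivWithin_const, hm.ne', coeff_one]
    rw [h1]
    simp
  | succ k ih =>
    have h1 := X_pow_dvd_jet_mul_sub hlt hγ (hu.pow k) hu
    have h2 := ih.mul_right (jet α β γ u)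
    have h3 := dvd_add h1 h2
    simp only [pow_succ _ k]
    refine h3.trans (dvd_of_eq ?_)
    ring

theorem jet_deriv {y z : ℝ → ℝ} (hlt : α < β) (hγ : γ ∈ Icc α β)
    (h : ∀ x ∈ Icc α β, HasDerivWithinAt y (z x) (Icc α β) x) :
    jet α β γ z = d⁄dX ℝ (jet α β γ y) := by
  ext k
  have h1 : EqOn (derivWithin y (Icc α β)) z (Icc α β) := fun x hx =>
    (h x hx).derivWithin (uniqueDiffOn_Icc hlt x hx)
  rw [coeff_derivative, jet, jet, coeff_mk, coeff_mk, taylorCoef, taylorCoef,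
    iteratedDerivWithin_succ', iteratedDerivWithin_congr h1 hγ, Nat.factorial_succ]
  push_cast
  field_simp

theorem X_pow_dvd_jet_sub_sum {r : ℕ} (hlt : α < β) (hγ : γ ∈ Icc α β) {ι : Type*} (s : Finset ι)
    {g : ℝ → ℝ} {a : ι → ℝ} {u : ι → ℝ → ℝ} (hg : ContDiffOn ℝ r g (Icc α β))
    (hu : ∀ i ∈ s, ContDiffOn ℝ r (u i) (Icc α β)) :
    X ^ (r + 1) ∣ jet α β γ (fun x => g x - ∑ i ∈ s, a i * u i x)
      - (jet α β γ g - ∑ i ∈ s, C (a i) * jet α β γ (u i)) := by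
  rw [X_pow_dvd_iff]
  intro m hm
  have hS := uniqueDiffOn_Icc hlt
  have hm' : (m : WithTop ℕ∞) ≤ r := by exact_mod_cast (by omega : m ≤ r)
  have hu' : ∀ i ∈ s, ContDiffWithinAt ℝ m (u i) (Icc α β) γ :=
    fun i hi => ((hu i hi) γ hγ).of_le hm'
  have h1 := iteratedDerivWithin_sub hγ hS ((hg γ hγ).of_le hm')
    (ContDiffWithinAt.sum (s := s) fun i hi => contDiffWithinAt_const (c := a i).mul (hu' i hi))
  have h2 : iteratedDerivWithin m (fun x => ∑ i ∈ s, a i * u i x) (Icc α β) γ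
      = ∑ i ∈ s, a i * iteratedDerivWithin m (u i) (Icc α β) γ := by
    rw [iteratedDerivWithin_fun_sum hγ hS fun i hi => contDiffWithinAt_const.mul (hu' i hi)]
    exact Finset.sum_congr rfl fun i hi => iteratedDerivWithin_const_mul hγ hS _ (hu' i hi)
  simp only [map_sub, map_sum, coeff_C_mul, jet, coeff_mk, taylorCoef]
  change iteratedDerivWithin m (g - fun x => ∑ i ∈ s, a i * u i x) (Icc α β) γ / _ - _ = 0
  rw [h1, h2, sub_div, Finset.sum_div]
  simp_rw [mul_div_assoc]
  ring

end Jet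

/-! ### Monomials in the Morse coordinate -/

section Consequences

variable {α β γ l : ℝ} {f y z : ℝ → ℝ}

open PowerSeries in
/-- With the coefficients `ϖ_k`, the combination of the `y^k y'` agrees with `g` to order `2n` at `γ`. -/
theorem IsMorseCoordinate.iteratedDerivWithin_sub_sum_eq_zero (hm : IsMorseCoordinate α β γ l f y z)
    (hlt : α < β) (hγ : γ ∈ Icc α β) (n : ℕ) (hl0 : l ≠ 0) (hl : taylorCoef α β γ f 2 = l)
    (hy : ContDiffOn ℝ (2 * n + 2 : ℕ) y (Icc α β)) (hz : ContDiffOn ℝ (2 * n + 1 : ℕ) z (Icc α β))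
    {g : ℝ → ℝ} (hg : ContDiffOn ℝ (2 * n + 1 : ℕ) g (Icc α β)) {s : ℕ} (hs : s ≤ 2 * n) :
    iteratedDerivWithin s (fun x => g x - ∑ k ∈ Finset.range (2 * n + 1),
      varpi saddleCoef n (taylorCoef α β γ f) (taylorCoef α β γ g) k * (y x ^ k * z x))
        (Icc α β) γ = 0 := by
  have hS := uniqueDiffOn_Icc hlt
  set lam := taylorCoef α β γ f with hlam
  set eta := taylorCoef α β γ g with heta
  set Y := jet α β γ y with hY
  have hder : jet α β γ z = d⁄dX ℝ Y := jet_deriv hlt hγ hm.hasDerivWithinAt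
  have hle1 : ((2 * n : ℕ) : WithTop ℕ∞) ≤ (2 * n + 1 : ℕ) := by exact_mod_cast Nat.le_succ _
  have hle2 : ((2 * n : ℕ) : WithTop ℕ∞) ≤ (2 * n + 2 : ℕ) := by
    exact_mod_cast (by omega : 2 * n ≤ 2 * n + 2)
  have hY0 : constantCoeff Y = 0 := by
    rw [← coeff_zero_eq_constantCoeff_apply, hY, jet, coeff_mk, taylorCoef]
    simp [hm.apply_center]
  have hY1 : coeff 1 Y = 1 := by
    have := congrArg (coeff 0) hder
    rw [coeff_derivative, jet, coeff_mk, taylorCoef] at this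
    simp only [iteratedDerivWithin_zero, hm.deriv_center] at this
    simpa using this.symm
  have hY2 : X ^ (2 * n + 3) ∣ C (lam 2) * Y ^ 2
      - ∑ m ∈ Finset.Icc 2 (2 * n + 3), C (lam m) * X ^ m := by
    rw [X_pow_dvd_iff]
    intro m hm3
    have hsum : coeff m (∑ m ∈ Finset.Icc 2 (2 * n + 3), C (lam m) * X ^ m : ℝ⟦X⟧)
        = if 2 ≤ m then lam m else 0 := by
      rw [map_sum]
      simp_rw [coeff_C_mul, coeff_X_pow, mul_ite, mul_one, mul_zero]
      rw [Finset.sum_ite_eq]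
      simp only [Finset.mem_Icc]
      congr 1
      simp only [eq_iff_iff, and_iff_left_iff_imp]
      omega
    rw [map_sub, coeff_C_mul, hsum]
    split_ifs with h2
    · have hmul := X_pow_dvd_jet_mul_sub hlt hγ hy hy
      rw [X_pow_dvd_iff] at hmul
      have h3 := hmul m (by omega)
      rw [map_sub, sub_eq_zero, ← sq] at h3
      rw [hY, ← h3, jet, coeff_mk]
      have hm' : (m : WithTop ℕ∞) ≤ (2 * n + 2 : ℕ) := by exact_mod_cast (by omega : m ≤ 2 * n + 2)
      have hcd : ContDiffWithinAt ℝ m (fun x => y x * y x) (Icc α β) γ :=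
        ((hy.mul hy) γ hγ).of_le hm'
      have h4 : iteratedDerivWithin m f (Icc α β) γ
          = l * iteratedDerivWithin m (fun x => y x * y x) (Icc α β) γ := by
        rw [iteratedDerivWithin_congr (g := fun x => f γ + l * (y x * y x))
          (fun x hx => by rw [hm.phase_eq x hx]; ring) hγ,
          iteratedDerivWithin_const_add (by omega), iteratedDerivWithin_const_mul hγ hS _ hcd]
      rw [hl, hlam, taylorCoef, taylorCoef, h4]
      ring
    · have : m = 0 ∨ m = 1 := by omega
      have hc : coeff m (Y ^ 2) = 0 := by
        have hX : X ^ 2 ∣ Y ^ 2 := pow_dvd_pow_of_dvd (X_dvd_iff.2 hY0) 2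
        rw [X_pow_dvd_iff] at hX
        exact hX m (by omega)
      rw [hc]; ring
  have hexp := X_pow_dvd_sub_varpi n lam eta (by rw [hl]; exact hl0) Y hY0 hY1 hY2
  have hmon : ∀ k, X ^ (2 * n + 1) ∣ jet α β γ (fun x => y x ^ k * z x) - Y ^ k * d⁄dX ℝ Y := by
    intro k
    have h1 := X_pow_dvd_jet_mul_sub hlt hγ ((hy.of_le hle2).pow k) (hz.of_le hle1)
    have h2 := (X_pow_dvd_jet_pow_sub hlt hγ (hy.of_le hle2) k).mul_right (jet α β γ z)
    rw [← hder]
    refine (dvd_add h1 h2).trans (dvd_of_eq ?_)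
    ring
  have hR := X_pow_dvd_jet_sub_sum hlt hγ (Finset.range (2 * n + 1)) (a := varpi saddleCoef n lam eta)
    (u := fun k x => y x ^ k * z x) (hg.of_le hle1)
    (fun k _ => ((hy.of_le hle2).pow k).mul (hz.of_le hle1))
  have hsum : X ^ (2 * n + 1) ∣ ∑ k ∈ Finset.range (2 * n + 1), C (varpi saddleCoef n lam eta k) *
      (jet α β γ (fun x => y x ^ k * z x) - Y ^ k * d⁄dX ℝ Y) :=
    Finset.dvd_sum fun k _ => (hmon k).mul_left _
  have htot := dvd_add (dvd_sub hR hsum) hexp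
  have heq : jet α β γ (fun x => g x - ∑ k ∈ Finset.range (2 * n + 1),
      varpi saddleCoef n lam eta k * (y x ^ k * z x))
      - (jet α β γ g - ∑ k ∈ Finset.range (2 * n + 1), C (varpi saddleCoef n lam eta k) *
        jet α β γ (fun x => y x ^ k * z x))
      - ∑ k ∈ Finset.range (2 * n + 1), C (varpi saddleCoef n lam eta k) *
        (jet α β γ (fun x => y x ^ k * z x) - Y ^ k * d⁄dX ℝ Y)
      + (PowerSeries.mk eta - ∑ k ∈ Finset.range (2 * n + 1),
        C (varpi saddleCoef n lam eta k) * (Y ^ k * d⁄dX ℝ Y))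
      = jet α β γ (fun x => g x - ∑ k ∈ Finset.range (2 * n + 1),
        varpi saddleCoef n lam eta k * (y x ^ k * z x)) := by
    simp_rw [mul_sub]
    rw [Finset.sum_sub_distrib, jet, jet, ← heta]
    ring
  rw [heq, X_pow_dvd_iff] at htot
  have h5 := htot s (by omega)
  rw [jet, coeff_mk, taylorCoef, div_eq_zero_iff] at h5
  exact h5.resolve_right (by positivity)

theorem abs_iteratedDerivWithin_le_of_vanishing (hlt : α < β) (hγ : γ ∈ Icc α β) {V : ℝ} (m : ℕ)
    {u : ℝ → ℝ} (hu : ContDiffOn ℝ m u (Icc α β))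
    (h0 : ∀ s < m, iteratedDerivWithin s u (Icc α β) γ = 0)
    (hV : ∀ x ∈ Icc α β, |iteratedDerivWithin m u (Icc α β) x| ≤ V) :
    ∀ s ≤ m, ∀ x ∈ Icc α β, |iteratedDerivWithin s u (Icc α β) x| ≤ V * |x - γ| ^ (m - s) := by
  have hS := uniqueDiffOn_Icc hlt
  induction m generalizing u with
  | zero =>
    intro s hs x hx
    obtain rfl : s = 0 := by omega
    simpa using hV x hx
  | succ m ih =>
    rw [Nat.cast_succ, contDiffOn_succ_iff_derivWithin hS] at hu
    have h := ih hu.2.2 (fun s hs => by rw [← iteratedDerivWithin_succ']; exact h0 _ (by omega))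
      (fun x hx => by rw [← iteratedDerivWithin_succ']; exact hV x hx)
    have hV0 : 0 ≤ V := (abs_nonneg _).trans (hV γ hγ)
    intro s hs x hx
    rcases s with _ | s
    · have hsub : uIcc γ x ⊆ Icc α β := (convex_Icc α β).ordConnected.uIcc_subset hγ hx
      have hb : ∀ t ∈ uIcc γ x, ‖derivWithin u (Icc α β) t‖ ≤ V * |x - γ| ^ m := by
        intro t ht
        have h1 := h 0 (Nat.zero_le _) t (hsub ht)
        rw [iteratedDerivWithin_zero, Nat.sub_zero] at h1
        refine h1.trans ?_
        have : |t - γ| ≤ |x - γ| := abs_sub_left_of_mem_uIcc ht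
        gcongr
      have h2 := (convex_uIcc γ x).norm_image_sub_le_of_norm_hasDerivWithin_le
        (fun t ht => ((hu.1 t (hsub ht)).hasDerivWithinAt).mono hsub) hb
        left_mem_uIcc right_mem_uIcc
      have h3 := h0 0 (by omega)
      rw [iteratedDerivWithin_zero] at h3 ⊢
      rw [h3, sub_zero] at h2
      rw [Nat.sub_zero, pow_succ, ← mul_assoc]
      exact h2
    · have := h s (by omega) x hx
      rw [iteratedDerivWithin_succ', show m + 1 - (s + 1) = m - s by omega]
      exact this

/-- For the amplitude `y^k y'`, the operator `v ↦ -v' / f'` acts in the variable `y` as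
`-(2 l y)⁻¹ d/dy`, hence on powers of `y`. -/
theorem IsMorseCoordinate.phaseQuot_monomial (hm : IsMorseCoordinate α β γ l f y z) (hlt : α < β)
    (hl : l ≠ 0) (hy0 : ∀ x ∈ Icc α β \ {γ}, y x ≠ 0)
    (hf0 : ∀ x ∈ Icc α β \ {γ}, derivWithin f (Icc α β) x ≠ 0) (k i : ℕ) :
    ∀ x ∈ Icc α β \ {γ}, phaseQuot α β f (fun x => y x ^ k * z x) i x
      = ladder k i * y x ^ ((k : ℤ) - 1 - 2 * i) / (2 * l) ^ (i + 1) := by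
  have hS := uniqueDiffOn_diff_singleton (uniqueDiffOn_Icc hlt) γ
  have hz0 : ∀ x ∈ Icc α β \ {γ}, z x ≠ 0 := fun x hx h => by
    have := hf0 x hx
    rw [hm.deriv_phase_eq x hx.1, h, mul_zero] at this
    exact this rfl
  induction i with
  | zero =>
    intro x hx
    have h1 := hy0 x hx
    have h2 := hz0 x hx
    have e1 : y x ^ ((k : ℤ) - 1 - 2 * (0 : ℕ)) = y x ^ k / y x := by
      rw [Nat.cast_zero, mul_zero, sub_zero, zpow_sub₀ h1, zpow_natCast, zpow_one]
    simp only [phaseQuot]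
    rw [hm.deriv_phase_eq x hx.1, e1, ladder]
    field_simp
    ring
  | succ i ih =>
    intro x hx
    have h1 := hy0 x hx
    have h2 := hz0 x hx
    have h3 : HasDerivWithinAt (fun x => ladder k i * y x ^ ((k : ℤ) - 1 - 2 * i) / (2 * l) ^ (i + 1))
        (ladder k i * ((((k : ℤ) - 1 - 2 * i : ℤ) : ℝ) * y x ^ ((k : ℤ) - 1 - 2 * i - 1) * z x)
          / (2 * l) ^ (i + 1)) (Icc α β \ {γ}) x :=
      ((((hasDerivAt_zpow _ (y x) (Or.inl h1)).comp_hasDerivWithinAt x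
        (hm.hasDerivWithinAt x hx.1)).mono sdiff_subset).const_mul _).div_const _
    rw [phaseQuot_succ_eq hx, derivWithin_congr ih (ih x hx), h3.derivWithin (hS x hx),
      hm.deriv_phase_eq x hx.1, ladder]
    have e1 : y x ^ ((k : ℤ) - 1 - 2 * i - 1) = y x ^ ((k : ℤ) - 1 - 2 * (i + 1 : ℕ)) * y x := by
      rw [← zpow_add_one₀ h1]; congr 1; push_cast; ring
    rw [e1]
    push_cast
    field_simp
    ring

theorem IsMorseCoordinate.sum_boundaryTerm_monomial (hm : IsMorseCoordinate α β γ l f y z)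
    (hlt : α < β) (hl : l ≠ 0) (hy0 : ∀ x ∈ Icc α β \ {γ}, y x ≠ 0)
    (hf0 : ∀ x ∈ Icc α β \ {γ}, derivWithin f (Icc α β) x ≠ 0) (k m : ℕ) {x : ℝ}
    (hx : x ∈ Icc α β \ {γ}) :
    ∑ i ∈ Finset.range m, boundaryTerm α β f (fun x => y x ^ k * z x) i x
      = e (f γ) * monomialBoundary l k m (y x) := by
  have hlc : (l : ℂ) ≠ 0 := by exact_mod_cast hl
  unfold monomialBoundary boundaryTerm
  rw [← mul_assoc, ← e_add, ← hm.phase_eq x hx.1, Finset.mul_sum]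
  refine Finset.sum_congr rfl fun i _ => ?_
  rw [hm.phaseQuot_monomial hlt hl hy0 hf0 k i x hx]
  rw [show (4 * Real.pi * Complex.I * l : ℂ) = (2 * l) * (2 * Real.pi * Complex.I) by ring,
    mul_pow (2 * l : ℂ)]
  push_cast
  rw [div_div]

theorem IsMorseCoordinate.integral_monomial (hm : IsMorseCoordinate α β γ l f y z) (hlt : α < β)
    (hz : ContinuousOn z (Icc α β)) (k : ℕ) :
    ∫ x in α..β, ((y x ^ k * z x : ℝ) : ℂ) * e (f x)
      = e (f γ) * ∫ t in y α..y β, (t : ℂ) ^ k * e (l * t ^ 2) := by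
  have hyc : ContinuousOn y (Icc α β) := fun x hx => (hm.hasDerivWithinAt x hx).continuousWithinAt
  have h := intervalIntegral.integral_deriv_smul_comp'' (a := α) (b := β) (f := y) (f' := z)
    (g := fun t : ℝ => (t : ℂ) ^ k * e (l * t ^ 2)) (by rwa [uIcc_of_le hlt.le]) ?_
    (by rwa [uIcc_of_le hlt.le]) (continuous_pow_mul_e l k).continuousOn
  · rw [← h, ← intervalIntegral.integral_const_mul]
    refine intervalIntegral.integral_congr fun x hx => ?_
    rw [uIcc_of_le hlt.le] at hx
    simp only [Function.comp]
    rw [hm.phase_eq x hx, e_add, Complex.real_smul]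
    push_cast
    ring
  · intro x hx
    rw [min_eq_left hlt.le, max_eq_right hlt.le] at hx
    exact ((hm.hasDerivWithinAt x (Ioo_subset_Icc_self hx)).hasDerivAt
      (Icc_mem_nhds hx.1 hx.2)).hasDerivWithinAt

end Consequences

/-- `ϖ_k` has the size of `U / L^k` if `η_i` has the size of `U / L^i` and `λ_m / λ₂` that of
`1 / L^{m-2}`. -/
theorem exists_varpi_bound (n k : ℕ) (hk : k ≤ 2 * n) (coef : ℕ → ℕ → ℕ → ℝ) {D E : ℝ} (hD : 0 < D)
    (hE : 0 < E) : ∃ K > 0, ∀ (lam eta : ℕ → ℝ) (U L : ℝ), 0 < U → 0 < L → lam 2 ≠ 0 →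
      (∀ i ≤ 2 * n, |eta i| ≤ D * U / L ^ i) →
      (∀ m, 3 ≤ m → m ≤ 2 * n + 3 → |lam m| ≤ E * |lam 2| / L ^ (m - 2)) →
      |varpi coef n lam eta k| ≤ K * U / L ^ k := by
  refine ⟨D + ∑ l ∈ Finset.range k, D * ∑ j ∈ Finset.Icc 1 (k - l),
    |coef k l j| * ((tuples n j (k - l + 2 * j)).card * E ^ j), by positivity,
    fun lam eta U L hU hL h2 heta hlam => ?_⟩
  have h2' : 0 < |lam 2| := abs_pos.2 h2
  have htup : ∀ j s, ∀ m ∈ tuples n j (s + 2 * j), |∏ i, lam (m i)| ≤ |lam 2| ^ j * (E ^ j / L ^ s) := by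
    intro j s m hm
    rw [tuples, Finset.mem_filter, Fintype.mem_piFinset] at hm
    have hs : ∑ i, (m i - 2) = s := by
      have h3 : ∑ i, m i = ∑ i, (m i - 2) + 2 * j := by
        have : ∀ i, m i = (m i - 2) + 2 := fun i => by
          have := Finset.mem_Icc.1 (hm.1 i); omega
        conv_lhs => rw [Finset.sum_congr rfl fun i _ => this i]
        rw [Finset.sum_add_distrib]
        simp [mul_comm]
      omega
    rw [Finset.abs_prod]
    calc ∏ i, |lam (m i)| ≤ ∏ i, (E * |lam 2| / L ^ (m i - 2)) :=
          Finset.prod_le_prod (fun _ _ => abs_nonneg _) fun i _ =>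
            hlam _ (Finset.mem_Icc.1 (hm.1 i)).1 (Finset.mem_Icc.1 (hm.1 i)).2
      _ = _ := by
          rw [Finset.prod_div_distrib, Finset.prod_pow_eq_pow_sum, hs]
          simp [mul_pow]
          ring
  have hinner : ∀ l ∈ Finset.range k, ∀ j ∈ Finset.Icc 1 (k - l),
      |coef k l j / lam 2 ^ j * ∑ m ∈ tuples n j (k - l + 2 * j), ∏ i, lam (m i)|
      ≤ |coef k l j| * ((tuples n j (k - l + 2 * j)).card * E ^ j) / L ^ (k - l) := by
    intro l hl j hj
    rw [abs_mul, abs_div, abs_pow]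
    have h3 : |∑ m ∈ tuples n j (k - l + 2 * j), ∏ i, lam (m i)|
        ≤ (tuples n j (k - l + 2 * j)).card * (|lam 2| ^ j * (E ^ j / L ^ (k - l))) := by
      refine (Finset.abs_sum_le_sum_abs _ _).trans ?_
      rw [← nsmul_eq_mul]
      exact Finset.sum_le_card_nsmul _ _ _ fun m hm => htup j (k - l) m hm
    calc _ ≤ |coef k l j| / |lam 2| ^ j * ((tuples n j (k - l + 2 * j)).card *
          (|lam 2| ^ j * (E ^ j / L ^ (k - l)))) := by gcongr
      _ = _ := by field_simp
  rw [varpi, add_mul, add_div]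
  refine (abs_add_le _ _).trans (add_le_add (heta k hk) ?_)
  rw [Finset.sum_mul, Finset.sum_div]
  refine (Finset.abs_sum_le_sum_abs _ _).trans (Finset.sum_le_sum fun l hl => ?_)
  have hlk := Finset.mem_range.1 hl
  rw [abs_mul]
  have h4 : |∑ j ∈ Finset.Icc 1 (k - l), coef k l j / lam 2 ^ j *
      ∑ m ∈ tuples n j (k - l + 2 * j), ∏ i, lam (m i)|
      ≤ (∑ j ∈ Finset.Icc 1 (k - l), |coef k l j| * ((tuples n j (k - l + 2 * j)).card * E ^ j))
        / L ^ (k - l) := by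
    rw [Finset.sum_div]
    exact (Finset.abs_sum_le_sum_abs _ _).trans (Finset.sum_le_sum fun j hj => hinner l hl j hj)
  refine (mul_le_mul (heta l (by omega)) h4 (abs_nonneg _) (by positivity)).trans (le_of_eq ?_)
  have : L ^ k = L ^ l * L ^ (k - l) := by rw [← pow_add]; congr 1; omega
  rw [this]
  field_simp

/-! ### Combining the monomials and the remainder -/

theorem sum_Icc_one_eq_sum_range {F : Type*} [AddCommMonoid F] (n : ℕ) (a : ℕ → F) :
    ∑ j ∈ Finset.Icc 1 n, a j = ∑ j ∈ Finset.range n, a (j + 1) := by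
  rw [← Finset.sum_image (s := Finset.range n) (g := fun j => j + 1) (by simp)]
  congr 1
  ext j
  simp only [Finset.mem_Icc, Finset.mem_image, Finset.mem_range]
  constructor
  · rintro ⟨h1, h2⟩; exact ⟨j - 1, by omega, by omega⟩
  · rintro ⟨i, h1, rfl⟩; omega

theorem sum_range_eq_sum_even {F : Type*} [AddCommMonoid F] (n : ℕ) (a : ℕ → F)
    (h : ∀ j, a (2 * j + 1) = 0) :
    ∑ k ∈ Finset.range (2 * n + 1), a k = ∑ j ∈ Finset.range (n + 1), a (2 * j) := by
  induction n with
  | zero => simp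
  | succ n ih =>
    rw [show 2 * (n + 1) + 1 = 2 * n + 1 + 1 + 1 by ring, Finset.sum_range_succ,
      Finset.sum_range_succ, ih, h, add_zero, Finset.sum_range_succ _ (n + 1)]
    rfl

theorem mainTerm_eq_sum (c : ℕ → ℕ → ℕ → ℝ) (n : ℕ) (α β γ : ℝ) (f g : ℝ → ℝ) :
    mainTerm c n α β γ f g = ∑ k ∈ Finset.range (2 * n + 1),
      (varpi c n (taylorCoef α β γ f) (taylorCoef α β γ g) k : ℂ)
        * (e (f γ) * monomialMain (taylorCoef α β γ f 2) k) := by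
  rw [sum_range_eq_sum_even n _ fun j => by
    rw [monomialMain, if_neg (Nat.not_even_iff_odd.2 (odd_two_mul_add_one j))]; simp]
  rw [Finset.sum_range_succ', mainTerm, sum_Icc_one_eq_sum_range, e_add]
  have h2 : iteratedDerivWithin 2 f (Icc α β) γ = 2 * taylorCoef α β γ f 2 := by
    simp [taylorCoef]; ring
  have h0 : varpi c n (taylorCoef α β γ f) (taylorCoef α β γ g) 0 = g γ := by
    simp [varpi, taylorCoef]
  have heven : ∀ j, monomialMain (taylorCoef α β γ f 2) (2 * j)
      = e (1 / 8) / (√(2 * taylorCoef α β γ f 2) : ℝ) * ((-1) ^ j *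
        ((2 * j - 1).doubleFactorial : ℂ) / (4 * Real.pi * Complex.I * taylorCoef α β γ f 2) ^ j) := by
    intro j
    rw [monomialMain, if_pos (even_two_mul j), Nat.mul_div_cancel_left _ two_pos]
  simp_rw [heven]
  rw [h2, mul_zero, h0, mul_add, add_comm, Finset.mul_sum]
  congr 1
  · refine Finset.sum_congr rfl fun j _ => ?_
    ring
  · simp
    ring

/-- The hypotheses on phase and amplitude in normalised form: `A` is the lower bound for `f''`, and `c`
and `D` bound the ratios to the natural sizes. -/
structure IsStationaryPhase (n : ℕ) (c D α β γ A M N U : ℝ) (f g : ℝ → ℝ) : Prop where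
  left_lt : α < γ
  lt_right : γ < β
  A_pos : 0 < A
  M_pos : 0 < M
  N_pos : 0 < N
  U_pos : 0 < U
  length_le : β - α ≤ M
  differentiableOn : DifferentiableOn ℝ f (Icc α β)
  differentiableOn_deriv : DifferentiableOn ℝ (derivWithin f (Icc α β)) (Icc α β)
  deriv_center : derivWithin f (Icc α β) γ = 0
  phase_symbol : SymbolOn (Icc α β) (2 * n + 1) (fun _ => c * A) (fun _ => M)
    (derivWithin (derivWithin f (Icc α β)) (Icc α β))
  le_second_deriv : ∀ x ∈ Icc α β, A ≤ derivWithin (derivWithin f (Icc α β)) (Icc α β) x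
  amplitude_symbol : SymbolOn (Icc α β) (2 * n + 1) (fun _ => D * U) (fun _ => N) g

namespace IsStationaryPhase

variable {n : ℕ} {c D α β γ A M N U : ℝ} {f g : ℝ → ℝ}

theorem lt (h : IsStationaryPhase n c D α β γ A M N U f g) : α < β := h.left_lt.trans h.lt_right

theorem mem (h : IsStationaryPhase n c D α β γ A M N U f g) : γ ∈ Icc α β :=
  ⟨h.left_lt.le, h.lt_right.le⟩

theorem abs_sub_le (h : IsStationaryPhase n c D α β γ A M N U f g) {x : ℝ} (hx : x ∈ Icc α β) :
    |x - γ| ≤ M := by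
  have := h.length_le
  have := h.mem
  rw [abs_le]
  constructor <;> linarith [hx.1, hx.2, this.1, this.2]

theorem deriv_symbol (h : IsStationaryPhase n c D α β γ A M N U f g) :
    SymbolOn (Icc α β \ {γ}) (2 * n + 1) (fun x => c * (A * |x - γ|)) (fun x => |x - γ|)
      (derivWithin f (Icc α β)) := by
  have hS := uniqueDiffOn_diff_singleton (uniqueDiffOn_Icc h.lt) γ
  have hω : ∀ x ∈ Icc α β \ {γ}, 0 < |x - γ| := fun x hx => abs_pos.2 (sub_ne_zero.2 hx.2)
  have hFc := h.phase_symbol.1.continuousOn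
  refine SymbolOn.of_le (r := 2 * n + 1 + 1) ?_ (by omega)
  rw [SymbolOn.succ_iff hS]
  refine ⟨h.differentiableOn_deriv.mono sdiff_subset, fun x hx => ?_, ?_⟩
  · rw [sub_mul_segmentMean_eq_derivWithin h.mem h.differentiableOn_deriv hFc h.deriv_center hx.1,
      abs_mul]
    have := (h.phase_symbol.segmentMean h.lt h.mem 0).abs_le hx.1
    calc _ ≤ |x - γ| * (c * A) := by gcongr
      _ = _ := by ring
  · refine (h.phase_symbol.diff_singleton.congr fun x hx =>
      derivWithin_diff_singleton hx.2 _).mono hω (fun _ hx => h.abs_sub_le hx.1) fun x hx => ?_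
    have := hω x hx
    apply le_of_eq
    field_simp

theorem le_abs_deriv (h : IsStationaryPhase n c D α β γ A M N U f g) {x : ℝ} (hx : x ∈ Icc α β) :
    A * |x - γ| ≤ |derivWithin f (Icc α β) x| := by
  have hFc := h.phase_symbol.1.continuousOn
  rw [sub_mul_segmentMean_eq_derivWithin h.mem h.differentiableOn_deriv hFc h.deriv_center hx,
    abs_mul, mul_comm]
  have := le_segmentMean (j := 0) (b := A) h.mem hFc hx h.le_second_deriv (by simp)
  have := this.trans (le_abs_self _)
  gcongr

theorem deriv_ne_zero (h : IsStationaryPhase n c D α β γ A M N U f g) :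
    ∀ x ∈ Icc α β \ {γ}, derivWithin f (Icc α β) x ≠ 0 := fun _ hx =>
  abs_pos.1 ((mul_pos h.A_pos (abs_pos.2 (sub_ne_zero.2 hx.2))).trans_le (h.le_abs_deriv hx.1))

theorem boundary_eq_sum (h : IsStationaryPhase n c D α β γ A M N U f g) {x : ℝ}
    (hx : x ∈ Icc α β \ {γ}) :
    boundary n α β f g x = ∑ i ∈ Finset.range (n + 1), boundaryTerm α β f g i x := by
  rw [boundary, sum_Icc_one_eq_sum_range, Finset.mul_sum]
  refine Finset.sum_congr rfl fun i hi => ?_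
  rw [H_succ_eq h.lt h.deriv_symbol.1 h.deriv_ne_zero
    (h.amplitude_symbol.1.mono sdiff_subset) i (by have := Finset.mem_range.1 hi; omega) x hx,
    boundaryTerm]

theorem deriv_deriv_div_two :
    derivWithin (derivWithin f (Icc α β)) (Icc α β) γ / 2 = taylorCoef α β γ f 2 := by
  simp [taylorCoef, iteratedDerivWithin_succ', iteratedDerivWithin_zero]

theorem le_taylorCoef_two (h : IsStationaryPhase n c D α β γ A M N U f g) :
    A / 2 ≤ taylorCoef α β γ f 2 := by
  rw [← deriv_deriv_div_two]
  linarith [h.le_second_deriv γ h.mem]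

theorem exists_varpi_le (n : ℕ) {c D : ℝ} (hc : 0 < c) (hD : 0 < D) : ∃ K > 0,
    ∀ (α β γ A M N U : ℝ) (f g : ℝ → ℝ), IsStationaryPhase n c D α β γ A M N U f g →
      ∀ k ≤ 2 * n, |varpi saddleCoef n (taylorCoef α β γ f) (taylorCoef α β γ g) k|
        ≤ K * U / (min N M) ^ k := by
  have : ∀ k, ∃ K > 0, k ≤ 2 * n → ∀ (lam eta : ℕ → ℝ) (U L : ℝ), 0 < U → 0 < L → lam 2 ≠ 0 →
      (∀ i ≤ 2 * n, |eta i| ≤ D * U / L ^ i) →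
      (∀ m, 3 ≤ m → m ≤ 2 * n + 3 → |lam m| ≤ (2 * c) * |lam 2| / L ^ (m - 2)) →
      |varpi saddleCoef n lam eta k| ≤ K * U / L ^ k := by
    intro k
    by_cases hk : k ≤ 2 * n
    · obtain ⟨K, hK, h⟩ := exists_varpi_bound n k hk saddleCoef hD (by positivity : 0 < 2 * c)
      exact ⟨K, hK, fun _ => h⟩
    · exact ⟨1, one_pos, fun h => absurd h hk⟩
  choose K hK hb using this
  have hsum : ∀ k ≤ 2 * n, K k ≤ ∑ k ∈ Finset.range (2 * n + 1), K k := fun k hk =>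
    Finset.single_le_sum (f := K) (fun i _ => (hK i).le) (Finset.mem_range.2 (by omega))
  refine ⟨∑ k ∈ Finset.range (2 * n + 1), K k, (hK 0).trans_le (hsum 0 (by omega)),
    fun α β γ A M N U f g h k hk => ?_⟩
  have hN := h.N_pos
  have hM := h.M_pos
  have hU := h.U_pos
  have hA := h.A_pos
  have hL : 0 < min N M := lt_min hN hM
  have hl := h.le_taylorCoef_two
  have hlpos : 0 < taylorCoef α β γ f 2 := lt_of_lt_of_le (by positivity) hl
  have hfac : ∀ (m : ℕ) (a : ℝ), |a / (m.factorial : ℝ)| ≤ |a| := fun m a => by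
    rw [abs_div, Nat.abs_cast]
    exact div_le_self (abs_nonneg _) (by exact_mod_cast Nat.succ_le_of_lt m.factorial_pos)
  refine (hb k hk _ _ U _ hU hL hlpos.ne' (fun i hi => ?_) fun m hm1 hm2 => ?_).trans ?_
  · refine ((hfac _ _).trans (h.amplitude_symbol.2 i (by omega) γ h.mem)).trans ?_
    gcongr
    exact min_le_left _ _
  · refine (hfac _ _).trans ?_
    obtain ⟨s, rfl⟩ : ∃ s, m = s + 2 := ⟨m - 2, by omega⟩
    rw [iteratedDerivWithin_succ', iteratedDerivWithin_succ', abs_of_pos hlpos]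
    refine (h.phase_symbol.2 s (by omega) γ h.mem).trans ?_
    rw [Nat.add_sub_cancel]
    have : c * A ≤ 2 * c * taylorCoef α β γ f 2 := by nlinarith
    gcongr
    exact min_le_right _ _
  · gcongr
    exact hsum k hk

/-- The part of the amplitude `g` left after subtracting its expansion in the monomials `y^k z`, where `y`
is a Morse coordinate and `z` its derivative. -/
noncomputable def remainder (n : ℕ) (α β γ : ℝ) (f g y z : ℝ → ℝ) (x : ℝ) : ℝ :=
  g x - ∑ k ∈ Finset.range (2 * n + 1),
    varpi saddleCoef n (taylorCoef α β γ f) (taylorCoef α β γ g) k * (y x ^ k * z x)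

/-- The expansion with an error in terms of `A` and the common scale `min N M` of phase and amplitude.
The first error term stems from the remainder, the sum from the monomials. -/
theorem exists_expansion_bound (n : ℕ) (hn : 1 ≤ n) {c D : ℝ} (hc : 0 < c) (hD : 0 < D) : ∃ K > 0,
    ∀ (α β γ A M N U : ℝ) (f g : ℝ → ℝ), IsStationaryPhase n c D α β γ A M N U f g →
      ‖(∫ x in α..β, (g x : ℂ) * e (f x)) - (mainTerm saddleCoef n α β γ f g
          + (boundary n α β f g β - boundary n α β f g α))‖
        ≤ K * (U / (min N M) ^ (2 * n + 1) / A ^ (n + 1)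
          + ∑ k ∈ Finset.range (2 * n + 1), U / (min N M) ^ k *
            (1 / (γ - α) ^ (2 * n + 3 - k) + 1 / (β - γ) ^ (2 * n + 3 - k)) / A ^ (n + 2)) := by
  obtain ⟨Ky, hKy, hmorse⟩ := exists_isMorseCoordinate (2 * n + 1) (by omega) hc
  obtain ⟨Kr, hKr, hrem⟩ := exists_remainder_bound n c hn
  obtain ⟨Kϖ, hKϖ, hϖ⟩ := exists_varpi_le n hc hD
  have hmon : ∀ k, ∃ K > 0, k ≤ 2 * n → ∀ l A B : ℝ, 0 < l → 0 < A → 0 < B →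
      ‖(∫ t in (-A)..B, (t : ℂ) ^ k * e (l * t ^ 2)) - monomialMain l k
        - (monomialBoundary l k (n + 1) B - monomialBoundary l k (n + 1) (-A))‖
        ≤ K * (A ^ ((k : ℤ) - 2 * n - 3) + B ^ ((k : ℤ) - 2 * n - 3)) / l ^ (n + 2) := by
    intro k
    by_cases hk : k ≤ 2 * n
    · obtain ⟨K, hK, h⟩ := exists_monomial_expansion n k hk
      exact ⟨K, hK, fun _ => h⟩
    · exact ⟨1, one_pos, fun h => absurd h hk⟩
  choose Km hKm hmon using hmon
  set r := 2 * n + 1 with hr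
  set Kv := D + ∑ k ∈ Finset.range (2 * n + 1), Kϖ * (2 ^ r * ((2 ^ r * Ky) ^ k * Ky)) with hKv
  have hKvpos : 0 < Kv := by positivity
  set Kq := ∑ k ∈ Finset.range (2 * n + 1), Km k * Ky ^ (2 * n + 3 - k) * 2 ^ (n + 2) with hKq
  have hKqpos : 0 ≤ Kq := Finset.sum_nonneg fun k _ => by have := hKm k; positivity
  refine ⟨Kr * Kv + Kϖ * Kq, by positivity, fun α β γ A M N U f g h => ?_⟩
  obtain ⟨y, z, hm, hz, hyle, hley, hypos, hyneg⟩ := hmorse α β γ A M f h.lt h.mem h.A_pos h.M_pos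
    h.differentiableOn h.differentiableOn_deriv h.deriv_center h.phase_symbol h.le_second_deriv
  rw [deriv_deriv_div_two] at hm
  have hN := h.N_pos
  have hM := h.M_pos
  have hU := h.U_pos
  have hA := h.A_pos
  have hS := uniqueDiffOn_Icc h.lt
  set L := min N M with hLdef
  have hL : 0 < L := lt_min hN hM
  set l := taylorCoef α β γ f 2 with hl
  have hlA : A / 2 ≤ l := h.le_taylorCoef_two
  have hlpos : 0 < l := lt_of_lt_of_le (by positivity) hlA
  set ϖ := varpi saddleCoef n (taylorCoef α β γ f) (taylorCoef α β γ g) with hϖdef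
  have hϖb : ∀ k ≤ 2 * n, |ϖ k| ≤ Kϖ * U / L ^ k := hϖ α β γ A M N U f g h
  have hωM : ∀ x ∈ Icc α β, 0 < (fun _ : ℝ => M) x := fun _ _ => hM
  have hyder : EqOn (derivWithin y (Icc α β)) z (Icc α β) := fun x hx =>
    (hm.hasDerivWithinAt x hx).derivWithin (hS x hx)
  have hysymb : SymbolOn (Icc α β) (r + 1) (fun _ => Ky * M) (fun _ => M) y := by
    rw [SymbolOn.succ_iff hS]
    refine ⟨fun x hx => (hm.hasDerivWithinAt x hx).differentiableWithinAt, fun x hx => ?_, ?_⟩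
    · refine (hyle x hx).trans ?_
      have := h.abs_sub_le hx
      gcongr
    · exact (hz.congr hyder).mono_left hωM fun x _ => le_of_eq (by field_simp)
  have hPsymb : ∀ k, SymbolOn (Icc α β) r (fun _ => 2 ^ r * ((2 ^ r * (Ky * M)) ^ k * Ky))
      (fun _ => M) (fun x => y x ^ k * z x) := fun k =>
    ((hysymb.of_le (by omega : r ≤ r + 1)).pow hS hωM k).mul hS hωM hz
  have hy0 : ∀ x ∈ Icc α β \ {γ}, y x ≠ 0 := by
    intro x hx
    rcases lt_or_gt_of_ne (show x ≠ γ from hx.2) with h1 | h1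
    · exact (hyneg x hx.1 h1).ne
    · exact (hypos x hx.1 h1).ne'
  set R := remainder n α β γ f g y z with hR
  have hPsum : ContDiffOn ℝ r (fun x => ∑ k ∈ Finset.range (2 * n + 1), ϖ k * (y x ^ k * z x))
      (Icc α β) := ContDiffOn.sum fun k _ => contDiffOn_const.mul (hPsymb k).1
  have hRc : ContDiffOn ℝ r R (Icc α β) := h.amplitude_symbol.1.sub hPsum
  have hR0 : ∀ s < r, iteratedDerivWithin s R (Icc α β) γ = 0 := fun s hs =>
    hm.iteratedDerivWithin_sub_sum_eq_zero h.lt h.mem n hlpos.ne' rfl hysymb.1 hz.1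
      h.amplitude_symbol.1 (by omega)
  set V := Kv * (U / L ^ r) with hV
  have hV0 : 0 ≤ V := by positivity
  have hRtop : ∀ x ∈ Icc α β, |iteratedDerivWithin r R (Icc α β) x| ≤ V := by
    intro x hx
    have h1 := iteratedDerivWithin_sub hx hS (h.amplitude_symbol.1 x hx) (hPsum x hx)
    have h2 : iteratedDerivWithin r (fun x => ∑ k ∈ Finset.range (2 * n + 1), ϖ k * (y x ^ k * z x))
        (Icc α β) x = ∑ k ∈ Finset.range (2 * n + 1),
          ϖ k * iteratedDerivWithin r (fun x => y x ^ k * z x) (Icc α β) x := by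
      rw [iteratedDerivWithin_fun_sum hx hS fun k _ =>
        contDiffWithinAt_const.mul ((hPsymb k).1 x hx)]
      exact Finset.sum_congr rfl fun k _ =>
        iteratedDerivWithin_const_mul hx hS _ ((hPsymb k).1 x hx)
    change |iteratedDerivWithin r (g - fun x => ∑ k ∈ Finset.range (2 * n + 1),
      ϖ k * (y x ^ k * z x)) (Icc α β) x| ≤ _
    rw [h1, h2, hV, hKv, add_mul, Finset.sum_mul]
    refine (abs_sub _ _).trans (add_le_add ?_ ((Finset.abs_sum_le_sum_abs _ _).trans
      (Finset.sum_le_sum fun k hk => ?_)))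
    · refine (h.amplitude_symbol.2 r le_rfl x hx).trans ?_
      rw [mul_div_assoc]
      gcongr
      exact min_le_left _ _
    · have hk' : k ≤ 2 * n := by have := Finset.mem_range.1 hk; omega
      rw [abs_mul]
      have h3 := (hPsymb k).2 r le_rfl x hx
      have hLM : L ≤ M := min_le_right _ _
      calc _ ≤ Kϖ * U / L ^ k * (2 ^ r * ((2 ^ r * (Ky * M)) ^ k * Ky) / M ^ r) :=
            mul_le_mul (hϖb k hk') h3 (abs_nonneg _) (by positivity)
        _ = Kϖ * (2 ^ r * ((2 ^ r * Ky) ^ k * Ky)) * (U / (L ^ k * M ^ (r - k))) := by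
            have : M ^ r = M ^ k * M ^ (r - k) := by rw [← pow_add]; congr 1; omega
            rw [this, show 2 ^ r * (Ky * M) = (2 ^ r * Ky) * M by ring, mul_pow _ M]
            field_simp
        -- the derivatives of the monomials live on the scale `M ≥ L`
        _ ≤ Kϖ * (2 ^ r * ((2 ^ r * Ky) ^ k * Ky)) * (U / (L ^ k * L ^ (r - k))) := by
            gcongr
        _ = _ := by
            rw [← pow_add, show k + (r - k) = r by omega]
  have hRall := abs_iteratedDerivWithin_le_of_vanishing h.lt h.mem r hRc hR0 hRtop
  have hRsymb : SymbolOn (Icc α β \ {γ}) r (fun x => V * |x - γ| ^ r) (fun x => |x - γ|) R := by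
    refine ⟨hRc.mono sdiff_subset, fun k hk x hx => ?_⟩
    rw [iteratedDerivWithin_diff_singleton hx]
    refine (hRall k hk x hx.1).trans (le_of_eq ?_)
    have : 0 < |x - γ| := abs_pos.2 (sub_ne_zero.2 hx.2)
    rw [pow_sub₀ _ this.ne' hk]
    field_simp
  have hRrem := hrem α β γ A V f R h.left_lt h.lt_right hA hV0 h.differentiableOn h.deriv_symbol
    (fun x hx => h.le_abs_deriv hx.1) hRsymb hRc.continuousOn
    (fun x hx => by simpa using hRall 0 (Nat.zero_le _) x hx)
  have hαS : α ∈ Icc α β \ {γ} := ⟨⟨le_rfl, h.lt.le⟩, h.left_lt.ne⟩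
  have hβS : β ∈ Icc α β \ {γ} := ⟨⟨h.lt.le, le_rfl⟩, h.lt_right.ne'⟩
  set P : ℕ → ℝ → ℝ := fun k x => y x ^ k * z x with hP
  -- boundary terms and integral are linear in the amplitude, and explicit for monomials
  have hgdec : ∀ x, g x = R x + ∑ k ∈ Finset.range (2 * n + 1), ϖ k * P k x := fun x => by
    rw [hR, remainder]; ring
  have hbdec : ∀ x ∈ Icc α β \ {γ}, boundary n α β f g x
      = ∑ i ∈ Finset.range (n + 1), boundaryTerm α β f R i x
        + ∑ k ∈ Finset.range (2 * n + 1), ϖ k * (e (f γ) * monomialBoundary l k (n + 1) (y x)) := by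
    intro x hx
    rw [h.boundary_eq_sum hx]
    have h1 : ∀ i ∈ Finset.range (n + 1), boundaryTerm α β f g i x = boundaryTerm α β f R i x
        + ∑ k ∈ Finset.range (2 * n + 1), (ϖ k : ℂ) * boundaryTerm α β f (P k) i x := by
      intro i hi
      have hi' : i ≤ r := by have := Finset.mem_range.1 hi; omega
      have h2 : phaseQuot α β f g i x = phaseQuot α β f R i x
          + ∑ k ∈ Finset.range (2 * n + 1), ϖ k * phaseQuot α β f (P k) i x := by
        rw [← phaseQuot_sum h.lt h.deriv_symbol.1 h.deriv_ne_zero _ _ _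
          (fun k _ => (hPsymb k).1.mono sdiff_subset) i hi' x hx,
          ← phaseQuot_add h.lt h.deriv_symbol.1 h.deriv_ne_zero hRsymb.1
          (hPsum.mono sdiff_subset) i hi' x hx]
        congr 1
        funext x
        exact hgdec x
      simp only [boundaryTerm]
      rw [h2]
      push_cast
      rw [add_div, mul_add, Finset.sum_div, Finset.mul_sum]
      congr 1
      exact Finset.sum_congr rfl fun k _ => by ring
    rw [Finset.sum_congr rfl h1, Finset.sum_add_distrib, Finset.sum_comm]
    congr 1
    refine Finset.sum_congr rfl fun k _ => ?_
    rw [← Finset.mul_sum, hm.sum_boundaryTerm_monomial h.lt hlpos.ne' hy0 h.deriv_ne_zero k _ hx]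
  have hec : ContinuousOn (fun x => e (f x)) (Icc α β) :=
    continuous_e.comp_continuousOn h.differentiableOn.continuousOn
  have hint : ∀ u : ℝ → ℝ, ContinuousOn u (Icc α β) →
      IntervalIntegrable (fun x => (u x : ℂ) * e (f x)) volume α β := fun u hu =>
    ((Complex.continuous_ofReal.comp_continuousOn hu).mul hec).intervalIntegrable_of_Icc h.lt.le
  have hidec : ∫ x in α..β, (g x : ℂ) * e (f x) = (∫ x in α..β, (R x : ℂ) * e (f x))
      + ∑ k ∈ Finset.range (2 * n + 1), (ϖ k : ℂ) * (e (f γ) *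
        ∫ t in y α..y β, (t : ℂ) ^ k * e (l * t ^ 2)) := by
    have h1 : ∀ x, (g x : ℂ) * e (f x) = (R x : ℂ) * e (f x)
        + ∑ k ∈ Finset.range (2 * n + 1), (ϖ k : ℂ) * ((P k x : ℂ) * e (f x)) := by
      intro x
      rw [hgdec x]
      push_cast
      rw [add_mul, Finset.sum_mul]
      congr 1
      exact Finset.sum_congr rfl fun k _ => by ring
    simp_rw [h1]
    have h3 : ∀ k, IntervalIntegrable (fun x => (ϖ k : ℂ) * ((P k x : ℂ) * e (f x))) volume α β :=
      fun k => (hint _ (hPsymb k).1.continuousOn).const_mul _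
    have h4 : IntervalIntegrable (fun x => ∑ k ∈ Finset.range (2 * n + 1),
        (ϖ k : ℂ) * ((P k x : ℂ) * e (f x))) volume α β :=
      (continuousOn_finsetSum _ fun k _ => continuousOn_const.mul
        ((Complex.continuous_ofReal.comp_continuousOn (hPsymb k).1.continuousOn).mul
          hec)).intervalIntegrable_of_Icc h.lt.le
    rw [intervalIntegral.integral_add (hint R hRc.continuousOn) h4, intervalIntegral.integral_finsetSum fun k _ => h3 k]
    congr 1
    refine Finset.sum_congr rfl fun k _ => ?_
    rw [intervalIntegral.integral_const_mul, hm.integral_monomial h.lt hz.1.continuousOn]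
  -- `y` is comparable to `x - γ`, which bounds the negative powers of its end values
  set a := -y α with ha
  have hapos : 0 < a := by have := hyneg α hαS.1 h.left_lt; linarith
  have hbpos : 0 < y β := hypos β hβS.1 h.lt_right
  have hylow : ∀ k ≤ 2 * n, ∀ t d : ℝ, 0 < t → 0 < d → d ≤ Ky * t →
      t ^ ((k : ℤ) - 2 * n - 3) ≤ Ky ^ (2 * n + 3 - k) * (1 / d ^ (2 * n + 3 - k)) := by
    intro k hk t d ht hd hdt
    have e1 : (k : ℤ) - 2 * n - 3 = -((2 * n + 3 - k : ℕ) : ℤ) := by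
      rw [Nat.cast_sub (by omega)]; push_cast; ring
    rw [e1, zpow_neg, zpow_natCast, ← one_div, mul_one_div, div_le_div_iff₀ (by positivity)
      (by positivity), one_mul, ← mul_pow]
    gcongr
  have hdα : γ - α ≤ Ky * a := by
    have := hley α hαS.1
    rwa [abs_of_neg (by linarith [h.left_lt]), abs_of_neg (by linarith), neg_sub] at this
  have hdβ : β - γ ≤ Ky * y β := by
    have := hley β hβS.1
    rwa [abs_of_pos (by linarith [h.lt_right]), abs_of_pos hbpos] at this
  have hpiece : ∀ k ∈ Finset.range (2 * n + 1),
      ‖(ϖ k : ℂ) * (e (f γ) * ((∫ t in y α..y β, (t : ℂ) ^ k * e (l * t ^ 2)) - monomialMain l k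
        - (monomialBoundary l k (n + 1) (y β) - monomialBoundary l k (n + 1) (y α))))‖
      ≤ Kϖ * Kq * (U / L ^ k * (1 / (γ - α) ^ (2 * n + 3 - k) + 1 / (β - γ) ^ (2 * n + 3 - k))
        / A ^ (n + 2)) := by
    intro k hk
    have hk' : k ≤ 2 * n := by have := Finset.mem_range.1 hk; omega
    have h1 := hmon k hk' l a (y β) hlpos hapos hbpos
    rw [ha, neg_neg, ← ha] at h1
    have hdαp : 0 < γ - α := by linarith [h.left_lt]
    have hdβp : 0 < β - γ := by linarith [h.lt_right]
    rw [norm_mul, norm_mul, norm_e, one_mul, Complex.norm_real, Real.norm_eq_abs]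
    have hlow : A ^ (n + 2) / 2 ^ (n + 2) ≤ l ^ (n + 2) := by
      rw [← div_pow]; gcongr
    have hkq : Km k * Ky ^ (2 * n + 3 - k) * 2 ^ (n + 2) ≤ Kq :=
      Finset.single_le_sum (f := fun k => Km k * Ky ^ (2 * n + 3 - k) * 2 ^ (n + 2))
        (fun k _ => by have := hKm k; positivity) hk
    have hKmk := hKm k
    calc _ ≤ Kϖ * U / L ^ k * (Km k * (Ky ^ (2 * n + 3 - k) * (1 / (γ - α) ^ (2 * n + 3 - k))
          + Ky ^ (2 * n + 3 - k) * (1 / (β - γ) ^ (2 * n + 3 - k)))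
          / (A ^ (n + 2) / 2 ^ (n + 2))) := by
          refine mul_le_mul (hϖb k hk') (h1.trans ?_) (norm_nonneg _) (by positivity)
          have h2 := hylow k hk' a (γ - α) hapos hdαp hdα
          have h3 := hylow k hk' (y β) (β - γ) hbpos hdβp hdβ
          gcongr
      _ = Kϖ * (Km k * Ky ^ (2 * n + 3 - k) * 2 ^ (n + 2)) * (U / L ^ k *
          (1 / (γ - α) ^ (2 * n + 3 - k) + 1 / (β - γ) ^ (2 * n + 3 - k)) / A ^ (n + 2)) := by
          field_simp
      _ ≤ _ := by gcongr
  have hfinal : (∫ x in α..β, (g x : ℂ) * e (f x)) - (mainTerm saddleCoef n α β γ f g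
        + (boundary n α β f g β - boundary n α β f g α))
      = ((∫ x in α..β, (R x : ℂ) * e (f x))
        - (∑ i ∈ Finset.range (n + 1), boundaryTerm α β f R i β
          - ∑ i ∈ Finset.range (n + 1), boundaryTerm α β f R i α))
        + ∑ k ∈ Finset.range (2 * n + 1), (ϖ k : ℂ) * (e (f γ) *
          ((∫ t in y α..y β, (t : ℂ) ^ k * e (l * t ^ 2)) - monomialMain l k
          - (monomialBoundary l k (n + 1) (y β) - monomialBoundary l k (n + 1) (y α)))) := by
    rw [hidec, hbdec α hαS, hbdec β hβS, mainTerm_eq_sum]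
    simp only [mul_sub, Finset.sum_sub_distrib]
    ring
  rw [hfinal]
  refine (norm_add_le _ _).trans ((add_le_add hRrem (norm_sum_le_of_le _ hpiece)).trans ?_)
  rw [← Finset.mul_sum, mul_add]
  have hX : 0 ≤ U / L ^ r / A ^ (n + 1) := by positivity
  have hY : 0 ≤ ∑ k ∈ Finset.range (2 * n + 1), U / L ^ k *
      (1 / (γ - α) ^ (2 * n + 3 - k) + 1 / (β - γ) ^ (2 * n + 3 - k)) / A ^ (n + 2) := by
    have hdαp : 0 < γ - α := by linarith [h.left_lt]
    have hdβp : 0 < β - γ := by linarith [h.lt_right]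
    exact Finset.sum_nonneg fun k _ => by positivity
  refine add_le_add ?_ ?_
  · calc _ = Kr * Kv * (U / L ^ r / A ^ (n + 1)) := by rw [hV]; ring
      _ ≤ _ := by
        gcongr
        have : 0 ≤ Kϖ * Kq := by positivity
        linarith
  · gcongr
    have : 0 ≤ Kr * Kv := by positivity
    linarith

end IsStationaryPhase

/-! ### The error in terms of the original parameters -/

theorem one_div_min_pow_le {N M : ℝ} (hN : 0 < N) (hM : 0 < M) (p : ℕ) :
    1 / (min N M) ^ p ≤ 1 / N ^ p + 1 / M ^ p := by
  have h1 : 0 < 1 / N ^ p := by positivity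
  have h2 : 0 < 1 / M ^ p := by positivity
  rcases min_choice N M with h | h <;> rw [h] <;> linarith

theorem pow_le_one_add_pow {t : ℝ} (ht : 0 ≤ t) {k m : ℕ} (hk : k ≤ m) : t ^ k ≤ 1 + t ^ m := by
  rcases le_total t 1 with h | h
  · linarith [pow_le_one₀ (n := k) ht h, pow_nonneg ht m]
  · linarith [pow_le_pow_right₀ h hk]

/-- Interpolation: the error terms for `0 < k < 2n` are dominated by those for `k = 0` and `k = 2n`. -/
theorem one_div_min_pow_mul_le {N M d : ℝ} (hN : 0 < N) (hd : 0 < d) (hdM : d ≤ M) {n k : ℕ}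
    (hk : k ≤ 2 * n) : 1 / (min N M) ^ k * (1 / d ^ (2 * n + 3 - k))
      ≤ 2 * (1 / d ^ (2 * n + 3)) + 1 / N ^ (2 * n) * (1 / d ^ 3) := by
  have hM := hd.trans_le hdM
  have h1 : d ^ (2 * n + 3) = d ^ k * d ^ (2 * n + 3 - k) := by
    rw [← pow_add]; congr 1; omega
  have h2 : (d / M) ^ k ≤ 1 := pow_le_one₀ (by positivity) ((div_le_one hM).2 hdM)
  have h3 : (d / N) ^ k ≤ 1 + (d / N) ^ (2 * n) := pow_le_one_add_pow (by positivity) hk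
  calc 1 / (min N M) ^ k * (1 / d ^ (2 * n + 3 - k))
      ≤ (1 / N ^ k + 1 / M ^ k) * (1 / d ^ (2 * n + 3 - k)) := by
        gcongr
        exact one_div_min_pow_le hN hM k
    _ = ((d / N) ^ k + (d / M) ^ k) * (1 / d ^ (2 * n + 3)) := by
        rw [h1, div_pow, div_pow]; field_simp
    _ ≤ (1 + (d / N) ^ (2 * n) + 1) * (1 / d ^ (2 * n + 3)) := by gcongr
    _ = _ := by rw [div_pow, pow_add d]; field_simp; ring

/-- The error of the normalised expansion, with `A = T / (C₂ M²)`, in terms of the parameters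
`M, N, T, U`. -/
theorem normalized_error_le (n : ℕ) {C₂ M N T U a b : ℝ} (hC : 0 < C₂) (hM : 0 < M)
    (hN : 0 < N) (hT : 0 < T) (hU : 0 < U) (ha : 0 < a) (haM : a ≤ M) (hb : 0 < b) (hbM : b ≤ M) :
    U / (min N M) ^ (2 * n + 1) / (T / (C₂ * M ^ 2)) ^ (n + 1)
      + ∑ k ∈ Finset.range (2 * n + 1), U / (min N M) ^ k *
        (1 / a ^ (2 * n + 3 - k) + 1 / b ^ (2 * n + 3 - k)) / (T / (C₂ * M ^ 2)) ^ (n + 2)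
    ≤ (C₂ ^ (n + 1) + (2 * n + 1) * 2 * C₂ ^ (n + 2)) *
      (U * M ^ (2 * n + 4) / T ^ (n + 2) * (1 / a ^ (2 * n + 3) + 1 / b ^ (2 * n + 3))
        + U * M ^ (2 * n + 4) / (T ^ (n + 2) * N ^ (2 * n)) * (1 / a ^ 3 + 1 / b ^ 3)
        + U / T ^ (n + 1) * (M ^ (2 * n + 2) / N ^ (2 * n + 1) + M)) := by
  have hL : 0 < min N M := lt_min hN hM
  set X := U * M ^ (2 * n + 4) / T ^ (n + 2) * (1 / a ^ (2 * n + 3) + 1 / b ^ (2 * n + 3)) with hX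
  set Y := U * M ^ (2 * n + 4) / (T ^ (n + 2) * N ^ (2 * n)) * (1 / a ^ 3 + 1 / b ^ 3) with hY
  set Z := U / T ^ (n + 1) * (M ^ (2 * n + 2) / N ^ (2 * n + 1) + M) with hZ
  have hX0 : 0 < X := by positivity
  have hY0 : 0 < Y := by positivity
  have hZ0 : 0 < Z := by positivity
  have h1 : U / (min N M) ^ (2 * n + 1) / (T / (C₂ * M ^ 2)) ^ (n + 1) ≤ C₂ ^ (n + 1) * Z := by
    calc _ = 1 / (min N M) ^ (2 * n + 1) * (C₂ ^ (n + 1) * (U / T ^ (n + 1) * M ^ (2 * n + 2))) := by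
          rw [div_pow, mul_pow, ← pow_mul, show 2 * (n + 1) = 2 * n + 2 by ring]
          field_simp
      _ ≤ (1 / N ^ (2 * n + 1) + 1 / M ^ (2 * n + 1)) *
          (C₂ ^ (n + 1) * (U / T ^ (n + 1) * M ^ (2 * n + 2))) := by
          gcongr
          exact one_div_min_pow_le hN hM _
      _ = _ := by rw [hZ, pow_succ M (2 * n + 1)]; field_simp
  have h2 : ∀ k ∈ Finset.range (2 * n + 1), U / (min N M) ^ k *
      (1 / a ^ (2 * n + 3 - k) + 1 / b ^ (2 * n + 3 - k)) / (T / (C₂ * M ^ 2)) ^ (n + 2)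
      ≤ 2 * C₂ ^ (n + 2) * (X + Y) := by
    intro k hk
    have hk' : k ≤ 2 * n := by have := Finset.mem_range.1 hk; omega
    calc _ = (1 / (min N M) ^ k * (1 / a ^ (2 * n + 3 - k))
          + 1 / (min N M) ^ k * (1 / b ^ (2 * n + 3 - k)))
          * (C₂ ^ (n + 2) * (U * M ^ (2 * n + 4) / T ^ (n + 2))) := by
          rw [div_pow, mul_pow, ← pow_mul, show 2 * (n + 2) = 2 * n + 4 by ring]
          field_simp
      _ ≤ (2 * (1 / a ^ (2 * n + 3)) + 1 / N ^ (2 * n) * (1 / a ^ 3)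
          + (2 * (1 / b ^ (2 * n + 3)) + 1 / N ^ (2 * n) * (1 / b ^ 3)))
          * (C₂ ^ (n + 2) * (U * M ^ (2 * n + 4) / T ^ (n + 2))) := by
          gcongr
          · exact one_div_min_pow_mul_le hN ha haM hk'
          · exact one_div_min_pow_mul_le hN hb hbM hk'
      _ = C₂ ^ (n + 2) * (2 * X + Y) := by rw [hX, hY]; field_simp; ring
      _ ≤ C₂ ^ (n + 2) * (2 * X + 2 * Y) := by gcongr; linarith
      _ = _ := by ring
  have h3 := Finset.sum_le_sum h2
  rw [Finset.sum_const, Finset.card_range, nsmul_eq_mul] at h3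
  push_cast at h3
  have h4 : 0 ≤ C₂ ^ (n + 1) * (X + Y) := by positivity
  have h5 : 0 ≤ (2 * n + 1) * 2 * C₂ ^ (n + 2) * Z := by positivity
  refine (add_le_add h1 h3).trans ?_
  linear_combination h4 + h5

/-- A derivative that is negative before `γ` and positive after it vanishes at `γ`. -/
theorem eq_zero_of_sign_change {F : ℝ → ℝ} {α β γ : ℝ} (hα : α < γ) (hβ : γ < β)
    (hF : ContinuousOn F (Icc α β)) (hneg : ∀ x ∈ Ico α γ, F x < 0)
    (hpos : ∀ x ∈ Ioc γ β, 0 < F x) : F γ = 0 := by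
  have hγ : ContinuousAt F γ := hF.continuousAt (Icc_mem_nhds hα hβ)
  apply le_antisymm
  · refine le_of_tendsto (hγ.tendsto.mono_left (nhdsWithin_le_nhds (s := Iio γ))) ?_
    filter_upwards [Ioo_mem_nhdsLT hα] with x hx using (hneg x ⟨hx.1.le, hx.2⟩).le
  · refine ge_of_tendsto (hγ.tendsto.mono_left (nhdsWithin_le_nhds (s := Ioi γ))) ?_
    filter_upwards [Ioo_mem_nhdsGT hβ] with x hx using (hpos x ⟨hx.1, hx.2.le⟩).le

end StationaryPhase

theorem theorem1p2 :
    ∃ c : ℕ → ℕ → ℕ → ℝ,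
    ∀ n : ℕ, 2 ≤ n →
    ∀ C : ℕ → ℝ, (∀ r : ℕ, r ≤ 2 * n + 3 → 0 < C r) →
    ∃ K : ℝ, 0 < K ∧
    ∀ (α β γ M N T U : ℝ) (f g : ℝ → ℝ),
      0 < M → 0 < N → 0 < T → 0 < U →
      β - α ≤ M →
      α < γ → γ < β →
      ContDiffOn ℝ ((2 * n + 3 : ℕ) : WithTop ℕ∞) f (Set.Icc α β) →
      ContDiffOn ℝ ((2 * n + 1 : ℕ) : WithTop ℕ∞) g (Set.Icc α β) →
      (∀ r : ℕ, 2 ≤ r → r ≤ 2 * n + 3 → ∀ x ∈ Set.Icc α β,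
        |iteratedDerivWithin r f (Set.Icc α β) x| ≤ C r * (T / M ^ r)) →
      (∀ x ∈ Set.Icc α β, T / (C 2 * M ^ 2) ≤ iteratedDerivWithin 2 f (Set.Icc α β) x) →
      (∀ s : ℕ, s ≤ 2 * n + 1 → ∀ x ∈ Set.Icc α β,
        |iteratedDerivWithin s g (Set.Icc α β) x| ≤ C s * (U / N ^ s)) →
      (∀ x ∈ Set.Ico α γ, derivWithin f (Set.Icc α β) x < 0) →
      (∀ x ∈ Set.Ioc γ β, 0 < derivWithin f (Set.Icc α β) x) →
      1 < T ^ ((1 : ℝ) / (2 * (n : ℝ) + 3)) * StationaryPhase.Delta n C →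
      ‖(∫ x in α..β, (g x : ℂ) * StationaryPhase.e (f x))
          - (StationaryPhase.mainTerm c n α β γ f g
            + (StationaryPhase.boundary n α β f g β
              - StationaryPhase.boundary n α β f g α))‖
        ≤ K *
          (U * M ^ (2 * n + 5) / (T ^ (n + 2) * N ^ (n + 2))
              * (1 / (γ - α) ^ (n + 2) + 1 / (β - γ) ^ (n + 2))
            + U * M ^ (2 * n + 4) / T ^ (n + 2)
              * (1 / (γ - α) ^ (2 * n + 3) + 1 / (β - γ) ^ (2 * n + 3))
            + U * M ^ (2 * n + 4) / (T ^ (n + 2) * N ^ (2 * n))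
              * (1 / (γ - α) ^ 3 + 1 / (β - γ) ^ 3)
            + U / T ^ (n + 1) * (M ^ (2 * n + 2) / N ^ (2 * n + 1) + M)) := by
  refine ⟨StationaryPhase.saddleCoef, fun n hn C hC => ?_⟩
  have hC2 : 0 < C 2 := hC 2 (by omega)
  -- one constant that dominates all `C r`
  set D := ∑ r ∈ Finset.range (2 * n + 4), |C r| with hDdef
  have hCD : ∀ r ≤ 2 * n + 3, C r ≤ D := fun r hr => (le_abs_self _).trans
    (Finset.single_le_sum (f := fun r => |C r|) (fun i _ => abs_nonneg _)
      (Finset.mem_range.2 (by omega)))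
  have hD : 0 < D := hC2.trans_le (hCD 2 (by omega))
  obtain ⟨K, hK, hcore⟩ := StationaryPhase.IsStationaryPhase.exists_expansion_bound n (by omega)
    (mul_pos hC2 hD) hD
  refine ⟨K * (C 2 ^ (n + 1) + (2 * n + 1) * 2 * C 2 ^ (n + 2)), by positivity, ?_⟩
  intro α β γ M N T U f g hM hN hT hU hlen hαγ hγβ hf hg hfb hf2 hgb hneg hpos _
  have hS := uniqueDiffOn_Icc (hαγ.trans hγβ)
  have hd2 : ∀ x, iteratedDerivWithin 2 f (Icc α β) x
      = derivWithin (derivWithin f (Icc α β)) (Icc α β) x := fun x => by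
    rw [iteratedDerivWithin_succ', iteratedDerivWithin_succ', iteratedDerivWithin_zero]
  have hf1 : ContDiffOn ℝ ((2 * n + 2 : ℕ) : WithTop ℕ∞) (derivWithin f (Icc α β)) (Icc α β) :=
    hf.derivWithin hS (by norm_cast)
  have hf2c : ContDiffOn ℝ ((2 * n + 1 : ℕ) : WithTop ℕ∞)
      (derivWithin (derivWithin f (Icc α β)) (Icc α β)) (Icc α β) :=
    hf1.derivWithin hS (by norm_cast)
  have hdata : StationaryPhase.IsStationaryPhase n (C 2 * D) D α β γ (T / (C 2 * M ^ 2)) M N U f g :=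
    { left_lt := hαγ
      lt_right := hγβ
      A_pos := by positivity
      M_pos := hM
      N_pos := hN
      U_pos := hU
      length_le := hlen
      differentiableOn := hf.differentiableOn (by norm_cast)
      differentiableOn_deriv := hf1.differentiableOn (by norm_cast)
      deriv_center :=
        StationaryPhase.eq_zero_of_sign_change hαγ hγβ hf1.continuousOn hneg hpos
      phase_symbol := by
        refine ⟨hf2c, fun k hk x hx => ?_⟩
        have h1 := hfb (k + 2) (by omega) (by omega) x hx
        rw [iteratedDerivWithin_succ', iteratedDerivWithin_succ'] at h1
        refine h1.trans ?_
        calc C (k + 2) * (T / M ^ (k + 2)) ≤ D * (T / M ^ (k + 2)) := by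
              gcongr
              exact hCD _ (by omega)
          _ = _ := by rw [pow_add]; field_simp
      le_second_deriv := fun x hx => hd2 x ▸ hf2 x hx
      amplitude_symbol := by
        refine ⟨hg, fun k hk x hx => (hgb k hk x hx).trans ?_⟩
        rw [mul_div_assoc]
        gcongr
        exact hCD _ (by omega) }
  have ha : 0 < γ - α := sub_pos.2 hαγ
  have hb : 0 < β - γ := sub_pos.2 hγβ
  refine (hcore α β γ _ M N U f g hdata).trans ?_
  rw [mul_assoc K]
  refine mul_le_mul_of_nonneg_left ((StationaryPhase.normalized_error_le n hC2 hM hN hT hU ha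
    (by linarith) hb (by linarith)).trans ?_) hK.le
  -- the term with `M ^ (2 * n + 5)` is nonnegative and is not needed for the bound
  gcongr
  have : 0 ≤ U * M ^ (2 * n + 5) / (T ^ (n + 2) * N ^ (n + 2))
      * (1 / (γ - α) ^ (n + 2) + 1 / (β - γ) ^ (n + 2)) := by positivity
  linarith
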